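/- Let $M$ be a compact 4-dimensional Riemannian spin manifold (smooth, without boundary) with spinor bundle $S$, Clifford multiplication by self-adjoint $\gamma^\mu$, spin connection $\nabla^S$, charge conjugation $J_M$ and chirality $\gamma_5$; let $N\ge 1$. Let $B\to M$ be an endomorphism bundle, i.e. a smooth $*$-algebra bundle that is locally trivial, as a $*$-algebra bundle, with fibre $M_N(\mathbb C)$. Give each fibre $B_x$ its normalized trace $\tau_x$ and the inner product $\langle a,b\rangle=\tau_x(a^*b)$. Let $\nabla^B$ be a hermitian $*$-algebra connection on $B$, i.e. a smooth connection, compatible with this inner product, with $\nabla^B(st)=s\nabla^B t+(\nabla^B s)t$ and $(\nabla^B s)^*=\nabla^B s^*$. The spectral triple of $(B,\nabla^B)$ is the quintuple $$\big(\Gamma(M,B),\ L^2(M,B\otimes S),\ D_B,\ J,\ \gamma_B\big),$$ where $\Gamma(M,B)$ acts by left multiplication, $D_B$ is the closure of the twisted Dirac operator $i\gamma^\mu(\nabla^B_\mu\otimes1+1\otimes\nabla^S_\mu)$ on $\Gamma(M,B\otimes S)$, $J(s\otimes\psi)=s^*\otimes J_M\psi$ and $\gamma_B=1\otimes\gamma_5$.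 A $PSU(N)$-gauge theory on $M$ is a pair $(P,\omega)$ of a smooth principal $PSU(N)$-bundle $P\to M$ and a connection 1-form $\omega$ on it: an $\mathfrak{su}(N)$-valued 1-form $\omega_u$ on $U$ for each local trivialization $(U,\phi_U)$ of $P$, with $\omega_u=g_{uv}^{-1}dg_{uv}+g_{uv}^{-1}\omega_v g_{uv}$ on $U\cap V$, where $g_{uv}$ is the transition function from $(U,\phi_U)$ to $(V,\phi_V)$. We say that $(P,\omega)$ is obtained from the spectral triple of $(B,\nabla^B)$ if there is an isomorphism of $*$-algebra bundles $B\cong P\times_{PSU(N)}M_N(\mathbb C)$ under which $\nabla^B=d+[\omega_u,\cdot\,]$ in each local trivialization of $P$. Then: 1. From every spectral triple of the above form one obtains a $PSU(N)$-gauge theory $(P,\omega)$, unique up to isomorphism: there is a principal $PSU(N)$-bundle $P$ such that $B$ is an associated bundle of $P$, with a connection 1-form $\omega$ on $P$ induced by $\nabla^B$. 2. Conversely, every $PSU(N)$-gauge theory $(P,\omega)$ on $M$ is determined by such a spectral triple: there are an endomorphism bundle $B\cong P\times_{PSU(N)}M_N(\mathbb C)$ and a hermitian $*$-algebra connection $\nabla^B$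 on $B$, induced by $\omega$, with a spectral triple as above; and every gauge theory obtained from this spectral triple is isomorphic to $(P,\omega)$. -/

import Mathlib

open Bundle MeasureTheory
open scoped Manifold ContDiff TensorProduct

attribute [local instance] Matrix.normedAddCommGroup Matrix.normedSpace

/-! ## The group `PSU(N)` and its Lie algebra -/

/-- The `*`-algebra `M_N(ℂ)`; its involution `star` is the conjugate transpose. -/
abbrev Mat (N : ℕ) : Type := Matrix (Fin N) (Fin N) ℂ

/-- The special unitary group `SU(N)`. -/
abbrev SU (N : ℕ) : Type := Matrix.specialUnitaryGroup (Fin N) ℂ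

/-- The projective special unitary group `PSU(N) = SU(N) / Z(SU(N))`, with the quotient topology. -/
abbrev PSU (N : ℕ) : Type := SU N ⧸ Subgroup.center (SU N)

theorem exists_eq_smul_SU {N : ℕ} [NeZero N] (u : unitary (Mat N)) :
    ∃ (c : ℂ) (v : SU N), (u : Mat N) = c • (v : Mat N) := by
  obtain ⟨u, hu⟩ := u
  have hN : N ≠ 0 := NeZero.ne N
  obtain ⟨c, hc⟩ := IsAlgClosed.exists_pow_nat_eq u.det (Nat.pos_of_ne_zero hN)
  have hdet : star u.det * u.det = 1 := (Matrix.det_of_mem_unitary hu).1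
  have hcn : star c * c = 1 := by
    have h1 : ‖u.det‖ = 1 := by
      have : ‖star u.det * u.det‖ = 1 := by rw [hdet]; simp
      rw [norm_mul, norm_star] at this
      nlinarith [norm_nonneg u.det]
    have h2 : ‖c‖ = 1 := by
      rw [← hc, norm_pow] at h1
      exact (pow_eq_one_iff_of_nonneg (norm_nonneg c) hN).1 h1
    have := Complex.conj_mul' c
    simp only [h2] at this
    simpa using this
  refine ⟨c, ⟨star c • u, ?_, ?_⟩, ?_⟩
  · change star c • u ∈ Matrix.unitaryGroup (Fin N) ℂ
    rw [Matrix.mem_unitaryGroup_iff]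
    have := Matrix.mem_unitaryGroup_iff.1 hu
    rw [star_smul, smul_mul_smul_comm, this, star_star, hcn, one_smul]
  · change (star c • u).det = 1
    rw [Matrix.det_smul, Fintype.card_fin, ← hc, ← mul_pow, hcn, one_pow]
  · change u = c • (star c • u)
    rw [smul_smul, mul_comm, hcn, one_smul]

theorem commute_of_mem_center_SU {N : ℕ} [NeZero N] {z : SU N} (hz : z ∈ Subgroup.center (SU N))
    (m : Mat N) : (z : Mat N) * m = m * (z : Mat N) := by
  open scoped Matrix.Norms.L2Operator in
  have hm : m ∈ Submodule.span ℂ (unitary (Mat N) : Set (Mat N)) := by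
    rw [CStarAlgebra.span_unitary]; trivial
  induction hm using Submodule.span_induction with
  | mem u hu =>
    obtain ⟨c, v, hv⟩ := exists_eq_smul_SU ⟨u, hu⟩
    have h : (v : Mat N) * z = z * v := congrArg Subtype.val (Subgroup.mem_center_iff.1 hz v)
    change u = _ at hv
    rw [hv, mul_smul_comm, smul_mul_assoc, h]
  | zero => simp
  | add a b _ _ ha hb => rw [mul_add, add_mul, ha, hb]
  | smul c a _ ha => rw [mul_smul_comm, smul_mul_assoc, ha]

/-- The action of `SU(N)` on `M_N(ℂ)` by `*`-automorphisms, `u · m = u m u*`. -/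
noncomputable def SU.conj (N : ℕ) : SU N →* (Mat N ≃⋆ₐ[ℂ] Mat N) :=
  (Unitary.conjStarAlgAut ℂ (Mat N)).comp
    (Submonoid.inclusion (Matrix.specialUnitaryGroup_le_unitaryGroup (n := Fin N) (α := ℂ)))

/-- The usual action of `PSU(N)` on `M_N(ℂ)` by `*`-automorphisms: the class of `u` acts as
`m ↦ u m u*`. -/
noncomputable def PSU.conj (N : ℕ) [NeZero N] : PSU N →* (Mat N ≃⋆ₐ[ℂ] Mat N) :=
  QuotientGroup.lift (Subgroup.center (SU N)) (SU.conj N) fun z hz => by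
    ext1 m
    change (z : Mat N) * m * star (z : Mat N) = m
    rw [commute_of_mem_center_SU hz, mul_assoc, (Matrix.mem_unitaryGroup_iff.1 z.2.1), mul_one]

theorem PSU.conj_mk (N : ℕ) [NeZero N] (u : SU N) (m : Mat N) :
    PSU.conj N (QuotientGroup.mk u) m = (u : Mat N) * m * star (u : Mat N) := rfl

/-- The Lie algebra `𝔰𝔲(N)` of `PSU(N)`: traceless anti-Hermitian matrices. It acts on `M_N(ℂ)` by
the (injective) derived representation `a ↦ [a, ·]` of `PSU.conj`. -/
def suLie (N : ℕ) : Set (Mat N) := {a | star a = -a ∧ a.trace = 0}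

/-! ## Smooth 4-manifolds -/

/-- The model space of 4-manifolds. -/
abbrev E4 : Type := EuclideanSpace ℝ (Fin 4)

section Manifold

variable {M : Type*} [TopologicalSpace M] [ChartedSpace E4 M]

/-- Mathlib's fibre bundles whose model fibre carries the topology of its norm. -/
abbrev NormedFiberBundle (F : Type*) [NormedAddCommGroup F] (V : M → Type*)
    [TopologicalSpace (TotalSpace F V)] [∀ x, TopologicalSpace (V x)] : Type _ :=
  FiberBundle F V

/-- `σ` is a smooth section over `U` of the smooth vector bundle `V` with model fibre `F`. -/
def SmoothSectionOn (F : Type*) [NormedAddCommGroup F] [NormedSpace ℝ F] {V : M → Type*}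
    [TopologicalSpace (TotalSpace F V)] [∀ x, TopologicalSpace (V x)] [FiberBundle F V]
    (σ : ∀ x, V x) (U : Set M) : Prop :=
  ContMDiffOn 𝓘(ℝ, E4) (𝓘(ℝ, E4).prod 𝓘(ℝ, F)) ∞ (fun x => TotalSpace.mk' F x (σ x)) U

/-- Smooth vector fields. -/
def SmoothVectorField [IsManifold 𝓘(ℝ, E4) ∞ M] (X : ∀ x : M, TangentSpace 𝓘(ℝ, E4) x) : Prop :=
  SmoothSectionOn E4 X Set.univ

/-- `f` is a smooth function on `U` with values in the normed space `F`. -/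
def SmoothFunOn {F : Type*} [NormedAddCommGroup F] [NormedSpace ℝ F] (f : M → F) (U : Set M) :
    Prop :=
  ContMDiffOn 𝓘(ℝ, E4) 𝓘(ℝ, F) ∞ f U

/-- A `M_N(ℂ)`-valued 1-form on `M` (or on an open subset of `M`, with junk values outside). -/
abbrev MatForm (M : Type*) [TopologicalSpace M] [ChartedSpace E4 M] (N : ℕ) : Type _ :=
  ∀ x : M, TangentSpace 𝓘(ℝ, E4) x →L[ℝ] Mat N

/-- `α` is a smooth `𝔰𝔲(N)`-valued 1-form on the open set `U`. -/
structure IsSuFormOn [IsManifold 𝓘(ℝ, E4) ∞ M] {N : ℕ} (α : MatForm M N) (U : Set M) : Prop where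
  mem : ∀ x ∈ U, ∀ v, α x v ∈ suLie N
  smooth : ∀ X : ∀ x : M, TangentSpace 𝓘(ℝ, E4) x, SmoothVectorField X →
    SmoothFunOn (fun x => α x (X x)) U

/-- Smoothness on `U` of a map to the Lie group `PSU(N)`, whose Lie group structure is the one for
which `PSU.conj` is a closed embedding of `PSU(N)` into the linear group of `M_N(ℂ)`. -/
def SmoothPSUOn {N : ℕ} [NeZero N] (g : M → PSU N) (U : Set M) : Prop :=
  ∀ m : Mat N, SmoothFunOn (fun x => PSU.conj N (g x) m) U

/-- The relation `α = g⁻¹ dg + g⁻¹ β g` on `U` between 1-forms with values in the Lie algebra of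
the matrix group `PSU(N) ⊂ GL(M_N(ℂ))`, tested on matrices `m`: `a ∈ 𝔰𝔲(N)` acts as `[a, m]`. -/
def GaugeRelatedOn {N : ℕ} [NeZero N] (U : Set M) (g : M → PSU N) (α β : MatForm M N) : Prop :=
  ∀ x ∈ U, ∀ (v : TangentSpace 𝓘(ℝ, E4) x) (m : Mat N),
    ⁅α x v, m⁆ =
      PSU.conj N (g x)⁻¹ (mvfderiv 𝓘(ℝ, E4) (fun y => PSU.conj N (g y) m) x v) +
      ⁅PSU.conj N (g x)⁻¹ (β x v), m⁆

end Manifold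

/-! ## Principal `PSU(N)`-bundles and gauge theories -/

/-- A smooth principal `PSU(N)`-bundle over `M`: a space with a right action of `PSU(N)`, a
projection to `M`, and a maximal smooth atlas of equivariant local trivializations. -/
structure PrincipalPSUBundle.{u, w} (M : Type u) [TopologicalSpace M] [ChartedSpace E4 M]
    (N : ℕ) [NeZero N] where
  Total : Type w
  [top : TopologicalSpace Total]
  /-- right action `p ◁ g` -/
  act : Total → PSU N → Total
  act_one : ∀ p, act p 1 = p
  act_mul : ∀ p g h, act p (g * h) = act (act p g) h
  proj : Total → M
  proj_act : ∀ p g, proj (act p g) = proj p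
  /-- the local trivializations `π⁻¹(U) ≃ U × PSU(N)` -/
  trivs : Set (Trivialization (PSU N) proj)
  cover : ∀ x, ∃ e ∈ trivs, x ∈ e.baseSet
  equivariant : ∀ e ∈ trivs, ∀ p, proj p ∈ e.baseSet → ∀ g, (e (act p g)).2 = (e p).2 * g
  smooth : ∀ e ∈ trivs, ∀ e' ∈ trivs,
    SmoothPSUOn (fun x => (e' (e.toOpenPartialHomeomorph.symm (x, 1))).2) (e.baseSet ∩ e'.baseSet)
  maximal : ∀ e : Trivialization (PSU N) proj,
    (∀ p, proj p ∈ e.baseSet → ∀ g, (e (act p g)).2 = (e p).2 * g) →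
    (∀ e' ∈ trivs,
      SmoothPSUOn (fun x => (e' (e.toOpenPartialHomeomorph.symm (x, 1))).2)
        (e.baseSet ∩ e'.baseSet) ∧
      SmoothPSUOn (fun x => (e (e'.toOpenPartialHomeomorph.symm (x, 1))).2)
        (e'.baseSet ∩ e.baseSet)) →
    e ∈ trivs

attribute [instance] PrincipalPSUBundle.top

namespace PrincipalPSUBundle

variable {M : Type*} [TopologicalSpace M] [ChartedSpace E4 M] {N : ℕ} [NeZero N]
  (P : PrincipalPSUBundle M N)

/-- The local section of `P` over `e.baseSet` at which the local trivialization `e` equals `1`. -/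
noncomputable def localSection {P : PrincipalPSUBundle M N} (e : Trivialization (PSU N) P.proj)
    (x : M) : P.Total :=
  e.toOpenPartialHomeomorph.symm (x, 1)

/-- The transition function from `e` to `e'`: in fibre coordinates `h' = transition e e' * h`. -/
noncomputable def transition {P : PrincipalPSUBundle M N} (e e' : Trivialization (PSU N) P.proj)
    (x : M) : PSU N :=
  (e' (localSection e x)).2

/-- The fibre of `P` over `x`. -/
def FiberAt (x : M) : Type _ := {p : P.Total // P.proj p = x}

/-- The equivalence relation `(p ◁ g, m) ∼ (p, g · m)` on `P_x × M_N(ℂ)`. -/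
def assocSetoid (x : M) : Setoid (P.FiberAt x × Mat N) where
  r a b := ∃ g : PSU N, b.1.1 = P.act a.1.1 g ∧ a.2 = PSU.conj N g b.2
  iseqv :=
    { refl := fun a => ⟨1, by rw [P.act_one], by simp⟩
      symm := by
        rintro a b ⟨g, h1, h2⟩
        refine ⟨g⁻¹, ?_, ?_⟩
        · rw [h1, ← P.act_mul, mul_inv_cancel, P.act_one]
        · rw [h2, ← StarAlgEquiv.mul_apply, ← map_mul, inv_mul_cancel, map_one]; rfl
      trans := by
        rintro a b c ⟨g, h1, h2⟩ ⟨h, h3, h4⟩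
        refine ⟨g * h, ?_, ?_⟩
        · rw [h3, h1, P.act_mul]
        · rw [h2, h4, map_mul]; rfl }

/-- The fibre over `x` of the associated bundle `P ×_{PSU(N)} M_N(ℂ)`. -/
def AssocFiber (x : M) : Type _ := Quotient (P.assocSetoid x)

/-- The class `[p, m]`. -/
def assocMk {P : PrincipalPSUBundle M N} {x : M} (p : P.FiberAt x) (m : Mat N) : P.AssocFiber x :=
  Quotient.mk (P.assocSetoid x) (p, m)

end PrincipalPSUBundle

open PrincipalPSUBundle in
/-- A `PSU(N)`-gauge theory `(P, ω)`: a principal `PSU(N)`-bundle with a connection 1-form, i.e.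
an `𝔰𝔲(N)`-valued 1-form `ω_e` on the base of each local trivialization `e` such that
`ω_e = g⁻¹ dg + g⁻¹ ω_{e'} g` on overlaps, `g` being the transition function from `e` to `e'`. -/
structure GaugeTheory.{u, w} (M : Type u) [TopologicalSpace M] [ChartedSpace E4 M]
    [IsManifold 𝓘(ℝ, E4) ∞ M] (N : ℕ) [NeZero N] where
  P : PrincipalPSUBundle.{u, w} M N
  form : Trivialization (PSU N) P.proj → MatForm M N
  isSuForm : ∀ e ∈ P.trivs, IsSuFormOn (form e) e.baseSet
  transform : ∀ e ∈ P.trivs, ∀ e' ∈ P.trivs,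
    GaugeRelatedOn (e.baseSet ∩ e'.baseSet) (transition e e') (form e) (form e')

open PrincipalPSUBundle in
/-- Isomorphisms of gauge theories over `M`: smooth isomorphisms of principal bundles over `id_M`
that match the connections. `localRep e e'` is the expression of the map in the local
trivializations `e` and `e'`. -/
structure GaugeTheory.Iso {M : Type*} [TopologicalSpace M] [ChartedSpace E4 M]
    [IsManifold 𝓘(ℝ, E4) ∞ M] {N : ℕ} [NeZero N] (G G' : GaugeTheory M N) where
  toHomeo : G.P.Total ≃ₜ G'.P.Total
  proj_eq : ∀ p, G'.P.proj (toHomeo p) = G.P.proj p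
  map_act : ∀ p g, toHomeo (G.P.act p g) = G'.P.act (toHomeo p) g
  smooth : ∀ e ∈ G.P.trivs, ∀ e' ∈ G'.P.trivs,
    SmoothPSUOn (fun x => (e' (toHomeo (localSection e x))).2) (e.baseSet ∩ e'.baseSet)
  map_form : ∀ e ∈ G.P.trivs, ∀ e' ∈ G'.P.trivs,
    GaugeRelatedOn (e.baseSet ∩ e'.baseSet) (fun x => (e' (toHomeo (localSection e x))).2)
      (G.form e) (G'.form e')

/-! ## Endomorphism bundles and hermitian `*`-algebra connections -/

/-- A smooth unital `*`-algebra bundle over `M` that is locally trivial, as a `*`-algebra bundle,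
with fibre `M_N(ℂ)`. -/
structure EndBundle.{u, v} (M : Type u) [TopologicalSpace M] [ChartedSpace E4 M]
    [IsManifold 𝓘(ℝ, E4) ∞ M] (N : ℕ) where
  Fiber : M → Type v
  [ring : ∀ x, Ring (Fiber x)]
  [algebra : ∀ x, Algebra ℂ (Fiber x)]
  [starRing : ∀ x, StarRing (Fiber x)]
  [starModule : ∀ x, StarModule ℂ (Fiber x)]
  [topFiber : ∀ x, TopologicalSpace (Fiber x)]
  [topAddGroup : ∀ x, IsTopologicalAddGroup (Fiber x)]
  [contSMul : ∀ x, ContinuousSMul ℝ (Fiber x)]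
  [topTotal : TopologicalSpace (TotalSpace (Mat N) Fiber)]
  [fiberBundle : NormedFiberBundle (Mat N) Fiber]
  [vectorBundle : VectorBundle ℝ (Mat N) Fiber]
  [smoothBundle : ContMDiffVectorBundle ∞ (Mat N) Fiber 𝓘(ℝ, E4)]
  smul_smooth : ∀ (c : ℂ) (s : ∀ x, Fiber x), SmoothSectionOn (Mat N) s Set.univ →
    SmoothSectionOn (Mat N) (c • s) Set.univ
  one_smooth : SmoothSectionOn (Mat N) (1 : ∀ x, Fiber x) Set.univ
  mul_smooth : ∀ s t : ∀ x, Fiber x, SmoothSectionOn (Mat N) s Set.univ →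
    SmoothSectionOn (Mat N) t Set.univ → SmoothSectionOn (Mat N) (s * t) Set.univ
  star_smooth : ∀ s : ∀ x, Fiber x, SmoothSectionOn (Mat N) s Set.univ →
    SmoothSectionOn (Mat N) (star s) Set.univ
  locTriv : ∀ x : M, ∃ U : Set M, IsOpen U ∧ x ∈ U ∧ ∃ Θ : ∀ y, Mat N ≃⋆ₐ[ℂ] Fiber y,
    ∀ m, SmoothSectionOn (Mat N) (fun y => Θ y m) U

namespace EndBundle

attribute [instance] ring algebra starRing starModule topFiber topAddGroup contSMul topTotal
  fiberBundle vectorBundle smoothBundle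

variable {M : Type*} [TopologicalSpace M] [ChartedSpace E4 M] [IsManifold 𝓘(ℝ, E4) ∞ M] {N : ℕ}
  (B : EndBundle M N)

/-- The `*`-algebra `Γ(M, B)` of smooth sections. -/
def sections : StarSubalgebra ℂ (∀ x, B.Fiber x) where
  carrier := {s | SmoothSectionOn (Mat N) s Set.univ}
  mul_mem' hs ht := B.mul_smooth _ _ hs ht
  add_mem' hs ht := ContMDiffOn.add_section hs ht
  algebraMap_mem' c := by
    rw [Algebra.algebraMap_eq_smul_one]
    exact B.smul_smooth c _ B.one_smooth
  star_mem' hs := B.star_smooth _ hs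

/-- The tracial state `τ_x` on `B_x ≅ M_N(ℂ)`, i.e. the normalized trace, written intrinsically as
`τ_x(a) = Tr(b ↦ a b) / N²`. -/
noncomputable def tau (x : M) (a : B.Fiber x) : ℂ :=
  LinearMap.trace ℂ (B.Fiber x) (LinearMap.mulLeft ℂ a) / (N : ℂ) ^ 2

end EndBundle

/-- A hermitian `*`-algebra connection on `B`: a smooth complex connection `∇` with
`∇(st) = s ∇t + (∇s) t` and `(∇s)* = ∇s*`, compatible with the Hilbert-Schmidt inner product
`⟨a, b⟩ = τ(a* b)` of the fibres. -/
structure StarConnection {M : Type*} [TopologicalSpace M] [ChartedSpace E4 M]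
    [IsManifold 𝓘(ℝ, E4) ∞ M] {N : ℕ} (B : EndBundle M N) where
  cov : CovariantDerivative 𝓘(ℝ, E4) (Mat N) B.Fiber
  smooth : CovariantDerivative.ContMDiffCovariantDerivative cov ∞
  map_smul : ∀ (c : ℂ) (s : B.sections) (x : M) (v : TangentSpace 𝓘(ℝ, E4) x),
    cov (c • s : B.sections) x v = c • cov s x v
  leibniz : ∀ (s t : B.sections) (x : M) (v : TangentSpace 𝓘(ℝ, E4) x),
    cov (s * t : B.sections) x v = s.1 x * cov t x v + cov s x v * t.1 x
  map_star : ∀ (s : B.sections) (x : M) (v : TangentSpace 𝓘(ℝ, E4) x),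
    cov (star s : B.sections) x v = star (cov s x v)
  hermitian : ∀ (s t : B.sections) (x : M) (v : TangentSpace 𝓘(ℝ, E4) x),
    mvfderiv 𝓘(ℝ, E4) (fun y => B.tau y (star (s.1 y) * t.1 y)) x v =
      B.tau x (star (cov s x v) * t.1 x) + B.tau x (star (s.1 x) * cov t x v)

/-! ## Riemannian spin structures in dimension 4 -/


/-- The model fibre of the spinor bundle in dimension 4. -/
abbrev Spinor : Type := EuclideanSpace ℂ (Fin 4)

/-- A spin structure on the Riemannian 4-manifold `M`, given by its spinor bundle: a hermitian
complex vector bundle `S` of rank 4 (so an irreducible Clifford module in each fibre) with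
* Clifford multiplication `γ(v)`, self-adjoint, `γ(v)² = |v|²`;
* the chirality operator `γ₅` (which is `± γ(e₁)γ(e₂)γ(e₃)γ(e₄)` for orthonormal frames `e`,
  and so fixes the orientation of `M`);
* charge conjugation `J_M`, fibrewise antiunitary with `J_M² = -1` and `J_M γ(v) = - γ(v) J_M`;
* the Levi-Civita connection of `M` and the spin connection `∇^S`, which is the unique hermitian
  connection on `S` that satisfies the Leibniz rule for `γ` and commutes with `J_M`. -/
structure SpinStructure.{u, s} (M : Type u) [TopologicalSpace M] [ChartedSpace E4 M]
    [IsManifold 𝓘(ℝ, E4) ∞ M] [RiemannianBundle (fun x : M => TangentSpace 𝓘(ℝ, E4) x)] where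
  Fiber : M → Type s
  [normedAddCommGroup : ∀ x, NormedAddCommGroup (Fiber x)]
  [innerProductSpace : ∀ x, InnerProductSpace ℂ (Fiber x)]
  [topTotal : TopologicalSpace (TotalSpace Spinor Fiber)]
  [fiberBundle : FiberBundle Spinor Fiber]
  [vectorBundle : VectorBundle ℝ Spinor Fiber]
  [smoothBundle : ContMDiffVectorBundle ∞ Spinor Fiber 𝓘(ℝ, E4)]
  smul_smooth : ∀ (c : ℂ) (ψ : ∀ x, Fiber x), SmoothSectionOn Spinor ψ Set.univ →
    SmoothSectionOn Spinor (c • ψ) Set.univ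
  locTriv : ∀ x : M, ∃ U : Set M, IsOpen U ∧ x ∈ U ∧ ∃ Θ : ∀ y, Spinor ≃ₗᵢ[ℂ] Fiber y,
    ∀ w, SmoothSectionOn Spinor (fun y => Θ y w) U
  clifford : ∀ x, TangentSpace 𝓘(ℝ, E4) x →ₗ[ℝ] (Fiber x →ₗ[ℂ] Fiber x)
  clifford_sq : ∀ x v ψ, clifford x v (clifford x v ψ) = ((inner ℝ v v : ℝ) : ℂ) • ψ
  clifford_symm : ∀ x v ψ φ, inner ℂ (clifford x v ψ) φ = inner ℂ ψ (clifford x v φ)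
  clifford_smooth : ∀ (X : ∀ x : M, TangentSpace 𝓘(ℝ, E4) x) (ψ : ∀ x, Fiber x),
    SmoothVectorField X → SmoothSectionOn Spinor ψ Set.univ →
    SmoothSectionOn Spinor (fun x => clifford x (X x) (ψ x)) Set.univ
  chirality : ∀ x, Fiber x →ₗ[ℂ] Fiber x
  chirality_sq : ∀ x ψ, chirality x (chirality x ψ) = ψ
  chirality_symm : ∀ x ψ φ, inner ℂ (chirality x ψ) φ = inner ℂ ψ (chirality x φ)
  chirality_clifford : ∀ x v ψ,
    chirality x (clifford x v ψ) = -clifford x v (chirality x ψ)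
  chirality_smooth : ∀ ψ : ∀ x, Fiber x, SmoothSectionOn Spinor ψ Set.univ →
    SmoothSectionOn Spinor (fun x => chirality x (ψ x)) Set.univ
  conj : ∀ x, Fiber x →ₛₗ[starRingEnd ℂ] Fiber x
  conj_sq : ∀ x ψ, conj x (conj x ψ) = -ψ
  conj_inner : ∀ x ψ φ, inner ℂ (conj x ψ) (conj x φ) = inner ℂ φ ψ
  conj_clifford : ∀ x v ψ, conj x (clifford x v ψ) = -clifford x v (conj x ψ)
  conj_smooth : ∀ ψ : ∀ x, Fiber x, SmoothSectionOn Spinor ψ Set.univ →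
    SmoothSectionOn Spinor (fun x => conj x (ψ x)) Set.univ
  leviCivita : CovariantDerivative 𝓘(ℝ, E4) E4 (fun x : M => TangentSpace 𝓘(ℝ, E4) x)
  leviCivita_smooth : CovariantDerivative.ContMDiffCovariantDerivative leviCivita ∞
  leviCivita_torsion : leviCivita.torsion = 0
  leviCivita_metric : ∀ X Y : ∀ x : M, TangentSpace 𝓘(ℝ, E4) x, SmoothVectorField X →
    SmoothVectorField Y → ∀ (x : M) (v : TangentSpace 𝓘(ℝ, E4) x),
    mvfderiv 𝓘(ℝ, E4) (fun y => (inner ℝ (X y) (Y y) : ℝ)) x v =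
      inner ℝ (leviCivita X x v) (Y x) + inner ℝ (X x) (leviCivita Y x v)
  cov : CovariantDerivative 𝓘(ℝ, E4) Spinor Fiber
  cov_smooth : CovariantDerivative.ContMDiffCovariantDerivative cov ∞
  cov_smul : ∀ (c : ℂ) (ψ : ∀ x, Fiber x), SmoothSectionOn Spinor ψ Set.univ →
    ∀ x v, cov (c • ψ) x v = c • cov ψ x v
  cov_inner : ∀ ψ φ : ∀ x, Fiber x, SmoothSectionOn Spinor ψ Set.univ →
    SmoothSectionOn Spinor φ Set.univ → ∀ (x : M) (v : TangentSpace 𝓘(ℝ, E4) x),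
    mvfderiv 𝓘(ℝ, E4) (fun y => inner ℂ (ψ y) (φ y)) x v =
      inner ℂ (cov ψ x v) (φ x) + inner ℂ (ψ x) (cov φ x v)
  cov_clifford : ∀ (X : ∀ x : M, TangentSpace 𝓘(ℝ, E4) x) (ψ : ∀ x, Fiber x),
    SmoothVectorField X → SmoothSectionOn Spinor ψ Set.univ →
    ∀ (x : M) (v : TangentSpace 𝓘(ℝ, E4) x),
    cov (fun y => clifford y (X y) (ψ y)) x v =
      clifford x (leviCivita X x v) (ψ x) + clifford x (X x) (cov ψ x v)
  cov_conj : ∀ ψ : ∀ x, Fiber x, SmoothSectionOn Spinor ψ Set.univ →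
    ∀ (x : M) (v : TangentSpace 𝓘(ℝ, E4) x),
    cov (fun y => conj y (ψ y)) x v = conj x (cov ψ x v)

namespace SpinStructure

attribute [instance] normedAddCommGroup innerProductSpace topTotal fiberBundle vectorBundle
  smoothBundle

variable {M : Type*} [TopologicalSpace M] [ChartedSpace E4 M] [IsManifold 𝓘(ℝ, E4) ∞ M]
  [RiemannianBundle (fun x : M => TangentSpace 𝓘(ℝ, E4) x)] (S : SpinStructure M)

/-- The space `Γ(M, S)` of smooth spinor fields. -/
def sections : Submodule ℂ (∀ x, S.Fiber x) where
  carrier := {ψ | SmoothSectionOn Spinor ψ Set.univ}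
  add_mem' h h' := ContMDiffOn.add_section h h'
  zero_mem' := (contMDiff_zeroSection ℝ S.Fiber).contMDiffOn
  smul_mem' c _ h := S.smul_smooth c _ h

/-- The action of `J_M` on spinor fields. -/
def conjSection (ψ : S.sections) : S.sections := ⟨fun x => S.conj x (ψ.1 x), S.conj_smooth _ ψ.2⟩

/-- The action of `γ₅` on spinor fields. -/
def chiralSection (ψ : S.sections) : S.sections :=
  ⟨fun x => S.chirality x (ψ.1 x), S.chirality_smooth _ ψ.2⟩

end SpinStructure

/-! ## The Riemannian volume measure -/

section Volume

variable {M : Type*} [TopologicalSpace M] [ChartedSpace E4 M] [IsManifold 𝓘(ℝ, E4) ∞ M]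
  [RiemannianBundle (fun x : M => TangentSpace 𝓘(ℝ, E4) x)]

/-- The density `√det(g_ij)` of the metric in the chart at `c`. -/
noncomputable def chartDensity (c : M) (y : E4) : ℝ :=
  let φ := extChartAt 𝓘(ℝ, E4) c
  let d : Fin 4 → TangentSpace 𝓘(ℝ, E4) (φ.symm y) := fun i =>
    mfderiv 𝓘(ℝ, E4) 𝓘(ℝ, E4) φ.symm y (EuclideanSpace.single i (1 : ℝ) : E4)
  √(Matrix.of fun i j => inner ℝ (d i) (d j)).det

/-- The measure `√det(g_ij) dy` on the domain of the chart at `c`. -/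
noncomputable def chartVolume [MeasurableSpace M] (c : M) : Measure M :=
  ((volume.restrict (extChartAt 𝓘(ℝ, E4) c).target).withDensity
    fun y => ENNReal.ofReal (chartDensity c y)).map (extChartAt 𝓘(ℝ, E4) c).symm

variable (M) in
/-- The Riemannian volume measure of `M`: the local measures `√det(g_ij) dy`, glued by a smooth
partition of unity subordinate to the charts. -/
noncomputable def riemannianVolume [T2Space M] [CompactSpace M] [MeasurableSpace M] : Measure M :=
  let ρ := (SmoothPartitionOfUnity.exists_isSubordinate_chartAt_source 𝓘(ℝ, E4) M).choose
  Measure.sum fun c : M => (chartVolume c).withDensity fun x => ENNReal.ofReal (ρ c x)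

end Volume

/-! ## The spectral triple of an endomorphism bundle with connection -/

/-- The constituents `(A, H, D, J, γ)` of a real even spectral triple: a `*`-algebra represented on
a Hilbert space, an unbounded operator, an antiunitary operator and a grading operator. -/
structure SpectralTripleData.{a, h} (A : Type a) [Ring A] [StarRing A] [Algebra ℂ A] where
  H : Type h
  [normedAddCommGroup : NormedAddCommGroup H]
  [innerProductSpace : InnerProductSpace ℂ H]
  [complete : CompleteSpace H]
  rep : A →⋆ₐ[ℂ] (H →L[ℂ] H)
  D : H →ₗ.[ℂ] H
  J : H ≃ₛₗᵢ[starRingEnd ℂ] H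
  grading : H →L[ℂ] H

attribute [instance] SpectralTripleData.normedAddCommGroup SpectralTripleData.innerProductSpace
  SpectralTripleData.complete

/-- `D` is the closure of the operator `D₀`. -/
def SpectralTripleData.DiracIsClosureOf {A : Type*} [Ring A] [StarRing A] [Algebra ℂ A]
    (T : SpectralTripleData A) (D₀ : T.H →ₗ.[ℂ] T.H) : Prop :=
  T.D = D₀.closure

section Triple

variable {M : Type*} [TopologicalSpace M] [ChartedSpace E4 M] [IsManifold 𝓘(ℝ, E4) ∞ M]
  [RiemannianBundle (fun x : M => TangentSpace 𝓘(ℝ, E4) x)] {N : ℕ}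

/-- `Γ(M, B ⊗ S)`: by `Γ(M, B ⊗ S) = Γ(M, B) ⊗ Γ(M, S)` (tensor product over `C^∞(M)`), the smooth
sections are the finite sums of the sections `x ↦ s(x) ⊗ ψ(x)`. -/
def TwistedSpinors (S : SpinStructure M) (B : EndBundle M N) :
    Submodule ℂ (∀ x, B.Fiber x ⊗[ℂ] S.Fiber x) :=
  Submodule.span ℂ {ξ | ∃ (s : B.sections) (ψ : S.sections), ξ = fun x => s.1 x ⊗ₜ[ℂ] ψ.1 x}

/-- The section `s ⊗ ψ`. -/
def twist {S : SpinStructure M} {B : EndBundle M N} (s : B.sections) (ψ : S.sections) :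
    TwistedSpinors S B :=
  ⟨fun x => s.1 x ⊗ₜ[ℂ] ψ.1 x, Submodule.subset_span ⟨s, ψ, rfl⟩⟩

/-- The value at `x` of `D_B (s ⊗ ψ) = i ∑ γ^μ (∇^B_μ s ⊗ ψ + s ⊗ ∇^S_μ ψ)`, the twisted Dirac
operator, computed in an orthonormal basis `e_μ` of `T_x M`. -/
noncomputable def twistedDirac (S : SpinStructure M) {B : EndBundle M N} (nabla : StarConnection B)
    (s : B.sections) (ψ : S.sections) (x : M) : B.Fiber x ⊗[ℂ] S.Fiber x :=
  haveI : FiniteDimensional ℝ (TangentSpace 𝓘(ℝ, E4) x) :=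
    inferInstanceAs (FiniteDimensional ℝ E4)
  let e := stdOrthonormalBasis ℝ (TangentSpace 𝓘(ℝ, E4) x)
  Complex.I • ∑ μ, (nabla.cov s x (e μ) ⊗ₜ[ℂ] S.clifford x (e μ) (ψ.1 x) +
    s.1 x ⊗ₜ[ℂ] S.clifford x (e μ) (S.cov ψ x (e μ)))

/-- `T` is the quintuple `(Γ(M, B), L²(M, B ⊗ S), D_B, J, γ_B)`, where the completion
`L²(M, B ⊗ S)` of `Γ(M, B ⊗ S)` is given through the canonical map `ι` from `Γ(M, B ⊗ S)`:
* `⟨s ⊗ ψ, t ⊗ φ⟩ = ∫ ⟨s, t⟩_{B_x} ⟨ψ, φ⟩_{S_x}`, with `⟨s, t⟩_{B_x} = τ_x(s* t)`;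
* `a ∈ Γ(M, B)` acts by `a (s ⊗ ψ) = (a s) ⊗ ψ`;
* `J (s ⊗ ψ) = s* ⊗ J_M ψ` and `γ_B = 1 ⊗ γ₅`;
* `D_B` is the closure of the twisted Dirac operator with domain `Γ(M, B ⊗ S)`. -/
structure IsYangMillsTriple [T2Space M] [CompactSpace M] [MeasurableSpace M]
    (S : SpinStructure M) {B : EndBundle M N} (nabla : StarConnection B)
    (T : SpectralTripleData B.sections) (ι : TwistedSpinors S B →ₗ[ℂ] T.H) : Prop where
  dense : DenseRange ι
  inner_eq : ∀ (s t : B.sections) (ψ φ : S.sections),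
    inner ℂ (ι (twist s ψ)) (ι (twist t φ)) =
      ∫ x, B.tau x (star (s.1 x) * t.1 x) * inner ℂ (ψ.1 x) (φ.1 x) ∂riemannianVolume M
  rep_eq : ∀ (a s : B.sections) (ψ : S.sections),
    T.rep a (ι (twist s ψ)) = ι (twist (a * s) ψ)
  J_eq : ∀ (s : B.sections) (ψ : S.sections),
    T.J (ι (twist s ψ)) = ι (twist (star s) (S.conjSection ψ))
  grading_eq : ∀ (s : B.sections) (ψ : S.sections),
    T.grading (ι (twist s ψ)) = ι (twist s (S.chiralSection ψ))
  dirac_eq : ∃ D₀ : T.H →ₗ.[ℂ] T.H, T.DiracIsClosureOf D₀ ∧ D₀.domain = LinearMap.range ι ∧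
    ∀ (s : B.sections) (ψ : S.sections), ∃ ξ : TwistedSpinors S B,
      (∀ x, ξ.1 x = twistedDirac S nabla s ψ x) ∧
      ∀ h : ι (twist s ψ) ∈ D₀.domain, D₀ ⟨ι (twist s ψ), h⟩ = ι ξ

set_option linter.checkUnivs false in
/-- The spectral triples `(Γ(M, B), L²(M, B ⊗ S), D_B, J, γ_B)` with `B` an endomorphism bundle
with fibre `M_N(ℂ)`, and `D_B` built from a hermitian `*`-algebra connection `∇^B` on `B`. -/
structure YangMillsTriple.{u, s, v, h} {M : Type u} [TopologicalSpace M] [ChartedSpace E4 M]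
    [IsManifold 𝓘(ℝ, E4) ∞ M] [RiemannianBundle (fun x : M => TangentSpace 𝓘(ℝ, E4) x)]
    [T2Space M] [CompactSpace M] [MeasurableSpace M] (S : SpinStructure.{u, s} M) (N : ℕ) where
  B : EndBundle.{u, v} M N
  nabla : StarConnection B
  triple : SpectralTripleData.{max u v, h} B.sections
  isTriple : ∃ ι, IsYangMillsTriple S nabla triple ι

end Triple

/-! ## The gauge theory of a spectral triple -/

section Reconstruction

variable {M : Type*} [TopologicalSpace M] [ChartedSpace E4 M] [IsManifold 𝓘(ℝ, E4) ∞ M]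
  {N : ℕ} [NeZero N]

open PrincipalPSUBundle

/-- An isomorphism of smooth `*`-algebra bundles `P ×_{PSU(N)} M_N(ℂ) ≅ B` over `M`: a fibrewise
bijection which is a `*`-isomorphism in the coordinates `m ↦ [p, m]` of the fibre, and which
maps smooth sections `x ↦ [p(x), f(x)]` to smooth sections (`p` a local section of `P`). -/
structure AssocIso (P : PrincipalPSUBundle M N) (B : EndBundle M N) where
  toEquiv : ∀ x, P.AssocFiber x ≃ B.Fiber x
  isStarAlg : ∀ (x : M) (p : P.FiberAt x), ∃ θ : Mat N ≃⋆ₐ[ℂ] B.Fiber x,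
    ∀ m, toEquiv x (assocMk p m) = θ m
  smooth : ∀ e ∈ P.trivs, ∀ f : M → Mat N, SmoothFunOn f e.baseSet → ∀ σ : ∀ x, B.Fiber x,
    (∀ x ∈ e.baseSet, ∀ p : P.FiberAt x, p.1 = localSection e x →
      σ x = toEquiv x (assocMk p (f x))) →
    SmoothSectionOn (Mat N) σ e.baseSet

/-- The connection `∇` on `B ≅ P ×_{PSU(N)} M_N(ℂ)` is induced by the connection 1-form `ω` of the
gauge theory `G = (P, ω)`, and conversely: `∇ = d + [ω_e, ·]` in each local trivialization `e`. -/
def Induces (G : GaugeTheory M N) {B : EndBundle M N} (Φ : AssocIso G.P B)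
    (nabla : StarConnection B) : Prop :=
  ∀ e ∈ G.P.trivs, ∀ f : M → Mat N, SmoothFunOn f e.baseSet → ∀ σ : ∀ x, B.Fiber x,
    (∀ x ∈ e.baseSet, ∀ p : G.P.FiberAt x, p.1 = localSection e x →
      σ x = Φ.toEquiv x (assocMk p (f x))) →
    ∀ x ∈ e.baseSet, ∀ p : G.P.FiberAt x, p.1 = localSection e x →
    ∀ v : TangentSpace 𝓘(ℝ, E4) x,
      nabla.cov σ x v =
        Φ.toEquiv x (assocMk p (mvfderiv 𝓘(ℝ, E4) f x v + ⁅G.form e x v, f x⁆))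

/-- `G = (P, ω)` is a gauge theory obtained from the spectral triple `T` of `(B, ∇^B)`: `B` is the
bundle associated to `P`, and `ω` is the connection 1-form corresponding to `∇^B`. -/
def IsGaugeTheoryOf [RiemannianBundle (fun x : M => TangentSpace 𝓘(ℝ, E4) x)]
    [T2Space M] [CompactSpace M] [MeasurableSpace M] {S : SpinStructure M}
    (G : GaugeTheory M N) (T : YangMillsTriple S N) : Prop :=
  ∃ Φ : AssocIso G.P T.B, Induces G Φ T.nabla

end Reconstruction

universe u s v h w z

/-!
A gauge theory and an endomorphism bundle with hermitian `*`-algebra connection are the same data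
because `PSU(N)` is the automorphism group of the `*`-algebra `M_N(ℂ)`, and `𝔰𝔲(N)` is its algebra
of `*`-derivations (every automorphism and every derivation of `M_N(ℂ)` is inner).

*From `(B, ∇)` to `(P, ω)`.* The star frames of `B`, i.e. the `*`-isomorphisms `M_N(ℂ) ≅ B_x`, form
a principal `PSU(N)`-bundle. In a local star frame `Θ` the connection is `∇ = d + [α, ·]`, where
`α` is `𝔰𝔲(N)`-valued since `m ↦ Θ⁻¹ ∇ (Θ m)` is a `*`-derivation (`isConnFormOn_connForm`,
`isSuFormOn_connForm`), and a change of star frame changes `α` by a gauge transformation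
(`gaugeRelatedOn_of_frames`). This gives `EndBundle.gaugeTheory`.

*Uniqueness.* If `(P, ω)` is any gauge theory that induces `(B, ∇)`, a point `p` of `P` over `x` is
the star frame `m ↦ [p, m]` of `B_x`. So two such gauge theories are identified with each other
through the star frames of `B`, and the forms correspond because both represent `∇` in star frames
(`GaugeTheory.nonempty_iso`).

*From `(P, ω)` to `(B, ∇)`.* The associated bundle `P ×_{PSU(N)} M_N(ℂ)` is built from the
transition functions of `P`, and the local operators `d + [ω_e, ·]` agree on overlaps by the
transformation rule of `ω` (`induces_assocConnection`).

*Existence of the spectral triple.* `Γ(M, B ⊗ S)` is a pre-Hilbert space for the integral of the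
inner product of the fibres, which is definite because the Riemannian volume is positive on
nonempty open sets. Left multiplication, `J` and `γ_B` are bounded there and extend to the
completion. The Dirac operator is defined on the spanning sections `s ⊗ ψ` only by a formula; it is
well defined on their span because in a star frame of `B` the connection
`∇^B ⊗ 1 + 1 ⊗ ∇^S` can be written as an operator that does not refer to a decomposition into
such sections (`twistedCov`). It maps `Γ(M, B ⊗ S)` to itself since the inverse metric is a finite
sum `∑ X_k ⊗ Y_k` with global smooth vector fields (`exists_fields_sum_inner`), so that
`D (s ⊗ ψ) = i ∑ (∇_{X_k} s ⊗ γ(Y_k) ψ + s ⊗ γ(Y_k) ∇_{X_k} ψ)`.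
-/

/-! ### The group `PSU(N)` as the automorphism group of `M_N(ℂ)` -/

section LinearAlgebra

open Matrix

variable {N : ℕ}

theorem PSU.conj_injective [NeZero N] : Function.Injective (PSU.conj N) := by
  rw [injective_iff_map_eq_one]
  intro g hg
  induction g using QuotientGroup.induction_on with
  | H u =>
    rw [QuotientGroup.eq_one_iff, Subgroup.mem_center_iff]
    intro v
    apply Subtype.ext
    have h : PSU.conj N (QuotientGroup.mk u) v = v := by rw [hg]; rfl
    rw [PSU.conj_mk] at h
    have hu : star (u : Mat N) * u = 1 := Matrix.mem_unitaryGroup_iff'.1 u.2.1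
    change (v : Mat N) * u = u * v
    calc (v : Mat N) * u = (u : Mat N) * v * star (u : Mat N) * u := by rw [h]
      _ = u * v := by rw [mul_assoc, hu, mul_one]

/-- Every `*`-automorphism of `M_N(ℂ)` is conjugation by a unitary, which can be rescaled into
`SU(N)`. -/
theorem PSU.conj_surjective [NeZero N] : Function.Surjective (PSU.conj N) := by
  intro f
  let E := Matrix.toEuclideanCLM (𝕜 := ℂ) (n := Fin N)
  let f' : (EuclideanSpace ℂ (Fin N) →L[ℂ] EuclideanSpace ℂ (Fin N)) ≃⋆ₐ[ℂ]
      (EuclideanSpace ℂ (Fin N) →L[ℂ] EuclideanSpace ℂ (Fin N)) := (E.symm.trans f).trans E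
  have hf' : Continuous f' := LinearMap.continuous_of_finiteDimensional
    (f'.toAlgEquiv.toLinearMap)
  obtain ⟨U, hU⟩ := StarAlgEquiv.eq_linearIsometryEquivConjStarAlgEquiv f' hf'
  let w : unitary (Mat N) := ⟨E.symm (Unitary.linearIsometryEquiv.symm U :
    unitary (EuclideanSpace ℂ (Fin N) →L[ℂ] EuclideanSpace ℂ (Fin N))), by
      have := Unitary.map_mem E.symm (Unitary.linearIsometryEquiv.symm U :
        unitary (EuclideanSpace ℂ (Fin N) →L[ℂ] EuclideanSpace ℂ (Fin N))).2
      exact this⟩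
  have hw : ∀ m, f m = (w : Mat N) * m * star (w : Mat N) := by
    intro m
    have h1 : f m = E.symm (f' (E m)) := by simp [f']
    rw [h1, hU, ← Unitary.conjStarAlgAut_symm_unitaryLinearIsometryEquiv,
      Unitary.conjStarAlgAut_apply, map_mul, map_mul, StarAlgEquiv.symm_apply_apply]
    exact congrArg (E.symm _ * m * ·) (E.symm.map_star' _)
  obtain ⟨c, v, hv⟩ := exists_eq_smul_SU w
  refine ⟨QuotientGroup.mk v, ?_⟩
  ext1 m
  have h1 : (w : Mat N) * star (w : Mat N) = 1 := Unitary.mul_star_self_of_mem w.2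
  have hvv : (v : Mat N) * star (v : Mat N) = 1 := Matrix.mem_unitaryGroup_iff.1 v.2.1
  have hc : c * star c = 1 := by
    rw [hv, star_smul, smul_mul_smul_comm, hvv] at h1
    have := congrArg (fun A : Mat N => A 0 0) h1
    simpa using this
  rw [PSU.conj_mk, hw m, hv, star_smul, smul_mul_assoc, smul_mul_smul_comm, hc, one_smul]

/-- The element of `PSU(N)` that acts by a given `*`-automorphism of `M_N(ℂ)`. -/
noncomputable def PSU.ofAut [NeZero N] (f : Mat N ≃⋆ₐ[ℂ] Mat N) : PSU N :=
  (PSU.conj_surjective f).choose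

@[simp]
theorem PSU.conj_ofAut [NeZero N] (f : Mat N ≃⋆ₐ[ℂ] Mat N) : PSU.conj N (PSU.ofAut f) = f :=
  (PSU.conj_surjective f).choose_spec

theorem PSU.ext_conj [NeZero N] {g h : PSU N} (H : ∀ m, PSU.conj N g m = PSU.conj N h m) :
    g = h :=
  PSU.conj_injective (StarAlgEquiv.ext H)

theorem PSU.conj_mul_apply [NeZero N] (g h : PSU N) (m : Mat N) :
    PSU.conj N (g * h) m = PSU.conj N g (PSU.conj N h m) := by
  rw [map_mul]; rfl

@[simp]
theorem PSU.conj_inv_conj [NeZero N] (g : PSU N) (m : Mat N) :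
    PSU.conj N g⁻¹ (PSU.conj N g m) = m := by
  rw [← PSU.conj_mul_apply, inv_mul_cancel, map_one]; rfl

@[simp]
theorem PSU.conj_conj_inv [NeZero N] (g : PSU N) (m : Mat N) :
    PSU.conj N g (PSU.conj N g⁻¹ m) = m := by
  rw [← PSU.conj_mul_apply, mul_inv_cancel, map_one]; rfl

theorem PSU.conj_bracket [NeZero N] (g : PSU N) (a m : Mat N) :
    PSU.conj N g ⁅a, m⁆ = ⁅PSU.conj N g a, PSU.conj N g m⁆ := by
  simp only [Ring.lie_def, map_sub, map_mul]

instance SU.compactSpace : CompactSpace (SU N) := by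
  suffices h : IsCompact (Matrix.specialUnitaryGroup (Fin N) ℂ : Set (Mat N)) from
    isCompact_iff_compactSpace.1 h
  have hcl : IsClosed ((Matrix.specialUnitaryGroup (Fin N) ℂ : Set (Mat N))) := by
    have : ((Matrix.specialUnitaryGroup (Fin N) ℂ : Set (Mat N))) =
        {A | A * star A = 1} ∩ {A | A.det = 1} := by
      ext A
      simp [Matrix.mem_specialUnitaryGroup_iff, Matrix.mem_unitaryGroup_iff]
    rw [this]
    exact (isClosed_eq (continuous_id.mul (continuous_star.comp continuous_id))
      continuous_const).inter (isClosed_eq (continuous_id.matrix_det) continuous_const)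
  refine Metric.isCompact_of_isClosed_isBounded hcl ?_
  refine (Metric.isBounded_closedBall (x := (0 : Mat N)) (r := 1)).subset ?_
  intro A hA
  rw [mem_closedBall_zero_iff]
  exact entrywise_sup_norm_bound_of_unitary hA.1

/-- As `PSU(N)` is compact, its topology is the one it inherits as a group of transformations of
`M_N(ℂ)`. -/
theorem PSU.isEmbedding_conj [NeZero N] :
    Topology.IsEmbedding (fun (g : PSU N) (m : Mat N) => PSU.conj N g m) := by
  have hc : Continuous (fun (g : PSU N) (m : Mat N) => PSU.conj N g m) := by
    refine (QuotientGroup.isQuotientMap_mk (N := Subgroup.center (SU N))).continuous_iff.2 ?_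
    refine continuous_pi fun m => ?_
    change Continuous fun u : SU N => (u : Mat N) * m * star (u : Mat N)
    have h : Continuous fun u : SU N => (u : Mat N) := continuous_subtype_val
    exact (h.mul continuous_const).mul (continuous_star.comp h)
  refine (hc.isClosedEmbedding ?_).isEmbedding
  intro g h hgh
  exact PSU.ext_conj fun m => congrFun hgh m

/-- The traceless matrix that generates a derivation `δ` of `M_N(ℂ)`, see
`bracket_derivGen`. The formula is the contraction of `δ` with the separability idempotent
`N⁻¹ ∑ e_ij ⊗ e_ji`. -/
noncomputable def derivGen (δ : Mat N → Mat N) : Mat N :=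
  (N : ℂ)⁻¹ • ∑ i, ∑ j, δ (single i j 1) * single j i 1

theorem mul_single_eq_sum (m : Mat N) (i j : Fin N) :
    m * single i j 1 = ∑ k, m k i • single k j (1 : ℂ) := by
  ext a b
  by_cases hb : j = b <;> simp [Matrix.sum_apply, Matrix.mul_apply, single_apply, hb]

theorem single_mul_eq_sum (m : Mat N) (i j : Fin N) :
    single j i 1 * m = ∑ k, m i k • single j k (1 : ℂ) := by
  ext a b
  by_cases hb : j = a <;> simp [Matrix.sum_apply, Matrix.mul_apply, single_apply, hb]

theorem sum_single_mul_single : ∑ i : Fin N, ∑ j : Fin N, single i j (1 : ℂ) * single j i 1 =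
    (N : ℂ) • (1 : Mat N) := by
  have : ∀ i : Fin N, ∑ j : Fin N, single i j (1 : ℂ) * single j i 1 =
      (N : ℂ) • single i i (1 : ℂ) := by
    intro i
    simp [single_mul_single_same, ← Nat.cast_smul_eq_nsmul ℂ]
  rw [Finset.sum_congr rfl fun i _ => this i, ← Finset.smul_sum]
  congr 1
  ext a b
  rw [Matrix.sum_apply]
  by_cases hab : a = b <;> simp [single_apply, one_apply, hab, ite_and]

/-- Every derivation of `M_N(ℂ)` is inner. -/
theorem bracket_derivGen [NeZero N] {δ : Mat N → Mat N} (hadd : ∀ a b, δ (a + b) = δ a + δ b)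
    (hsmul : ∀ (c : ℂ) a, δ (c • a) = c • δ a) (hmul : ∀ a b, δ (a * b) = a * δ b + δ a * b)
    (m : Mat N) : ⁅derivGen δ, m⁆ = δ m := by
  let D : Mat N →ₗ[ℂ] Mat N := { toFun := δ, map_add' := hadd, map_smul' := hsmul }
  have hN : (N : ℂ) ≠ 0 := Nat.cast_ne_zero.2 (NeZero.ne N)
  -- The separability idempotent is central: `∑ e_ij ⊗ e_ji m = ∑ m e_ij ⊗ e_ji`.
  have key : (∑ i, ∑ j, δ (single i j 1) * single j i 1) * m =
      ∑ i, ∑ j, δ (m * single i j 1) * single j i 1 := by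
    have h0 : ∀ i j : Fin N, m * single i j 1 = ∑ k, m k i • single k j (1 : ℂ) :=
      mul_single_eq_sum m
    simp only [Finset.sum_mul, mul_assoc, single_mul_eq_sum, h0]
    have h1 : ∀ i j : Fin N, δ (∑ k, m k i • single k j (1 : ℂ)) =
        ∑ k, m k i • δ (single k j 1) := fun i j => by
      change D _ = _
      rw [map_sum]; simp only [map_smul]; rfl
    simp only [h1, Finset.mul_sum, Finset.sum_mul, mul_smul_comm, smul_mul_assoc]
    rw [Finset.sum_comm]
    conv_rhs => rw [Finset.sum_comm]
    refine Finset.sum_congr rfl fun j _ => ?_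
    rw [Finset.sum_comm]
  rw [Ring.lie_def, derivGen, smul_mul_assoc, key]
  simp only [hmul, add_mul, Finset.sum_add_distrib, mul_smul_comm, smul_add, mul_assoc,
    ← Finset.mul_sum]
  rw [add_sub_cancel_left, sum_single_mul_single, mul_smul_comm, smul_smul,
    inv_mul_cancel₀ hN, one_smul, mul_one]

/-- The generator of a `*`-derivation is anti-hermitian and traceless. -/
theorem derivGen_mem_suLie [NeZero N] {δ : Mat N → Mat N} (hadd : ∀ a b, δ (a + b) = δ a + δ b)
    (hsmul : ∀ (c : ℂ) a, δ (c • a) = c • δ a) (hmul : ∀ a b, δ (a * b) = a * δ b + δ a * b)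
    (hstar : ∀ a, δ (star a) = star (δ a)) : derivGen δ ∈ suLie N := by
  let D : Mat N →ₗ[ℂ] Mat N := { toFun := δ, map_add' := hadd, map_smul' := hsmul }
  have h1 : δ 1 = 0 := by
    have := hmul 1 1
    simpa using this
  have hst : ∀ i j : Fin N, star (single i j (1 : ℂ)) = single j i 1 := fun i j => by
    rw [star_eq_conjTranspose, conjTranspose_single, star_one]
  -- Apply `δ` to `∑ e_ij e_ji = N` and use `δ 1 = 0`.
  have hsum : ∑ i, ∑ j, single i j 1 * δ (single j i 1) =
      - ∑ i, ∑ j, δ (single i j 1) * single j i 1 := by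
    rw [eq_neg_iff_add_eq_zero, ← Finset.sum_add_distrib]
    simp only [← Finset.sum_add_distrib, ← hmul]
    change ∑ i, ∑ j, D (single i j (1 : ℂ) * single j i 1) = 0
    simp only [← map_sum]
    rw [sum_single_mul_single, map_smul]
    change (N : ℂ) • δ 1 = 0
    rw [h1, smul_zero]
  refine ⟨?_, ?_⟩
  · rw [derivGen, star_smul, star_sum]
    simp only [star_sum, star_mul, hst, ← hstar]
    rw [hsum, smul_neg]
    simp
  · rw [derivGen, trace_smul]
    have : (∑ i, ∑ j, δ (single i j 1) * single j i (1 : ℂ)).trace = 0 := by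
      have h2 := congrArg trace hsum
      rw [trace_neg] at h2
      have h3 : (∑ i, ∑ j, single i j 1 * δ (single j i (1 : ℂ))).trace =
          (∑ i, ∑ j, δ (single i j 1) * single j i (1 : ℂ)).trace := by
        simp only [trace_sum]
        rw [Finset.sum_comm]
        refine Finset.sum_congr rfl fun i _ => Finset.sum_congr rfl fun j _ => ?_
        rw [trace_mul_comm]
      rw [h3] at h2
      exact self_eq_neg.1 h2
    rw [this, smul_zero]

/-- The normalized trace of the operator of left multiplication by `a` is that of `a`. -/
theorem trace_mulLeft (a : Mat N) : LinearMap.trace ℂ (Mat N) (LinearMap.mulLeft ℂ a) =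
    N * a.trace := by
  rw [LinearMap.trace_eq_matrix_trace ℂ (Matrix.stdBasis ℂ (Fin N) (Fin N))]
  simp only [trace, diag_apply, LinearMap.toMatrix_apply, LinearMap.mulLeft_apply,
    Fintype.sum_prod_type]
  have : ∀ i j, (stdBasis ℂ (Fin N) (Fin N)).repr (a * stdBasis ℂ (Fin N) (Fin N) (i, j)) (i, j) =
      a i i := fun i j => by
    rw [stdBasis_eq_single]
    change (a * single i j (1 : ℂ) : Mat N) i j = _
    simp
  simp only [this]
  simp [Finset.mul_sum]

end LinearAlgebra

/-! ### Smooth frames and local sections of vector bundles -/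

section Smooth

open Filter Topology

variable {M : Type*} [TopologicalSpace M] [ChartedSpace E4 M]

/-- Smoothness at a point of a function with values in a normed space. -/
abbrev SmoothFunAt {F : Type*} [NormedAddCommGroup F] [NormedSpace ℝ F] (f : M → F) (x : M) :
    Prop :=
  ContMDiffAt 𝓘(ℝ, E4) 𝓘(ℝ, F) ∞ f x

/-- Smoothness at a point of a section of a vector bundle with model fibre `F`. -/
abbrev SmoothSectionAt (F : Type*) [NormedAddCommGroup F] [NormedSpace ℝ F] {V : M → Type*}
    [TopologicalSpace (TotalSpace F V)] [∀ x, TopologicalSpace (V x)] [FiberBundle F V]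
    (σ : ∀ x, V x) (x : M) : Prop :=
  ContMDiffAt 𝓘(ℝ, E4) (𝓘(ℝ, E4).prod 𝓘(ℝ, F)) ∞ (fun y => TotalSpace.mk' F y (σ y)) x

theorem contMDiffAt_clm_of_apply {F F' : Type*} [NormedAddCommGroup F] [NormedSpace ℝ F]
    [FiniteDimensional ℝ F] [NormedAddCommGroup F'] [NormedSpace ℝ F'] {A : M → F →L[ℝ] F'} {x : M}
    (hA : ∀ w, SmoothFunAt (fun y => A y w) x) :
    SmoothFunAt A x := by
  let b := Module.finBasis ℝ F
  have h : A = fun y => ∑ i, ContinuousLinearMap.smulRightL ℝ F F'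
      (LinearMap.toContinuousLinearMap (b.coord i)) (A y (b i)) := by
    funext y
    ext w
    conv_lhs => rw [← b.sum_repr w, map_sum]
    simp
  rw [h]
  exact ContMDiffAt.sum fun i _ =>
    (ContinuousLinearMap.contMDiff _).contMDiffAt.comp x (hA (b i))

/-- A solution `f` of a linear equation `A f = g` with smooth and invertible `A` is smooth. -/
theorem contMDiffAt_of_clm_apply_eq {F F' : Type*} [NormedAddCommGroup F] [NormedSpace ℝ F]
    [FiniteDimensional ℝ F] [NormedAddCommGroup F'] [NormedSpace ℝ F'] {A : M → F →L[ℝ] F'} {x : M}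
    {f : M → F} {g : M → F'}
    (hA : ∀ w, SmoothFunAt (fun y => A y w) x)
    (hg : SmoothFunAt g x) (hinv : ∀ᶠ y in 𝓝 x, (A y).IsInvertible)
    (hfg : ∀ᶠ y in 𝓝 x, A y (f y) = g y) : SmoothFunAt f x := by
  have h1 := contMDiffAt_clm_of_apply hA
  obtain ⟨e, he⟩ := hinv.self_of_nhds
  have h2 : SmoothFunAt (fun y => ContinuousLinearMap.inverse (A y)) x := by
    have : CompleteSpace F := FiniteDimensional.complete ℝ F
    have h3 : ContDiffAt ℝ ∞ ContinuousLinearMap.inverse (A x) := he ▸ contDiffAt_map_inverse e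
    exact h3.contMDiffAt.comp x h1
  refine (h2.clm_apply hg).congr_of_eventuallyEq ?_
  filter_upwards [hinv, hfg] with y hy hy'
  exact ((hy.inverse_apply_eq).2 hy'.symm).symm

section Section

variable {F : Type*} [NormedAddCommGroup F] [NormedSpace ℝ F]
  {V : M → Type*} [TopologicalSpace (TotalSpace F V)] [∀ x, TopologicalSpace (V x)]
  [FiberBundle F V]

theorem SmoothSectionOn.contMDiffAt {U : Set M} (hU : IsOpen U) {x : M} (hx : x ∈ U)
    {s : ∀ x, V x} (hs : SmoothSectionOn F s U) :
    SmoothSectionAt F (fun y => s y) x :=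
  (hs x hx).contMDiffAt (hU.mem_nhds hx)

theorem SmoothFunOn.contMDiffAt {U : Set M} (hU : IsOpen U) {x : M} (hx : x ∈ U)
    {s : M → F} (hs : SmoothFunOn s U) : SmoothFunAt s x :=
  (hs x hx).contMDiffAt (hU.mem_nhds hx)

theorem contMDiffAt_section_congr {s t : ∀ x, V x} {x : M}
    (hs : SmoothSectionAt F (fun y => s y) x)
    (h : ∀ᶠ y in 𝓝 x, t y = s y) :
    SmoothSectionAt F (fun y => t y) x := by
  refine hs.congr_of_eventuallyEq ?_
  filter_upwards [h] with y hy
  rw [hy]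

end Section

section Frame

variable {F F' : Type*} [NormedAddCommGroup F] [NormedSpace ℝ F] [NormedAddCommGroup F']
  [NormedSpace ℝ F'] {V : M → Type*} [∀ x, AddCommGroup (V x)]
  [∀ x, Module ℝ (V x)] [TopologicalSpace (TotalSpace F V)] [∀ x, TopologicalSpace (V x)]
  [FiberBundle F V] [VectorBundle ℝ F V]

/-- In a smooth frame `Θ`, a section is smooth if and only if its components `f` are. -/
theorem contMDiffAt_frame_iff [FiniteDimensional ℝ F'] {Θ : ∀ y, F' → V y}
    (hlin : ∀ y, IsLinearMap ℝ (Θ y)) (hbij : ∀ y, Function.Bijective (Θ y)) {x : M}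
    (hΘ : ∀ w, SmoothSectionAt F (fun y => Θ y w) x) {f : M → F'} :
    SmoothSectionAt F (fun y => Θ y (f y)) x ↔
      SmoothFunAt f x := by
  let e := trivializationAt F V x
  let A : M → F' →L[ℝ] F := fun y =>
    LinearMap.toContinuousLinearMap ((e.linearMapAt ℝ y) ∘ₗ (hlin y).mk')
  have hbase : ∀ᶠ y in 𝓝 x, y ∈ e.baseSet :=
    e.open_baseSet.mem_nhds (FiberBundle.mem_baseSet_trivializationAt' x)
  have hAe : ∀ᶠ y in 𝓝 x, ∀ w, A y w = (e ⟨y, Θ y w⟩).2 := by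
    filter_upwards [hbase] with y hy w
    change e.linearMapAt ℝ y (Θ y w) = _
    rw [e.coe_linearMapAt_of_mem hy]
  have hA : ∀ w, SmoothFunAt (fun y => A y w) x := fun w => by
    refine ((Bundle.contMDiffAt_section x).1 (hΘ w)).congr_of_eventuallyEq ?_
    filter_upwards [hAe] with y hy
    exact hy w
  have hinv : ∀ᶠ y in 𝓝 x, (A y).IsInvertible := by
    filter_upwards [hbase] with y hy
    let e1 : F' ≃ₗ[ℝ] V y := LinearEquiv.ofBijective (hlin y).mk' (hbij y)
    let e2 : F' ≃ₗ[ℝ] F := e1.trans (e.linearEquivAt ℝ y hy)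
    have : FiniteDimensional ℝ F := e2.finiteDimensional
    refine ⟨e2.toContinuousLinearEquiv, ?_⟩
    ext w
    change (e.linearEquivAt ℝ y hy) (Θ y w) = e.linearMapAt ℝ y (Θ y w)
    rw [e.coe_linearMapAt_of_mem hy]; rfl
  rw [SmoothSectionAt, Bundle.contMDiffAt_section]
  constructor
  · intro h
    refine contMDiffAt_of_clm_apply_eq hA h hinv ?_
    filter_upwards [hAe] with y hy
    exact hy _
  · intro h
    refine ((contMDiffAt_clm_of_apply hA).clm_apply h).congr_of_eventuallyEq ?_
    filter_upwards [hAe] with y hy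
    exact (hy _).symm

/-- A local smooth section agrees near each point with a global one. -/
theorem exists_smooth_section_eventuallyEq [T2Space M] [IsManifold 𝓘(ℝ, E4) ∞ M]
    {U : Set M} (hU : IsOpen U) {x : M} (hx : x ∈ U)
    {s : ∀ x, V x} (hs : SmoothSectionOn F s U) :
    ∃ t : ∀ x, V x, SmoothSectionOn F t Set.univ ∧ ∀ᶠ y in 𝓝 x, t y = s y := by
  obtain ⟨f, -, hf⟩ := (SmoothBumpFunction.nhds_basis_tsupport (I := 𝓘(ℝ, E4)) x).mem_iff.1
    (hU.mem_nhds hx)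
  refine ⟨fun y => f y • s y, ?_, ?_⟩
  · exact (ContMDiffOn.smul_section_of_tsupport f.contMDiff.contMDiffOn hU hf hs).contMDiffOn
  · filter_upwards [f.eventuallyEq_one] with y hy
    simp [hy]

/-- A section of `Hom(TM, V)` is smooth at `x` as soon as its values on smooth vector fields
are. -/
theorem contMDiffAt_hom_of_apply [T2Space M] [IsManifold 𝓘(ℝ, E4) ∞ M]
    [∀ x, IsTopologicalAddGroup (V x)] [∀ x, ContinuousSMul ℝ (V x)]
    {A : ∀ x : M, TangentSpace 𝓘(ℝ, E4) x →L[ℝ] V x} {x : M}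
    (hA : ∀ X : ∀ x : M, TangentSpace 𝓘(ℝ, E4) x, SmoothVectorField X →
      SmoothSectionAt F (fun y => A y (X y)) x) :
    ContMDiffAt 𝓘(ℝ, E4) (𝓘(ℝ, E4).prod 𝓘(ℝ, E4 →L[ℝ] F)) ∞
      (fun y => (⟨y, A y⟩ : TotalSpace (E4 →L[ℝ] F)
        fun x : M => TangentSpace 𝓘(ℝ, E4) x →L[ℝ] V x)) x := by
  rw [contMDiffAt_hom_bundle]
  refine ⟨contMDiffAt_id, contMDiffAt_clm_of_apply fun w => ?_⟩
  let eT := trivializationAt E4 (TangentSpace 𝓘(ℝ, E4) : M → Type _) x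
  have hX : SmoothSectionOn E4 (fun y => eT.symmL ℝ y w) eT.baseSet := by
    intro y hy
    refine (((eT.contMDiffAt_section_iff hy).2 ?_).contMDiffWithinAt)
    refine (contMDiffAt_const (c := w)).congr_of_eventuallyEq ?_
    filter_upwards [eT.open_baseSet.mem_nhds hy] with z hz
    rw [eT.symmL_apply hz, eT.apply_mk_symm hz]
  obtain ⟨X, hXs, hXe⟩ := exists_smooth_section_eventuallyEq eT.open_baseSet
    (FiberBundle.mem_baseSet_trivializationAt' x) hX
  refine ((Bundle.contMDiffAt_section x).1 (hA X hXs)).congr_of_eventuallyEq ?_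
  filter_upwards [hXe, eT.open_baseSet.mem_nhds (FiberBundle.mem_baseSet_trivializationAt' x),
    (trivializationAt F V x).open_baseSet.mem_nhds (FiberBundle.mem_baseSet_trivializationAt' x)]
    with y hy h1 h2
  rw [ContinuousLinearMap.inCoordinates_eq h1 h2, hy]
  simp [eT, Trivialization.symmL_apply _ h1]

end Frame

/-- The derivative of a smooth function along a smooth vector field is smooth. -/
theorem contMDiffAt_mvfderiv_apply [IsManifold 𝓘(ℝ, E4) ∞ M] {F : Type*} [NormedAddCommGroup F]
    [NormedSpace ℝ F] {f : M → F} {x : M} (hf : SmoothFunAt f x)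
    {X : ∀ x : M, TangentSpace 𝓘(ℝ, E4) x}
    (hX : SmoothSectionAt E4 (fun y => X y) x) :
    SmoothFunAt (fun y => mvfderiv 𝓘(ℝ, E4) f y (X y)) x := by
  have h1 := hf.mfderiv_const (m := ∞) le_rfl
  have h2 := ContMDiffAt.clm_apply_of_inCoordinates (b₁ := id) (b₂ := f) h1 hX hf
  exact (contMDiff_snd_tangentBundle_modelSpace F 𝓘(ℝ, F)).contMDiffAt.comp x h2

end Smooth

/-! ### Star frames of an endomorphism bundle and their connection forms -/

section Frames

open Filter Topology

variable {M : Type*} [TopologicalSpace M] [ChartedSpace E4 M]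

theorem mvfderiv_clm_comp {F F' : Type*} [NormedAddCommGroup F] [NormedSpace ℝ F]
    [NormedAddCommGroup F'] [NormedSpace ℝ F'] (L : F →L[ℝ] F') {f : M → F} {x : M}
    (hf : MDifferentiableAt 𝓘(ℝ, E4) 𝓘(ℝ, F) f x) (v : TangentSpace 𝓘(ℝ, E4) x) :
    mvfderiv 𝓘(ℝ, E4) (fun y => L (f y)) x v = L (mvfderiv 𝓘(ℝ, E4) f x v) := by
  have h := mfderiv_comp x (I' := 𝓘(ℝ, F)) (L.differentiableAt.mdifferentiableAt
    : MDifferentiableAt 𝓘(ℝ, F) 𝓘(ℝ, F') L (f x)) hf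
  have h2 : mfderiv 𝓘(ℝ, F) 𝓘(ℝ, F') L (f x) = L := by
    rw [mfderiv_eq_fderiv]; exact L.fderiv
  rw [h2] at h
  change mfderiv 𝓘(ℝ, E4) 𝓘(ℝ, F') (L ∘ f) x v = L (mfderiv 𝓘(ℝ, E4) 𝓘(ℝ, F) f x v)
  rw [h]; rfl

theorem mvfderiv_congr {F : Type*} [NormedAddCommGroup F] [NormedSpace ℝ F] {f g : M → F} {x : M}
    (h : f =ᶠ[𝓝 x] g) (v : TangentSpace 𝓘(ℝ, E4) x) :
    mvfderiv 𝓘(ℝ, E4) f x v = mvfderiv 𝓘(ℝ, E4) g x v := by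
  change mfderiv 𝓘(ℝ, E4) 𝓘(ℝ, F) f x v = mfderiv 𝓘(ℝ, E4) 𝓘(ℝ, F) g x v
  rw [h.mfderiv_eq]; rfl

theorem SmoothFunAt.linearMap_comp {F F' : Type*} [NormedAddCommGroup F] [NormedSpace ℝ F]
    [FiniteDimensional ℝ F] [NormedAddCommGroup F'] [NormedSpace ℝ F'] {f : M → F} {x : M}
    (hf : SmoothFunAt f x) (L : F →ₗ[ℝ] F') : SmoothFunAt (fun y => L (f y)) x :=
  (LinearMap.toContinuousLinearMap L).contMDiff.contMDiffAt.comp x hf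

theorem SmoothFunAt.sum {F ι : Type*} [NormedAddCommGroup F] [NormedSpace ℝ F] {S : Finset ι}
    {f : ι → M → F} {x : M} (hf : ∀ i ∈ S, SmoothFunAt (f i) x) :
    SmoothFunAt (fun y => ∑ i ∈ S, f i y) x :=
  ContMDiffAt.sum hf

theorem smoothFunAt_derivGen {N : ℕ} {δ : M → Mat N → Mat N} {x : M}
    (hδ : ∀ m, SmoothFunAt (fun y => δ y m) x) : SmoothFunAt (fun y => derivGen (δ y)) x := by
  refine SmoothFunAt.linearMap_comp (f := fun y => ∑ i, ∑ j, δ y (Matrix.single i j 1) *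
    Matrix.single j i 1) ?_ ((LinearMap.lsmul ℂ (Mat N) (N : ℂ)⁻¹).restrictScalars ℝ)
  refine SmoothFunAt.sum fun i _ => SmoothFunAt.sum fun j _ => ?_
  exact (hδ (Matrix.single i j 1)).linearMap_comp (LinearMap.mulRight ℝ (Matrix.single j i 1))

variable [IsManifold 𝓘(ℝ, E4) ∞ M] {N : ℕ}

theorem EndBundle.tau_apply [NeZero N] (B : EndBundle M N) {x : M} (θ : Mat N ≃⋆ₐ[ℂ] B.Fiber x)
    (m : Mat N) : B.tau x (θ m) = m.trace / N := by
  let e : Mat N ≃ₗ[ℂ] B.Fiber x := θ.toAlgEquiv.toLinearEquiv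
  have h : LinearMap.mulLeft ℂ (θ m) = e.conj (LinearMap.mulLeft ℂ m) := by
    ext b
    rw [LinearEquiv.conj_apply_apply]
    change θ m * b = θ (m * θ.symm b)
    rw [map_mul, StarAlgEquiv.apply_symm_apply]
  rw [EndBundle.tau, h, LinearMap.trace_conj', trace_mulLeft]
  have hN : (N : ℂ) ≠ 0 := Nat.cast_ne_zero.2 (NeZero.ne N)
  field_simp

/-- A local trivialization of `B` as a `*`-algebra bundle over the open set `U`. Only the
restriction of `Θ` to `U` matters. -/
structure IsStarFrameOn {B : EndBundle M N} (Θ : ∀ y, Mat N ≃⋆ₐ[ℂ] B.Fiber y) (U : Set M) :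
    Prop where
  isOpen : IsOpen U
  smooth : ∀ m, SmoothSectionOn (Mat N) (fun y => Θ y m) U

theorem StarAlgEquiv.map_real_smul {A A' : Type*} [Ring A] [Algebra ℂ A] [Star A] [Ring A']
    [Algebra ℂ A'] [Star A'] (θ : A ≃⋆ₐ[ℂ] A') (r : ℝ) (a : A) : θ (r • a) = r • θ a := by
  have h := map_smul θ (r : ℂ) a
  rwa [Complex.coe_smul, Complex.coe_smul] at h

variable {B : EndBundle M N}

theorem IsStarFrameOn.contMDiffAt_iff {Θ : ∀ y, Mat N ≃⋆ₐ[ℂ] B.Fiber y} {U : Set M}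
    (hΘ : IsStarFrameOn Θ U) {x : M} (hx : x ∈ U) {f : M → Mat N} :
    SmoothSectionAt (Mat N) (fun y => Θ y (f y)) x ↔
      SmoothFunAt f x :=
  contMDiffAt_frame_iff (fun y => ⟨map_add (Θ y), fun r m => (Θ y).map_real_smul r m⟩)
    (fun y => (Θ y).bijective) (fun w => (hΘ.smooth w).contMDiffAt hΘ.isOpen hx)

theorem EndBundle.exists_starFrame (B : EndBundle M N) (x : M) :
    ∃ (U : Set M) (Θ : ∀ y, Mat N ≃⋆ₐ[ℂ] B.Fiber y), x ∈ U ∧ IsStarFrameOn Θ U := by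
  obtain ⟨U, hU, hx, Θ, hΘ⟩ := B.locTriv x
  exact ⟨U, Θ, hx, hU, hΘ⟩

theorem EndBundle.exists_section_eventuallyEq [T2Space M] {U : Set M} (hU : IsOpen U) {x : M}
    (hx : x ∈ U) {σ : ∀ y, B.Fiber y} (hσ : SmoothSectionOn (Mat N) σ U) :
    ∃ s : B.sections, ∀ᶠ y in 𝓝 x, s.1 y = σ y := by
  obtain ⟨t, ht, h⟩ := exists_smooth_section_eventuallyEq hU hx hσ
  exact ⟨⟨t, ht⟩, h⟩

namespace StarConnection

variable (nabla : StarConnection B)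

theorem cov_congr {σ τ : ∀ y, B.Fiber y} {x : M}
    (hσ : SmoothSectionAt (Mat N) (fun y => σ y) x)
    (h : ∀ᶠ y in 𝓝 x, τ y = σ y) : nabla.cov τ x = nabla.cov σ x :=
  nabla.cov.isCovariantDerivativeOnUniv.congr_of_eventuallyEq
    ((contMDiffAt_section_congr hσ h).mdifferentiableAt (by simp))
    (hσ.mdifferentiableAt (by simp)) univ_mem h

theorem cov_section_congr (s : B.sections) {τ : ∀ y, B.Fiber y} {x : M}
    (h : ∀ᶠ y in 𝓝 x, τ y = s.1 y) : nabla.cov τ x = nabla.cov s x :=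
  nabla.cov_congr (SmoothSectionOn.contMDiffAt isOpen_univ (Set.mem_univ x) s.2) h

theorem cov_sum {ι : Type*} (S : Finset ι) {σ : ι → ∀ y, B.Fiber y} {x : M}
    (hσ : ∀ i ∈ S, SmoothSectionAt (Mat N) (fun y => σ i y) x) :
    nabla.cov (fun y => ∑ i ∈ S, σ i y) x = ∑ i ∈ S, nabla.cov (σ i) x := by
  classical
  induction S using Finset.induction_on with
  | empty =>
    simp only [Finset.sum_empty]
    exact nabla.cov.isCovariantDerivativeOnUniv.zero
  | insert i S hi ih =>
    simp only [Finset.sum_insert hi]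
    have h1 := hσ i (Finset.mem_insert_self i S)
    have h2 := fun j hj => hσ j (Finset.mem_insert_of_mem (b := i) hj)
    have := nabla.cov.isCovariantDerivativeOnUniv.add (h1.mdifferentiableAt (by simp))
      ((ContMDiffAt.sum_section h2).mdifferentiableAt (by simp))
    rw [← ih h2]
    exact this

variable [T2Space M] {U : Set M} {σ τ : ∀ y, B.Fiber y} {x : M}

theorem cov_smul_of_smoothOn (hU : IsOpen U) (hσ : SmoothSectionOn (Mat N) σ U) (hx : x ∈ U)
    (c : ℂ) (v : TangentSpace 𝓘(ℝ, E4) x) :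
    nabla.cov (fun y => c • σ y) x v = c • nabla.cov σ x v := by
  obtain ⟨s, hs⟩ := EndBundle.exists_section_eventuallyEq hU hx hσ
  rw [nabla.cov_section_congr s (hs.mono fun y hy => hy.symm), ← nabla.map_smul,
    nabla.cov_section_congr (c • s) (hs.mono fun y hy => ?_)]
  change c • σ y = c • s.1 y
  rw [hy]

theorem cov_mul_of_smoothOn (hU : IsOpen U) (hσ : SmoothSectionOn (Mat N) σ U)
    (hτ : SmoothSectionOn (Mat N) τ U) (hx : x ∈ U) (v : TangentSpace 𝓘(ℝ, E4) x) :
    nabla.cov (fun y => σ y * τ y) x v = σ x * nabla.cov τ x v + nabla.cov σ x v * τ x := by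
  obtain ⟨s, hs⟩ := EndBundle.exists_section_eventuallyEq hU hx hσ
  obtain ⟨t, ht⟩ := EndBundle.exists_section_eventuallyEq hU hx hτ
  rw [nabla.cov_section_congr s (hs.mono fun y hy => hy.symm),
    nabla.cov_section_congr t (ht.mono fun y hy => hy.symm), ← hs.self_of_nhds,
    ← ht.self_of_nhds, ← nabla.leibniz, nabla.cov_section_congr (s * t)]
  filter_upwards [hs, ht] with y hy hy'
  change _ = s.1 y * t.1 y
  rw [hy, hy']

theorem cov_star_of_smoothOn (hU : IsOpen U) (hσ : SmoothSectionOn (Mat N) σ U) (hx : x ∈ U)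
    (v : TangentSpace 𝓘(ℝ, E4) x) :
    nabla.cov (fun y => star (σ y)) x v = star (nabla.cov σ x v) := by
  obtain ⟨s, hs⟩ := EndBundle.exists_section_eventuallyEq hU hx hσ
  rw [nabla.cov_section_congr s (hs.mono fun y hy => hy.symm), ← nabla.map_star,
    nabla.cov_section_congr (star s) (hs.mono fun y hy => ?_)]
  change star (σ y) = star (s.1 y)
  rw [hy]

theorem cov_apply_contMDiffAt (hU : IsOpen U) (hσ : SmoothSectionOn (Mat N) σ U) (hx : x ∈ U)
    {X : ∀ x : M, TangentSpace 𝓘(ℝ, E4) x} (hX : SmoothVectorField X) :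
    SmoothSectionAt (Mat N) (fun y => nabla.cov σ y (X y)) x := by
  obtain ⟨s, hs⟩ := EndBundle.exists_section_eventuallyEq hU hx hσ
  have h1 := (nabla.smooth.contMDiff.contMDiff (σ := s.1) s.2).contMDiffAt (x := x) univ_mem
  have h2 := h1.clm_bundle_apply (hX.contMDiffAt isOpen_univ (Set.mem_univ x))
  refine contMDiffAt_section_congr h2 ?_
  filter_upwards [hs.eventually_nhds] with y hy
  rw [nabla.cov_section_congr s (hy.mono fun z hz => hz.symm)]

end StarConnection

/-- `α` is the connection form of `∇` in the frame `Θ` over `U`: `∇(Θ m) = Θ [α, m]` for constant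
matrices `m`. -/
def IsConnFormOn (nabla : StarConnection B) (Θ : ∀ y, Mat N ≃⋆ₐ[ℂ] B.Fiber y) (α : MatForm M N)
    (U : Set M) : Prop :=
  ∀ x ∈ U, ∀ (v : TangentSpace 𝓘(ℝ, E4) x) (m : Mat N),
    nabla.cov (fun y => Θ y m) x v = Θ x ⁅α x v, m⁆

/-- The local formula `∇ = d + [α, ·]`. -/
theorem IsConnFormOn.cov_eq [T2Space M] {nabla : StarConnection B}
    {Θ : ∀ y, Mat N ≃⋆ₐ[ℂ] B.Fiber y} {α : MatForm M N} {U : Set M} (hα : IsConnFormOn nabla Θ α U)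
    (hΘ : IsStarFrameOn Θ U) {f : M → Mat N} {x : M} (hx : x ∈ U)
    (hf : SmoothFunAt f x) {σ : ∀ y, B.Fiber y}
    (hσ : ∀ᶠ y in 𝓝 x, σ y = Θ y (f y)) (v : TangentSpace 𝓘(ℝ, E4) x) :
    nabla.cov σ x v = Θ x (mvfderiv 𝓘(ℝ, E4) f x v + ⁅α x v, f x⁆) := by
  -- Expand `f` in a real basis of `M_N(ℂ)` and apply the Leibniz rule to each term.
  let b := Module.finBasis ℝ (Mat N)
  let c := fun k => LinearMap.toContinuousLinearMap (b.coord k)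
  have hsum : ∀ m : Mat N, m = ∑ k, c k m • b k := fun m => (b.sum_repr m).symm
  have hc : ∀ k, SmoothFunAt (fun y => c k (f y)) x := fun k =>
    ((c k).contMDiff).contMDiffAt.comp x hf
  have hb : ∀ k, SmoothSectionAt (Mat N) (fun y => Θ y (b k)) x :=
    fun k => (hΘ.smooth (b k)).contMDiffAt hΘ.isOpen hx
  have hs : ∀ k, SmoothSectionAt (Mat N) (fun y => c k (f y) • Θ y (b k)) x :=
    fun k => (hc k).smul_section (hb k)
  have h1 : nabla.cov σ x = nabla.cov (fun y => ∑ k, c k (f y) • Θ y (b k)) x := by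
    refine nabla.cov_congr (ContMDiffAt.sum_section fun k _ => hs k) ?_
    filter_upwards [hσ] with y hy
    rw [hy]
    conv_lhs => rw [hsum (f y), map_sum]
    simp only [StarAlgEquiv.map_real_smul]
  rw [h1, nabla.cov_sum _ fun k _ => hs k, _root_.sum_apply]
  have h2 : ∀ k, nabla.cov (fun y => c k (f y) • Θ y (b k)) x v =
      Θ x (c k (mvfderiv 𝓘(ℝ, E4) f x v) • b k + c k (f x) • ⁅α x v, b k⁆) := by
    intro k
    have h3 := nabla.cov.isCovariantDerivativeOnUniv.leibniz ((hb k).mdifferentiableAt (by simp))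
      ((hc k).mdifferentiableAt (by simp))
    have h4 := congrArg (fun L => L v) h3
    change nabla.cov (fun y => c k (f y) • Θ y (b k)) x v = c k (f x) •
      nabla.cov (fun y => Θ y (b k)) x v +
      mvfderiv 𝓘(ℝ, E4) (fun y => c k (f y)) x v • Θ x (b k) at h4
    have h5 : mvfderiv 𝓘(ℝ, E4) (fun y => c k (f y)) x v = c k (mvfderiv 𝓘(ℝ, E4) f x v) :=
      mvfderiv_clm_comp (c k) (hf.mdifferentiableAt (by simp)) v
    rw [h4, hα x hx, h5, map_add,
      StarAlgEquiv.map_real_smul, StarAlgEquiv.map_real_smul, add_comm]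
  rw [Finset.sum_congr rfl fun k _ => h2 k, ← map_sum, Finset.sum_add_distrib, ← hsum]
  congr 2
  conv_rhs => rw [hsum (f x)]
  simp only [Ring.lie_def, Finset.mul_sum, Finset.sum_mul, mul_smul_comm, smul_mul_assoc,
    smul_sub, Finset.sum_sub_distrib]

/-- Two frames over `U` and `U'` differ by a smooth `PSU(N)`-valued function. -/
theorem smoothPSUOn_of_frames [NeZero N] {Θ Θ' : ∀ y, Mat N ≃⋆ₐ[ℂ] B.Fiber y} {U U' : Set M}
    (hΘ : IsStarFrameOn Θ U) (hΘ' : IsStarFrameOn Θ' U') {g : M → PSU N}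
    (hg : ∀ y ∈ U ∩ U', ∀ m, Θ y m = Θ' y (PSU.conj N (g y) m)) : SmoothPSUOn g (U ∩ U') := by
  intro m x hx
  refine ((hΘ'.contMDiffAt_iff hx.2).1 ?_).contMDiffWithinAt
  refine contMDiffAt_section_congr ((hΘ.smooth m).contMDiffAt hΘ.isOpen hx.1) ?_
  filter_upwards [(hΘ.isOpen.inter hΘ'.isOpen).mem_nhds hx] with y hy
  exact (hg y hy m).symm

/-- The connection forms in two frames are related by the gauge transformation between the
frames. -/
theorem gaugeRelatedOn_of_frames [T2Space M] [NeZero N] {nabla : StarConnection B}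
    {Θ Θ' : ∀ y, Mat N ≃⋆ₐ[ℂ] B.Fiber y} {U U' : Set M}
    (hΘ : IsStarFrameOn Θ U) (hΘ' : IsStarFrameOn Θ' U') {α α' : MatForm M N}
    (hα : IsConnFormOn nabla Θ α U) (hα' : IsConnFormOn nabla Θ' α' U') {g : M → PSU N}
    (hg : ∀ y ∈ U ∩ U', ∀ m, Θ y m = Θ' y (PSU.conj N (g y) m)) :
    GaugeRelatedOn (U ∩ U') g α α' := by
  intro x hx v m
  have hs := smoothPSUOn_of_frames hΘ hΘ' hg
  have h1 := hα x hx.1 v m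
  rw [hα'.cov_eq hΘ' (f := fun y => PSU.conj N (g y) m) hx.2
    (SmoothFunOn.contMDiffAt (hΘ.isOpen.inter hΘ'.isOpen) hx (hs m))
    (by filter_upwards [(hΘ.isOpen.inter hΘ'.isOpen).mem_nhds hx] with y hy using hg y hy m),
    hg x hx] at h1
  have h2 := (Θ' x).injective h1
  have h3 := congrArg (PSU.conj N (g x)⁻¹) h2
  rw [PSU.conj_inv_conj] at h3
  rw [← h3, map_add, PSU.conj_bracket, PSU.conj_inv_conj]

/-- The connection form of `∇` in a frame: its value at `v` is the traceless matrix which generates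
the derivation `m ↦ Θ⁻¹ ∇_v (Θ m)`. -/
noncomputable def connForm (nabla : StarConnection B) (Θ : ∀ y, Mat N ≃⋆ₐ[ℂ] B.Fiber y) :
    MatForm M N := fun x =>
  haveI : FiniteDimensional ℝ (TangentSpace 𝓘(ℝ, E4) x) :=
    inferInstanceAs (FiniteDimensional ℝ E4)
  haveI : T2Space (TangentSpace 𝓘(ℝ, E4) x) := inferInstanceAs (T2Space E4)
  LinearMap.toContinuousLinearMap
    { toFun := fun v => derivGen fun m => (Θ x).symm (nabla.cov (fun y => Θ y m) x v)
      map_add' := fun v w => by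
        simp only [derivGen, map_add, add_mul, Finset.sum_add_distrib, smul_add]
      map_smul' := fun r v => by
        simp only [derivGen, map_smul, StarAlgEquiv.map_real_smul, smul_mul_assoc,
          ← Finset.smul_sum, RingHom.id_apply]
        rw [smul_comm] }

theorem connForm_apply (nabla : StarConnection B) (Θ : ∀ y, Mat N ≃⋆ₐ[ℂ] B.Fiber y) (x : M)
    (v : TangentSpace 𝓘(ℝ, E4) x) : connForm nabla Θ x v =
      derivGen fun m => (Θ x).symm (nabla.cov (fun y => Θ y m) x v) := rfl

section

variable {Θ : ∀ y, Mat N ≃⋆ₐ[ℂ] B.Fiber y} {U : Set M}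

theorem IsStarFrameOn.cov_add (hΘ : IsStarFrameOn Θ U) (nabla : StarConnection B)
    {x : M} (hx : x ∈ U) (v : TangentSpace 𝓘(ℝ, E4) x) (a b : Mat N) :
    (Θ x).symm (nabla.cov (fun y => Θ y (a + b)) x v) =
    (Θ x).symm (nabla.cov (fun y => Θ y a) x v) + (Θ x).symm (nabla.cov (fun y => Θ y b) x v) := by
  have h := nabla.cov.isCovariantDerivativeOnUniv.add
    (((hΘ.smooth a).contMDiffAt hΘ.isOpen hx).mdifferentiableAt (by simp))
    (((hΘ.smooth b).contMDiffAt hΘ.isOpen hx).mdifferentiableAt (by simp))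
  have h2 : (fun y => Θ y (a + b)) = (fun y => Θ y a) + fun y => Θ y b := by
    funext y; exact map_add (Θ y) a b
  rw [h2, h]
  exact map_add (Θ x).symm _ _

theorem IsStarFrameOn.cov_smul [T2Space M] (hΘ : IsStarFrameOn Θ U) (nabla : StarConnection B)
    {x : M} (hx : x ∈ U) (v : TangentSpace 𝓘(ℝ, E4) x) (c : ℂ) (a : Mat N) :
    (Θ x).symm (nabla.cov (fun y => Θ y (c • a)) x v) =
      c • (Θ x).symm (nabla.cov (fun y => Θ y a) x v) := by
  simp only [map_smul]
  rw [nabla.cov_smul_of_smoothOn hΘ.isOpen (hΘ.smooth a) hx, map_smul]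

theorem IsStarFrameOn.cov_mul [T2Space M] (hΘ : IsStarFrameOn Θ U) (nabla : StarConnection B)
    {x : M} (hx : x ∈ U) (v : TangentSpace 𝓘(ℝ, E4) x) (a b : Mat N) :
    (Θ x).symm (nabla.cov (fun y => Θ y (a * b)) x v) =
      a * (Θ x).symm (nabla.cov (fun y => Θ y b) x v) +
        (Θ x).symm (nabla.cov (fun y => Θ y a) x v) * b := by
  simp only [map_mul]
  rw [nabla.cov_mul_of_smoothOn hΘ.isOpen (hΘ.smooth a) (hΘ.smooth b) hx]
  simp only [map_add, map_mul, StarAlgEquiv.symm_apply_apply]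

theorem IsStarFrameOn.cov_star [T2Space M] (hΘ : IsStarFrameOn Θ U) (nabla : StarConnection B)
    {x : M} (hx : x ∈ U) (v : TangentSpace 𝓘(ℝ, E4) x) (a : Mat N) :
    (Θ x).symm (nabla.cov (fun y => Θ y (star a)) x v) =
      star ((Θ x).symm (nabla.cov (fun y => Θ y a) x v)) := by
  simp only [map_star]
  rw [nabla.cov_star_of_smoothOn hΘ.isOpen (hΘ.smooth a) hx]
  exact map_star (Θ x).symm _

end

theorem isConnFormOn_connForm [T2Space M] [NeZero N] (nabla : StarConnection B)
    {Θ : ∀ y, Mat N ≃⋆ₐ[ℂ] B.Fiber y} {U : Set M} (hΘ : IsStarFrameOn Θ U) :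
    IsConnFormOn nabla Θ (connForm nabla Θ) U := by
  intro x hx v m
  rw [connForm_apply, bracket_derivGen (hΘ.cov_add nabla hx v) (hΘ.cov_smul nabla hx v)
    (hΘ.cov_mul nabla hx v), StarAlgEquiv.apply_symm_apply]

theorem isSuFormOn_connForm [T2Space M] [NeZero N] (nabla : StarConnection B)
    {Θ : ∀ y, Mat N ≃⋆ₐ[ℂ] B.Fiber y} {U : Set M} (hΘ : IsStarFrameOn Θ U) :
    IsSuFormOn (connForm nabla Θ) U := by
  refine ⟨fun x hx v => ?_, fun X hX x hx => ?_⟩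
  · rw [connForm_apply]
    exact derivGen_mem_suLie (hΘ.cov_add nabla hx v) (hΘ.cov_smul nabla hx v)
      (hΘ.cov_mul nabla hx v) (hΘ.cov_star nabla hx v)
  · have h : ∀ m, SmoothFunAt (fun y => (Θ y).symm (nabla.cov (fun z => Θ z m) y (X y))) x := by
      intro m
      rw [← hΘ.contMDiffAt_iff hx]
      simp only [StarAlgEquiv.apply_symm_apply]
      exact nabla.cov_apply_contMDiffAt hΘ.isOpen (hΘ.smooth m) hx hX
    simp only [connForm_apply]
    exact (smoothFunAt_derivGen h).contMDiffWithinAt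

end Frames

/-! ### Principal bundles and their isomorphisms -/

section Principal

open Filter Topology

variable {M : Type*} [TopologicalSpace M] [ChartedSpace E4 M] {N : ℕ}

instance SU.isTopologicalGroup : IsTopologicalGroup (SU N) where
  continuous_inv := Continuous.subtype_mk (continuous_star.comp continuous_subtype_val) _

/-- In an equivariant trivialization `e`, every point of a fibre is the translate, by its
`PSU(N)`-coordinate, of the point with coordinate `1`. -/
theorem PrincipalPSUBundle.eq_act_of_equivariant {X Total : Type*} [TopologicalSpace X]
    [TopologicalSpace Total] {proj : Total → X}
    {act : Total → PSU N → Total} (hproj : ∀ p g, proj (act p g) = proj p)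
    (e : Trivialization (PSU N) proj)
    (he : ∀ p, proj p ∈ e.baseSet → ∀ g, (e (act p g)).2 = (e p).2 * g) {p : Total}
    (hp : proj p ∈ e.baseSet) :
    p = act (e.toOpenPartialHomeomorph.symm (proj p, 1)) (e p).2 := by
  have h1 : proj (e.toOpenPartialHomeomorph.symm (proj p, (1 : PSU N))) = proj p :=
    e.proj_symm_apply' hp
  have h2 : e (e.toOpenPartialHomeomorph.symm (proj p, (1 : PSU N))) = (proj p, 1) :=
    e.apply_symm_apply' hp
  refine e.injOn (e.mem_source.2 hp) (e.mem_source.2 (by rw [hproj, h1]; exact hp)) ?_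
  change e p = e (act (e.toOpenPartialHomeomorph.symm (proj p, 1)) (e p).2)
  refine Prod.ext ?_ ?_
  · rw [e.coe_fst' hp, e.coe_fst' (by rw [hproj, h1]; exact hp), hproj, h1]
  · rw [he _ (by rw [h1]; exact hp), h2, one_mul]

variable [NeZero N]

theorem SmoothPSUOn.continuousOn {g : M → PSU N} {U : Set M} (hg : SmoothPSUOn g U) :
    ContinuousOn g U :=
  PSU.isEmbedding_conj.isInducing.continuousOn_iff.2
    (continuousOn_pi.2 fun m => (hg m).continuousOn)

namespace PrincipalPSUBundle

variable {P : PrincipalPSUBundle M N} {e e' : Trivialization (PSU N) P.proj} {x : M}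

/-- A point of `P` over `x` as an element of the fibre. -/
def fiberMk (p : P.Total) (h : P.proj p = x) : P.FiberAt x := ⟨p, h⟩

theorem proj_localSection (hx : x ∈ e.baseSet) : P.proj (localSection e x) = x :=
  e.proj_symm_apply' hx

theorem apply_localSection (hx : x ∈ e.baseSet) : e (localSection e x) = (x, 1) :=
  e.apply_symm_apply' hx

theorem eq_act_localSection (he : e ∈ P.trivs) {p : P.Total} (hp : P.proj p ∈ e.baseSet) :
    p = P.act (localSection e (P.proj p)) (e p).2 :=
  eq_act_of_equivariant P.proj_act e (P.equivariant e he) hp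

theorem coord_eq_transition_mul (he : e ∈ P.trivs) (he' : e' ∈ P.trivs) {p : P.Total}
    (hp : P.proj p ∈ e.baseSet) (hp' : P.proj p ∈ e'.baseSet) :
    (e' p).2 = transition e e' (P.proj p) * (e p).2 := by
  conv_lhs => rw [eq_act_localSection he hp]
  exact P.equivariant e' he' _ (by rw [proj_localSection hp]; exact hp') _

theorem assocMk_act (p : P.FiberAt x) (g : PSU N) (q : P.FiberAt x) (h : q.1 = P.act p.1 g)
    (m : Mat N) : assocMk q m = assocMk p (PSU.conj N g m) :=
  (Quotient.sound (s := P.assocSetoid x) ⟨g, h, rfl⟩).symm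

end PrincipalPSUBundle

end Principal

/-! ### Associated bundles and uniqueness of the gauge theory -/

section Uniqueness

open Filter Topology PrincipalPSUBundle

variable {M : Type*} [TopologicalSpace M] [ChartedSpace E4 M] [IsManifold 𝓘(ℝ, E4) ∞ M]
  {N : ℕ} [NeZero N] {B : EndBundle M N}

namespace AssocIso

variable {P : PrincipalPSUBundle M N} (Φ : AssocIso P B)

open Classical in
/-- The frame of `B` over `e.baseSet` that corresponds, under `B ≅ P ×_{PSU(N)} M_N(ℂ)`, to the
local section of `P` defined by `e`; outside of `e.baseSet` an arbitrary isomorphism. -/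
noncomputable def frame (e : Trivialization (PSU N) P.proj) (y : M) : Mat N ≃⋆ₐ[ℂ] B.Fiber y :=
  if h : y ∈ e.baseSet then (Φ.isStarAlg y ⟨localSection e y, proj_localSection h⟩).choose
  else (B.exists_starFrame y).choose_spec.choose y

variable {e : Trivialization (PSU N) P.proj} {x : M}

theorem frame_apply (hx : x ∈ e.baseSet) (p : P.FiberAt x) (hp : p.1 = localSection e x)
    (m : Mat N) : Φ.frame e x m = Φ.toEquiv x (assocMk p m) := by
  obtain rfl : p = ⟨localSection e x, proj_localSection hx⟩ := Subtype.ext hp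
  rw [frame, dif_pos hx]
  exact ((Φ.isStarAlg x _).choose_spec m).symm

theorem toEquiv_assocMk (he : e ∈ P.trivs) (hx : x ∈ e.baseSet) (p : P.FiberAt x) (m : Mat N) :
    Φ.toEquiv x (assocMk p m) = Φ.frame e x (PSU.conj N (e p.1).2 m) := by
  obtain ⟨p, rfl⟩ := p
  rw [Φ.frame_apply hx ⟨localSection e _, proj_localSection hx⟩ rfl]
  exact congrArg _ (assocMk_act _ _ _ (eq_act_localSection he hx) m)

theorem isStarFrameOn (he : e ∈ P.trivs) : IsStarFrameOn (Φ.frame e) e.baseSet :=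
  ⟨e.open_baseSet, fun m => Φ.smooth e he (fun _ => m) contMDiffOn_const _
    fun _ hx p hp => Φ.frame_apply hx p hp m⟩

end AssocIso

theorem Induces.isConnFormOn {G : GaugeTheory M N} {Φ : AssocIso G.P B} {nabla : StarConnection B}
    (h : Induces G Φ nabla) {e : Trivialization (PSU N) G.P.proj} (he : e ∈ G.P.trivs) :
    IsConnFormOn nabla (Φ.frame e) (G.form e) e.baseSet := by
  intro x hx v m
  have h0 : mvfderiv 𝓘(ℝ, E4) (fun _ : M => m) x v = 0 := by rw [mvfderiv_const]; rfl
  rw [h e he (fun _ => m) contMDiffOn_const _ (fun y hy p hp => Φ.frame_apply hy p hp m) x hx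
    ⟨localSection e x, proj_localSection hx⟩ rfl v, h0, zero_add]
  exact (Φ.frame_apply hx _ rfl _).symm

section Corresponds

variable {P P' : PrincipalPSUBundle M N}

/-- The points `p` and `q` of two principal bundles to which `B` is associated correspond to each
other if they lie over the same `x` and define the same isomorphism `M_N(ℂ) ≅ B_x`. -/
def Corresponds (Φ : AssocIso P B) (Φ' : AssocIso P' B) (p : P.Total) (q : P'.Total) : Prop :=
  ∃ (x : M) (hp : P.proj p = x) (hq : P'.proj q = x), ∀ m,
    Φ.toEquiv x (assocMk (fiberMk p hp) m) = Φ'.toEquiv x (assocMk (fiberMk q hq) m)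

variable {Φ : AssocIso P B} {Φ' : AssocIso P' B}

theorem Corresponds.symm {p : P.Total} {q : P'.Total} (h : Corresponds Φ Φ' p q) :
    Corresponds Φ' Φ q p := by
  obtain ⟨x, hp, hq, H⟩ := h
  exact ⟨x, hq, hp, fun m => (H m).symm⟩

theorem Corresponds.proj_eq {p : P.Total} {q : P'.Total} (h : Corresponds Φ Φ' p q) :
    P'.proj q = P.proj p := by
  obtain ⟨x, hp, hq, -⟩ := h
  rw [hp, hq]

/-- The transition function between the frames of `B` defined by `e` and `e'`. -/
noncomputable def frameTransition (Φ : AssocIso P B) (Φ' : AssocIso P' B)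
    (e : Trivialization (PSU N) P.proj) (e' : Trivialization (PSU N) P'.proj) (y : M) : PSU N :=
  PSU.ofAut ((Φ.frame e y).trans (Φ'.frame e' y).symm)

theorem frame_frameTransition (e : Trivialization (PSU N) P.proj)
    (e' : Trivialization (PSU N) P'.proj) (y : M) (m : Mat N) :
    Φ.frame e y m = Φ'.frame e' y (PSU.conj N (frameTransition Φ Φ' e e' y) m) := by
  rw [frameTransition, PSU.conj_ofAut, StarAlgEquiv.trans_apply, StarAlgEquiv.apply_symm_apply]

variable {e : Trivialization (PSU N) P.proj} {e' : Trivialization (PSU N) P'.proj}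

/-- In fibre coordinates the correspondence is multiplication by the frame transition. -/
theorem corresponds_iff (he : e ∈ P.trivs) (he' : e' ∈ P'.trivs) {p : P.Total} {q : P'.Total}
    (hp : P.proj p ∈ e.baseSet) (hp' : P.proj p ∈ e'.baseSet) :
    Corresponds Φ Φ' p q ↔ P'.proj q = P.proj p ∧
      (e' q).2 = frameTransition Φ Φ' e e' (P.proj p) * (e p).2 := by
  have key : ∀ h : P'.proj q = P.proj p, (∀ m, Φ.toEquiv (P.proj p) (assocMk (fiberMk p rfl) m) =
      Φ'.toEquiv (P.proj p) (assocMk (fiberMk q h) m)) ↔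
        (e' q).2 = frameTransition Φ Φ' e e' (P.proj p) * (e p).2 := by
    intro h
    have h1 : ∀ m, Φ.toEquiv (P.proj p) (assocMk (fiberMk p rfl) m) = Φ'.frame e' (P.proj p)
        (PSU.conj N (frameTransition Φ Φ' e e' (P.proj p) * (e p).2) m) := fun m => by
      rw [Φ.toEquiv_assocMk he hp, frame_frameTransition (Φ' := Φ') e e', PSU.conj_mul_apply]
      rfl
    have h2 : ∀ m, Φ'.toEquiv (P.proj p) (assocMk (fiberMk q h) m) = Φ'.frame e' (P.proj p)
        (PSU.conj N (e' q).2 m) := fun m => Φ'.toEquiv_assocMk he' hp' _ m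
    simp only [h1, h2]
    exact ⟨fun H => PSU.ext_conj fun m => ((Φ'.frame e' (P.proj p)).injective (H m)).symm,
      fun H m => by rw [H]⟩
  constructor
  · rintro ⟨x, rfl, h, H⟩
    exact ⟨h, (key h).1 H⟩
  · rintro ⟨h, H⟩
    exact ⟨_, rfl, h, (key h).2 H⟩

variable (Φ Φ') in
theorem existsUnique_corresponds (p : P.Total) : ∃! q, Corresponds Φ Φ' p q := by
  obtain ⟨e, he, hp⟩ := P.cover (P.proj p)
  obtain ⟨e', he', hp'⟩ := P'.cover (P.proj p)
  simp only [corresponds_iff he he' hp hp']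
  set h := frameTransition Φ Φ' e e' (P.proj p) * (e p).2
  have h1 : P'.proj (e'.toOpenPartialHomeomorph.symm (P.proj p, h)) = P.proj p :=
    e'.proj_symm_apply' hp'
  have h2 : e' (e'.toOpenPartialHomeomorph.symm (P.proj p, h)) = (P.proj p, h) :=
    e'.apply_symm_apply' hp'
  refine ⟨e'.toOpenPartialHomeomorph.symm (P.proj p, h), ⟨h1, by rw [h2]⟩, ?_⟩
  rintro q ⟨hq, hq'⟩
  refine e'.injOn (e'.mem_source.2 (by rwa [hq])) (e'.mem_source.2 (by rwa [h1])) ?_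
  change e' q = e' (e'.toOpenPartialHomeomorph.symm (P.proj p, h))
  rw [h2]
  exact Prod.ext ((e'.coe_fst' (by rwa [hq])).trans hq) hq'

variable (Φ Φ') in
/-- The map `P → P'` that sends each point to the corresponding one. -/
noncomputable def corr (p : P.Total) : P'.Total := (existsUnique_corresponds Φ Φ' p).choose

theorem corresponds_corr (p : P.Total) : Corresponds Φ Φ' p (corr Φ Φ' p) :=
  (existsUnique_corresponds Φ Φ' p).choose_spec.1

theorem Corresponds.eq_corr {p : P.Total} {q : P'.Total} (h : Corresponds Φ Φ' p q) :
    q = corr Φ Φ' p :=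
  (existsUnique_corresponds Φ Φ' p).choose_spec.2 q h

theorem proj_corr (p : P.Total) : P'.proj (corr Φ Φ' p) = P.proj p := ((corresponds_corr p).proj_eq)

theorem corr_corr (p : P.Total) : corr Φ' Φ (corr Φ Φ' p) = p :=
  (corresponds_corr p).symm.eq_corr.symm

theorem coord_corr (he : e ∈ P.trivs) (he' : e' ∈ P'.trivs) {p : P.Total}
    (hp : P.proj p ∈ e.baseSet) (hp' : P.proj p ∈ e'.baseSet) :
    (e' (corr Φ Φ' p)).2 = frameTransition Φ Φ' e e' (P.proj p) * (e p).2 :=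
  ((corresponds_iff he he' hp hp').1 (corresponds_corr p)).2

theorem corr_act (p : P.Total) (g : PSU N) :
    corr Φ Φ' (P.act p g) = P'.act (corr Φ Φ' p) g := by
  obtain ⟨e, he, hp⟩ := P.cover (P.proj p)
  obtain ⟨e', he', hp'⟩ := P'.cover (P.proj p)
  refine (Corresponds.eq_corr ?_).symm
  rw [corresponds_iff he he' (by rwa [P.proj_act]) (by rwa [P.proj_act]), P'.proj_act,
    P.proj_act, proj_corr, P'.equivariant e' he' _ (by rwa [proj_corr]),
    P.equivariant e he _ hp, coord_corr he he' hp hp', mul_assoc]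
  exact ⟨rfl, rfl⟩

variable (Φ Φ') in
theorem continuous_corr : Continuous (corr Φ Φ') := by
  refine continuous_iff_continuousAt.2 fun p => ?_
  obtain ⟨e, he, hp⟩ := P.cover (P.proj p)
  obtain ⟨e', he', hp'⟩ := P'.cover (P.proj p)
  have hnear : ∀ᶠ r in 𝓝 p, P.proj r ∈ e.baseSet ∩ e'.baseSet :=
    (e.continuousAt_proj (e.mem_source.2 hp)).eventually
      ((e.open_baseSet.inter e'.open_baseSet).mem_nhds ⟨hp, hp'⟩)
  have heq : corr Φ Φ' =ᶠ[𝓝 p] fun r => e'.toOpenPartialHomeomorph.symm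
      (P.proj r, frameTransition Φ Φ' e e' (P.proj r) * (e r).2) := by
    filter_upwards [hnear] with r hr
    rw [← coord_corr he he' hr.1 hr.2]
    have h1 := e'.symm_apply_mk_proj (x := corr Φ Φ' r) (e'.mem_source.2 (by
      rw [proj_corr]; exact hr.2))
    rw [proj_corr] at h1
    exact h1.symm
  refine ContinuousAt.congr ?_ heq.symm
  have hpr : ContinuousAt P.proj p := e.continuousAt_proj (e.mem_source.2 hp)
  have hg : ContinuousAt (frameTransition Φ Φ' e e') (P.proj p) :=
    (smoothPSUOn_of_frames (Φ.isStarFrameOn he) (Φ'.isStarFrameOn he')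
      fun y _ m => frame_frameTransition e e' y m).continuousOn.continuousAt
      ((e.open_baseSet.inter e'.open_baseSet).mem_nhds ⟨hp, hp'⟩)
  have he2 : ContinuousAt (fun r => (e r).2) p :=
    continuous_snd.continuousAt.comp (e.continuousAt (e.mem_source.2 hp))
  refine ContinuousAt.comp (g := e'.toOpenPartialHomeomorph.symm)
    (e'.continuousAt_symm ?_) (hpr.prodMk ((hg.comp hpr).mul he2))
  exact e'.mem_target.2 hp'

end Corresponds

/-- Two gauge theories that induce the same connection on the same endomorphism bundle are
isomorphic. -/
theorem GaugeTheory.nonempty_iso [T2Space M] {G G' : GaugeTheory M N} {nabla : StarConnection B}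
    {Φ : AssocIso G.P B} {Φ' : AssocIso G'.P B} (hΦ : Induces G Φ nabla)
    (hΦ' : Induces G' Φ' nabla) : Nonempty (GaugeTheory.Iso G G') := by
  have hcoord : ∀ e ∈ G.P.trivs, ∀ e' ∈ G'.P.trivs, ∀ y ∈ e.baseSet ∩ e'.baseSet, ∀ m,
      Φ.frame e y m =
        Φ'.frame e' y (PSU.conj N (e' (corr Φ Φ' (localSection e y))).2 m) := by
    intro e he e' he' y hy m
    have h1 := proj_localSection hy.1
    rw [coord_corr he he' (by rw [h1]; exact hy.1) (by rw [h1]; exact hy.2), h1,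
      apply_localSection hy.1, mul_one]
    exact frame_frameTransition e e' y m
  exact ⟨{
    toHomeo :=
      { toFun := corr Φ Φ'
        invFun := corr Φ' Φ
        left_inv := corr_corr
        right_inv := corr_corr
        continuous_toFun := continuous_corr Φ Φ'
        continuous_invFun := continuous_corr Φ' Φ }
    proj_eq := proj_corr
    map_act := corr_act
    smooth := fun e he e' he' => smoothPSUOn_of_frames (Φ.isStarFrameOn he)
      (Φ'.isStarFrameOn he') (hcoord e he e' he')
    map_form := fun e he e' he' => gaugeRelatedOn_of_frames (Φ.isStarFrameOn he)
      (Φ'.isStarFrameOn he') (hΦ.isConnFormOn he) (hΦ'.isConnFormOn he') (hcoord e he e' he') }⟩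

end Uniqueness

/-! ### The frame bundle of an endomorphism bundle -/

section FrameBundle

open Filter Topology PrincipalPSUBundle

variable {M : Type*} [TopologicalSpace M] [ChartedSpace E4 M] [IsManifold 𝓘(ℝ, E4) ∞ M]
  {N : ℕ}

namespace EndBundle

/-- The domain of a chosen star frame around `i`. -/
noncomputable def chartSet (B : EndBundle M N) (i : M) : Set M := (B.exists_starFrame i).choose

/-- A chosen star frame around `i`. -/
noncomputable def chartFrame (B : EndBundle M N) (i y : M) : Mat N ≃⋆ₐ[ℂ] B.Fiber y :=
  (B.exists_starFrame i).choose_spec.choose y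

theorem mem_chartSet (B : EndBundle M N) (i : M) : i ∈ B.chartSet i :=
  (B.exists_starFrame i).choose_spec.choose_spec.1

theorem isStarFrameOn_chartFrame (B : EndBundle M N) (i : M) :
    IsStarFrameOn (B.chartFrame i) (B.chartSet i) :=
  (B.exists_starFrame i).choose_spec.choose_spec.2

variable [NeZero N] (B : EndBundle M N)

/-- The transition function between two chosen frames. -/
noncomputable def chartTransition (i j y : M) : PSU N :=
  PSU.ofAut ((B.chartFrame i y).trans (B.chartFrame j y).symm)

variable {B} in
theorem chartFrame_chartTransition (i j y : M) (m : Mat N) :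
    B.chartFrame j y (PSU.conj N (B.chartTransition i j y) m) = B.chartFrame i y m := by
  rw [chartTransition, PSU.conj_ofAut, StarAlgEquiv.trans_apply, StarAlgEquiv.apply_symm_apply]

/-- The principal `PSU(N)`-bundle of star frames of `B`, given by the transition functions between
the chosen frames. -/
noncomputable def frameCore : FiberBundleCore M M (PSU N) where
  baseSet := B.chartSet
  isOpen_baseSet i := (B.isStarFrameOn_chartFrame i).isOpen
  indexAt := id
  mem_baseSet_at := B.mem_chartSet
  coordChange i j x h := B.chartTransition i j x * h
  coordChange_self i x _ h := by
    have : B.chartTransition i i x = 1 := PSU.ext_conj fun m => (B.chartFrame i x).injective (by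
      change B.chartFrame i x _ = B.chartFrame i x _
      rw [chartFrame_chartTransition, map_one]; rfl)
    rw [this, one_mul]
  continuousOn_coordChange i j := by
    have h := (smoothPSUOn_of_frames (B.isStarFrameOn_chartFrame i)
      (B.isStarFrameOn_chartFrame j) (g := B.chartTransition i j)
      fun y _ m => (chartFrame_chartTransition i j y m).symm).continuousOn
    exact (h.comp continuousOn_fst fun p hp => hp.1).mul continuousOn_snd
  coordChange_comp i j k x _ h := by
    rw [← mul_assoc]
    congr 1
    refine PSU.ext_conj fun m => (B.chartFrame k x).injective ?_
    change B.chartFrame k x _ = B.chartFrame k x _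
    rw [PSU.conj_mul_apply, chartFrame_chartTransition, chartFrame_chartTransition,
      chartFrame_chartTransition]

/-- The point of the frame bundle over `x` with fibre coordinate `h`, with respect to the frame
chosen around `x`. -/
noncomputable def frameMk (x : M) (h : PSU N) : B.frameCore.TotalSpace := ⟨x, h⟩

/-- The fibre coordinate of a point of the frame bundle. -/
noncomputable def frameCoord (p : B.frameCore.TotalSpace) : PSU N := p.2

/-- The right action of `PSU(N)` on the frame bundle. -/
noncomputable def frameAct (p : B.frameCore.TotalSpace) (g : PSU N) : B.frameCore.TotalSpace :=
  B.frameMk p.1 (B.frameCoord p * g)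

/-- The star frame of `B` that corresponds to a point of the frame bundle over `x` with fibre
coordinate `h`. -/
noncomputable def pointFrame (x : M) (h : PSU N) : Mat N ≃⋆ₐ[ℂ] B.Fiber x :=
  (PSU.conj N h).trans (B.chartFrame x x)

theorem pointFrame_mul (x : M) (h g : PSU N) (m : Mat N) :
    B.pointFrame x (h * g) m = B.pointFrame x h (PSU.conj N g m) := by
  simp only [pointFrame, StarAlgEquiv.trans_apply, PSU.conj_mul_apply]

variable {B}

/-- The local star frame of `B` defined by a local trivialization of the frame bundle. -/
noncomputable def trivFrame (e : Trivialization (PSU N) B.frameCore.proj) (y : M) :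
    Mat N ≃⋆ₐ[ℂ] B.Fiber y :=
  B.pointFrame y (B.frameCoord (e.toOpenPartialHomeomorph.symm (y, 1)))

/-- Equivariance of a local trivialization of the frame bundle. -/
def IsEquivariant (e : Trivialization (PSU N) B.frameCore.proj) : Prop :=
  ∀ p, B.frameCore.proj p ∈ e.baseSet → ∀ g, (e (B.frameAct p g)).2 = (e p).2 * g

variable {e e' : Trivialization (PSU N) B.frameCore.proj} {x : M}

theorem IsEquivariant.pointFrame_eq (he : IsEquivariant e) {p : B.frameCore.TotalSpace}
    (hp : p.1 = x) (hx : x ∈ e.baseSet) (m : Mat N) :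
    B.pointFrame x (B.frameCoord p) m = trivFrame e x (PSU.conj N (e p).2 m) := by
  subst hp
  have h1 := eq_act_of_equivariant (act := B.frameAct) (fun _ _ => rfl) e he hx
  have h2 : B.frameCoord p =
      B.frameCoord (e.toOpenPartialHomeomorph.symm (p.1, 1)) * (e p).2 :=
    congrArg B.frameCoord h1
  rw [trivFrame, ← pointFrame_mul, ← h2]

theorem IsEquivariant.trivFrame_eq (he' : IsEquivariant e') (hx : x ∈ e.baseSet ∩ e'.baseSet)
    (m : Mat N) : trivFrame e x m =
      trivFrame e' x (PSU.conj N (e' (e.toOpenPartialHomeomorph.symm (x, 1))).2 m) :=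
  he'.pointFrame_eq (e.proj_symm_apply' hx.1) hx.2 m

theorem isEquivariant_localTriv (i : M) : IsEquivariant (B.frameCore.localTriv i) :=
  fun _ _ _ => (mul_assoc _ _ _).symm

theorem trivFrame_localTriv (i : M) (m : Mat N) :
    trivFrame (B.frameCore.localTriv i) x m = B.chartFrame i x m := by
  change B.chartFrame x x (PSU.conj N (B.chartTransition i x x * 1) m) = _
  rw [mul_one, chartFrame_chartTransition]

theorem isStarFrameOn_localTriv (i : M) : IsStarFrameOn (trivFrame (B.frameCore.localTriv i))
    (B.frameCore.localTriv i).baseSet := by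
  refine ⟨(B.frameCore.localTriv i).open_baseSet, fun m => ?_⟩
  simp only [trivFrame_localTriv]
  exact (B.isStarFrameOn_chartFrame i).smooth m

variable (B) in
/-- The principal `PSU(N)`-bundle of star frames of `B`. Its atlas consists of the equivariant
trivializations whose associated frame of `B` is smooth. -/
noncomputable def frameBundle : PrincipalPSUBundle M N where
  Total := B.frameCore.TotalSpace
  act := B.frameAct
  act_one p := by
    change B.frameMk p.1 (B.frameCoord p * 1) = p
    rw [mul_one]; rfl
  act_mul p g h := by
    change B.frameMk p.1 (B.frameCoord p * (g * h)) = B.frameMk p.1 (B.frameCoord p * g * h)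
    rw [mul_assoc]
  proj := B.frameCore.proj
  proj_act _ _ := rfl
  trivs := {e | IsEquivariant e ∧ IsStarFrameOn (trivFrame e) e.baseSet}
  cover x := ⟨B.frameCore.localTriv x, ⟨isEquivariant_localTriv x, isStarFrameOn_localTriv x⟩,
    B.mem_chartSet x⟩
  equivariant _ he := he.1
  smooth _ he _ he' := smoothPSUOn_of_frames he.2 he'.2 fun _ hy m => he'.1.trivFrame_eq hy m
  maximal e he h := by
    refine ⟨he, e.open_baseSet, fun m x hx => ContMDiffAt.contMDiffWithinAt ?_⟩
    -- Smoothness of the frame near `x` is tested against the local trivialization around `x`.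
    have hL := isStarFrameOn_localTriv (B := B) x
    have hxL : x ∈ (B.frameCore.localTriv x).baseSet := B.mem_chartSet x
    have h1 := (h (B.frameCore.localTriv x)
      ⟨isEquivariant_localTriv x, isStarFrameOn_localTriv x⟩).1 m
    have hopen := e.open_baseSet.inter (B.frameCore.localTriv x).open_baseSet
    refine contMDiffAt_section_congr ((hL.contMDiffAt_iff hxL).2
      (SmoothFunOn.contMDiffAt hopen ⟨hx, hxL⟩ h1)) ?_
    filter_upwards [hopen.mem_nhds ⟨hx, hxL⟩] with y hy
    exact (isEquivariant_localTriv x).trivFrame_eq hy m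

/-- The gauge theory of a hermitian `*`-algebra connection on `B`: the bundle of star frames with
the connection forms of `∇` in these frames. -/
noncomputable def gaugeTheory [T2Space M] (nabla : StarConnection B) : GaugeTheory M N where
  P := B.frameBundle
  form e := connForm nabla (trivFrame (B := B) e)
  isSuForm _ he := isSuFormOn_connForm nabla he.2
  transform _ he _ he' := gaugeRelatedOn_of_frames he.2 he'.2 (isConnFormOn_connForm nabla he.2)
    (isConnFormOn_connForm nabla he'.2) fun _ hy m => he'.1.trivFrame_eq hy m

/-- The map `[p, m] ↦ p(m)`, a point `p` of the frame bundle being an isomorphism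
`M_N(ℂ) ≅ B_x`. -/
noncomputable def evalFrame (x : M) : B.frameBundle.AssocFiber x → B.Fiber x :=
  Quotient.lift (fun a => B.pointFrame x (B.frameCoord a.1.1) a.2) <| by
    rintro ⟨⟨p, hp⟩, m⟩ ⟨⟨q, hq⟩, m'⟩ ⟨g, hg, hm⟩
    change m = PSU.conj N g m' at hm
    change q = B.frameAct p g at hg
    subst hg hm
    exact (B.pointFrame_mul x _ g m').symm

theorem evalFrame_bijective (x : M) : Function.Bijective (evalFrame (B := B) x) := by
  constructor
  · rintro ⟨⟨p, hp⟩, m⟩ ⟨⟨q, hq⟩, m'⟩ h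
    change p.1 = x at hp
    change q.1 = x at hq
    have h3 : PSU.conj N (B.frameCoord p) m = PSU.conj N (B.frameCoord q) m' :=
      (B.chartFrame x x).injective h
    refine Quotient.sound (s := B.frameBundle.assocSetoid x)
      ⟨(B.frameCoord p)⁻¹ * B.frameCoord q, ?_, ?_⟩
    · change B.frameMk q.1 (B.frameCoord q) = B.frameMk p.1 (B.frameCoord p *
        ((B.frameCoord p)⁻¹ * B.frameCoord q))
      rw [mul_inv_cancel_left, hp, hq]
    · rw [PSU.conj_mul_apply]
      change m = _
      rw [← h3, PSU.conj_inv_conj]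
  · intro b
    refine ⟨assocMk (P := B.frameBundle) (fiberMk (P := B.frameBundle)
      (B.frameMk x 1) rfl) ((B.pointFrame x 1).symm b), ?_⟩
    exact (B.pointFrame x 1).apply_symm_apply b

theorem evalFrame_localSection {e : Trivialization (PSU N) B.frameBundle.proj}
    (p : B.frameBundle.FiberAt x) (hp : p.1 = localSection e x) (m : Mat N) :
    evalFrame x (assocMk p m) = trivFrame (B := B) e x m := by
  obtain ⟨p, h⟩ := p
  change p = _ at hp
  subst hp
  rfl

variable (B) in
/-- `B` is the bundle associated to its frame bundle. -/
noncomputable def frameAssocIso : AssocIso B.frameBundle B where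
  toEquiv x := Equiv.ofBijective _ (evalFrame_bijective x)
  isStarAlg x p := ⟨B.pointFrame x (B.frameCoord p.1), fun _ => rfl⟩
  smooth e he f hf σ hσ := by
    intro x hx
    refine ContMDiffAt.contMDiffWithinAt (contMDiffAt_section_congr
      ((he.2.contMDiffAt_iff hx).2 (hf.contMDiffAt e.open_baseSet hx)) ?_)
    filter_upwards [e.open_baseSet.mem_nhds hx] with y hy
    rw [hσ y hy (fiberMk (localSection e y) (proj_localSection hy)) rfl]
    exact evalFrame_localSection (e := e) _ rfl (f y)

theorem induces_gaugeTheory [T2Space M] (nabla : StarConnection B) :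
    Induces (gaugeTheory nabla) (frameAssocIso B) nabla := by
  intro e he f hf σ hσ x hx p hp v
  refine ((isConnFormOn_connForm nabla he.2).cov_eq he.2 hx
    (SmoothFunOn.contMDiffAt e.open_baseSet hx hf) ?_ v).trans
    (evalFrame_localSection (e := e) p hp _).symm
  filter_upwards [e.open_baseSet.mem_nhds hx] with y hy
  rw [hσ y hy (fiberMk (localSection e y) (proj_localSection hy)) rfl]
  exact evalFrame_localSection (e := e) _ rfl (f y)

end EndBundle

end FrameBundle

/-! ### The endomorphism bundle of a gauge theory -/

section Core

open Filter Topology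

variable {M : Type*} [TopologicalSpace M] [ChartedSpace E4 M]
  {F ι : Type*} [NormedAddCommGroup F] [NormedSpace ℝ F]

theorem VectorBundleCore.contMDiffAt_iff [IsManifold 𝓘(ℝ, E4) ∞ M] (Z : VectorBundleCore ℝ M F ι)
    [Z.IsContMDiff 𝓘(ℝ, E4) ∞] {i : ι} {x : M} (hx : x ∈ Z.baseSet i) (σ : ∀ y, Z.Fiber y) :
    SmoothSectionAt F σ x ↔
      SmoothFunAt (fun y => Z.coordChange (Z.indexAt y) i y (σ y)) x :=
  haveI : MemTrivializationAtlas (Z.localTriv i) := ⟨⟨i, rfl⟩⟩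
  (Z.localTriv i).contMDiffAt_section_iff hx

theorem VectorBundleCore.mdifferentiableAt [IsManifold 𝓘(ℝ, E4) ∞ M]
    (Z : VectorBundleCore ℝ M F ι) {x : M} {σ : ∀ y, Z.Fiber y}
    (hσ : MDifferentiableAt 𝓘(ℝ, E4) (𝓘(ℝ, E4).prod 𝓘(ℝ, F))
      (fun y => TotalSpace.mk' F y (σ y)) x) :
    MDifferentiableAt 𝓘(ℝ, E4) 𝓘(ℝ, F)
      (fun y => Z.coordChange (Z.indexAt y) (Z.indexAt x) y (σ y)) x :=
  (mdifferentiableAt_section (F := F) 𝓘(ℝ, E4) σ).1 hσ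

variable [FiniteDimensional ℝ F]

/-- The vector bundle with given pointwise smooth coordinate changes. -/
noncomputable def smoothCore (baseSet : ι → Set M) (isOpen : ∀ i, IsOpen (baseSet i))
    (indexAt : M → ι) (mem : ∀ x, x ∈ baseSet (indexAt x)) (c : ι → ι → M → F →ₗ[ℝ] F)
    (c_self : ∀ i, ∀ x ∈ baseSet i, ∀ w, c i i x w = w)
    (c_smooth : ∀ i j w, SmoothFunOn (fun x => c i j x w) (baseSet i ∩ baseSet j))
    (c_comp : ∀ i j k, ∀ x ∈ baseSet i ∩ baseSet j ∩ baseSet k, ∀ w,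
      c j k x (c i j x w) = c i k x w) : VectorBundleCore ℝ M F ι where
  baseSet := baseSet
  isOpen_baseSet := isOpen
  indexAt := indexAt
  mem_baseSet_at := mem
  coordChange i j x := LinearMap.toContinuousLinearMap (c i j x)
  coordChange_self := c_self
  continuousOn_coordChange i j x hx := by
    have h : SmoothFunAt (fun y => LinearMap.toContinuousLinearMap (c i j y)) x :=
      contMDiffAt_clm_of_apply fun w =>
        (c_smooth i j w).contMDiffAt ((isOpen i).inter (isOpen j)) hx
    exact h.continuousAt.continuousWithinAt
  coordChange_comp := c_comp

theorem smoothFunAt_const {F : Type*} [NormedAddCommGroup F] [NormedSpace ℝ F] (c : F) (x : M) :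
    SmoothFunAt (fun _ : M => c) x :=
  contMDiffAt_const

theorem SmoothFunAt.bilin {F₁ F₂ F₃ : Type*} [NormedAddCommGroup F₁] [NormedSpace ℝ F₁]
    [FiniteDimensional ℝ F₁] [NormedAddCommGroup F₂] [NormedSpace ℝ F₂] [FiniteDimensional ℝ F₂]
    [NormedAddCommGroup F₃] [NormedSpace ℝ F₃] {f : M → F₁} {g : M → F₂} {x : M}
    (hf : SmoothFunAt f x) (hg : SmoothFunAt g x) (b : F₁ →ₗ[ℝ] F₂ →ₗ[ℝ] F₃) :
    SmoothFunAt (fun y => b (f y) (g y)) x :=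
  (contMDiffAt_clm_of_apply (A := fun y => LinearMap.toContinuousLinearMap (b (f y)))
    fun w => hf.linearMap_comp (b.flip w)).clm_apply hg

theorem mvfderiv_bilin {F₁ F₂ F₃ : Type*} [NormedAddCommGroup F₁] [NormedSpace ℝ F₁]
    [FiniteDimensional ℝ F₁] [NormedAddCommGroup F₂] [NormedSpace ℝ F₂] [FiniteDimensional ℝ F₂]
    [NormedAddCommGroup F₃] [NormedSpace ℝ F₃] {f : M → F₁} {g : M → F₂} {x : M}
    (hf : SmoothFunAt f x) (hg : SmoothFunAt g x) (b : F₁ →ₗ[ℝ] F₂ →ₗ[ℝ] F₃)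
    (v : TangentSpace 𝓘(ℝ, E4) x) :
    mvfderiv 𝓘(ℝ, E4) (fun y => b (f y) (g y)) x v =
      b (mvfderiv 𝓘(ℝ, E4) f x v) (g x) + b (f x) (mvfderiv 𝓘(ℝ, E4) g x v) := by
  let c : F₁ →L[ℝ] F₂ →L[ℝ] F₃ := LinearMap.toContinuousLinearMap
    ((LinearMap.toContinuousLinearMap : (F₂ →ₗ[ℝ] F₃) ≃ₗ[ℝ] F₂ →L[ℝ] F₃).toLinearMap ∘ₗ b)
  have h1 := HasMFDerivAt.prodMk (hf.mdifferentiableAt (by simp)).hasMFDerivAt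
    (hg.mdifferentiableAt (by simp)).hasMFDerivAt
  rw [← modelWithCornersSelf_prod] at h1
  have h2 := (c.isBoundedBilinearMap.hasFDerivAt (f x, g x)).hasMFDerivAt.comp x h1
  change mfderiv 𝓘(ℝ, E4) 𝓘(ℝ, F₃) (fun y => b (f y) (g y)) x v = _
  have h3 : mfderiv 𝓘(ℝ, E4) 𝓘(ℝ, F₃) (fun y => b (f y) (g y)) x = _ := h2.mfderiv
  rw [h3]
  change b (f x) (mfderiv 𝓘(ℝ, E4) 𝓘(ℝ, F₂) g x v) + b (mfderiv 𝓘(ℝ, E4) 𝓘(ℝ, F₁) f x v) (g x) = _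
  rw [add_comm]; rfl

/-- The product rule for a varying linear map, tested on constant vectors. -/
theorem mvfderiv_linearMap_apply {F₁ F₂ : Type*} [NormedAddCommGroup F₁] [NormedSpace ℝ F₁]
    [FiniteDimensional ℝ F₁] [NormedAddCommGroup F₂] [NormedSpace ℝ F₂]
    [FiniteDimensional ℝ F₂] {A : M → F₁ →ₗ[ℝ] F₂} {f : M → F₁} {x : M}
    (hA : ∀ w, SmoothFunAt (fun y => A y w) x) (hf : SmoothFunAt f x)
    (v : TangentSpace 𝓘(ℝ, E4) x) :
    mvfderiv 𝓘(ℝ, E4) (fun y => A y (f y)) x v =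
      A x (mvfderiv 𝓘(ℝ, E4) f x v) + mvfderiv 𝓘(ℝ, E4) (fun y => A y (f x)) x v := by
  have hA' : SmoothFunAt (fun y => LinearMap.toContinuousLinearMap (A y)) x :=
    contMDiffAt_clm_of_apply hA
  let b : (F₁ →L[ℝ] F₂) →ₗ[ℝ] F₁ →ₗ[ℝ] F₂ := ContinuousLinearMap.coeLM ℝ
  have h1 := mvfderiv_bilin hA' hf b v
  have h2 := mvfderiv_bilin hA' (smoothFunAt_const (f x) x) b v
  rw [mvfderiv_const] at h2
  refine h1.trans ((add_comm _ _).trans (congrArg _ ?_))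
  refine Eq.trans ?_ h2.symm
  simp

theorem VectorBundleCore.isContMDiff_of_apply (Z : VectorBundleCore ℝ M F ι)
    (h : ∀ i j w, SmoothFunOn (fun x => Z.coordChange i j x w) (Z.baseSet i ∩ Z.baseSet j)) :
    Z.IsContMDiff 𝓘(ℝ, E4) ∞ :=
  ⟨fun i j _ hx => (contMDiffAt_clm_of_apply (A := Z.coordChange i j) fun w =>
    (h i j w).contMDiffAt ((Z.isOpen_baseSet i).inter (Z.isOpen_baseSet j))
      hx).contMDiffWithinAt⟩

end Core

section Associated

open Filter Topology PrincipalPSUBundle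

variable {M : Type*} [TopologicalSpace M] [ChartedSpace E4 M]
  {N : ℕ} [NeZero N]

/-- The action of `PSU(N)` on the real vector space `M_N(ℂ)`. -/
noncomputable def PSU.conjLin (g : PSU N) : Mat N →ₗ[ℝ] Mat N where
  toFun := PSU.conj N g
  map_add' := map_add _
  map_smul' r m := (PSU.conj N g).map_real_smul r m

/-- The commutator as a real bilinear map. -/
noncomputable def bracketLin {N : ℕ} : Mat N →ₗ[ℝ] Mat N →ₗ[ℝ] Mat N :=
  LinearMap.mul ℝ (Mat N) - (LinearMap.mul ℝ (Mat N)).flip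

/-- The conjugate transpose as a real linear map. -/
def matStar {N : ℕ} : Mat N →ₗ[ℝ] Mat N where
  toFun := star
  map_add' := star_add
  map_smul' r m := by
    rw [star_smul, star_trivial]; rfl

namespace PrincipalPSUBundle

variable (P : PrincipalPSUBundle M N)

/-- A chosen local trivialization of `P` around `x`. -/
noncomputable def trivAt (x : M) : P.trivs := ⟨(P.cover x).choose, (P.cover x).choose_spec.1⟩

theorem mem_trivAt (x : M) : x ∈ (P.trivAt x).1.baseSet := (P.cover x).choose_spec.2

variable {P}

theorem transition_self {e : Trivialization (PSU N) P.proj} {x : M} (hx : x ∈ e.baseSet) :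
    transition e e x = 1 := by
  rw [transition, apply_localSection hx]

theorem transition_mul {e e' e'' : Trivialization (PSU N) P.proj} (he' : e' ∈ P.trivs)
    (he'' : e'' ∈ P.trivs) {x : M}
    (hx : x ∈ e.baseSet) (hx' : x ∈ e'.baseSet) (hx'' : x ∈ e''.baseSet) :
    transition e' e'' x * transition e e' x = transition e e'' x := by
  have h := proj_localSection hx
  have h1 := coord_eq_transition_mul he' he'' (p := localSection e x) (by rwa [h]) (by rwa [h])
  rw [h] at h1
  exact h1.symm

theorem smooth_transition {e e' : Trivialization (PSU N) P.proj} (he : e ∈ P.trivs)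
    (he' : e' ∈ P.trivs) : SmoothPSUOn (transition e e') (e.baseSet ∩ e'.baseSet) :=
  P.smooth e he e' he'

variable (P)

/-- The vector bundle `P ×_{PSU(N)} M_N(ℂ)`, given by its coordinate changes. -/
noncomputable def assocCore : VectorBundleCore ℝ M (Mat N) P.trivs :=
  smoothCore (fun e => e.1.baseSet) (fun e => e.1.open_baseSet) P.trivAt P.mem_trivAt
    (fun e e' x => PSU.conjLin (transition e.1 e'.1 x))
    (fun e x hx w => by
      change PSU.conj N (transition e.1 e.1 x) w = w
      rw [transition_self hx, map_one]; rfl)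
    (fun e e' w => smooth_transition e.2 e'.2 w)
    (fun e e' e'' x hx w => by
      change PSU.conj N _ (PSU.conj N _ w) = PSU.conj N _ w
      rw [← PSU.conj_mul_apply, transition_mul e'.2 e''.2 hx.1.1 hx.1.2 hx.2])

instance : (P.assocCore).IsContMDiff 𝓘(ℝ, E4) ∞ :=
  VectorBundleCore.isContMDiff_of_apply _ fun e e' w => smooth_transition e.2 e'.2 w

/-- The `M_N(ℂ)`-valued function that represents the section `σ` of the associated bundle in the
trivialization `e`. -/
noncomputable def secCoord {P : PrincipalPSUBundle M N} (e : Trivialization (PSU N) P.proj)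
    (σ : M → Mat N) (y : M) : Mat N :=
  PSU.conj N (transition (P.trivAt y).1 e y) (σ y)

variable {P} in
theorem secCoord_trivAt (σ : M → Mat N) (x : M) : secCoord (P.trivAt x).1 σ x = σ x := by
  rw [secCoord, transition_self (P.mem_trivAt x), map_one]; rfl

variable {P} in
theorem secCoord_change {e e' : Trivialization (PSU N) P.proj} (he : e ∈ P.trivs)
    (he' : e' ∈ P.trivs) {y : M} (hy : y ∈ e.baseSet ∩ e'.baseSet) (σ : M → Mat N) :
    secCoord e' σ y = PSU.conj N (transition e e' y) (secCoord e σ y) := by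
  rw [secCoord, secCoord, ← PSU.conj_mul_apply, transition_mul he he' (P.mem_trivAt y) hy.1 hy.2]

theorem secCoord_transition {e : Trivialization (PSU N) P.proj} (he : e ∈ P.trivs) {y : M}
    (hy : y ∈ e.baseSet) (m : Mat N) :
    PSU.conj N (transition (P.trivAt y).1 e y) (PSU.conj N (transition e (P.trivAt y).1 y) m)
      = m := by
  rw [← PSU.conj_mul_apply, transition_mul (P.trivAt y).2 he hy (P.mem_trivAt y) hy,
    transition_self hy, map_one]; rfl

variable [IsManifold 𝓘(ℝ, E4) ∞ M]

theorem assocCore_contMDiffAt_iff {e : Trivialization (PSU N) P.proj} (he : e ∈ P.trivs) {x : M}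
    (hx : x ∈ e.baseSet) (σ : ∀ y, P.assocCore.Fiber y) :
    SmoothSectionAt (Mat N) σ x ↔ SmoothFunAt (secCoord e σ) x :=
  P.assocCore.contMDiffAt_iff (i := ⟨e, he⟩) hx σ

noncomputable instance (x : M) : Ring (P.assocCore.Fiber x) := inferInstanceAs (Ring (Mat N))
noncomputable instance (x : M) : Algebra ℂ (P.assocCore.Fiber x) :=
  inferInstanceAs (Algebra ℂ (Mat N))
instance (x : M) : StarRing (P.assocCore.Fiber x) := inferInstanceAs (StarRing (Mat N))
instance (x : M) : StarModule ℂ (P.assocCore.Fiber x) := inferInstanceAs (StarModule ℂ (Mat N))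

/-- The endomorphism bundle `P ×_{PSU(N)} M_N(ℂ)`. -/
noncomputable def assocBundle : EndBundle.{_, 0} M N where
  Fiber := P.assocCore.Fiber
  topAddGroup x := inferInstanceAs (IsTopologicalAddGroup (Mat N))
  contSMul x := inferInstanceAs (ContinuousSMul ℝ (Mat N))
  topTotal := P.assocCore.toTopologicalSpace
  fiberBundle := P.assocCore.fiberBundle
  vectorBundle := P.assocCore.vectorBundle
  smoothBundle := inferInstanceAs (ContMDiffVectorBundle ∞ (Mat N) P.assocCore.Fiber 𝓘(ℝ, E4))
  smul_smooth c s hs := by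
    intro x _
    have h := (P.assocCore_contMDiffAt_iff (P.trivAt x).2 (P.mem_trivAt x) s).1
      (SmoothSectionOn.contMDiffAt isOpen_univ (Set.mem_univ x) hs)
    refine ((P.assocCore_contMDiffAt_iff (P.trivAt x).2 (P.mem_trivAt x) _).2 ?_).contMDiffWithinAt
    refine (h.linearMap_comp
      ((LinearMap.lsmul ℂ (Mat N) c).restrictScalars ℝ)).congr_of_eventuallyEq
      (Eventually.of_forall fun y => ?_)
    exact map_smul (PSU.conj N (transition (P.trivAt y).1 _ y)) c _
  one_smooth := by
    intro x _
    refine ((P.assocCore_contMDiffAt_iff (P.trivAt x).2 (P.mem_trivAt x) _).2 ?_).contMDiffWithinAt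
    refine (smoothFunAt_const (1 : Mat N) x).congr_of_eventuallyEq
      (Eventually.of_forall fun y => ?_)
    exact map_one (PSU.conj N (transition (P.trivAt y).1 _ y))
  mul_smooth s t hs ht := by
    intro x _
    have h := (P.assocCore_contMDiffAt_iff (P.trivAt x).2 (P.mem_trivAt x) s).1
      (SmoothSectionOn.contMDiffAt isOpen_univ (Set.mem_univ x) hs)
    have h' := (P.assocCore_contMDiffAt_iff (P.trivAt x).2 (P.mem_trivAt x) t).1
      (SmoothSectionOn.contMDiffAt isOpen_univ (Set.mem_univ x) ht)
    refine ((P.assocCore_contMDiffAt_iff (P.trivAt x).2 (P.mem_trivAt x) _).2 ?_).contMDiffWithinAt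
    refine (h.bilin h' (LinearMap.mul ℝ (Mat N))).congr_of_eventuallyEq
      (Eventually.of_forall fun y => ?_)
    exact map_mul (PSU.conj N (transition (P.trivAt y).1 _ y)) _ _
  star_smooth s hs := by
    intro x _
    have h := (P.assocCore_contMDiffAt_iff (P.trivAt x).2 (P.mem_trivAt x) s).1
      (SmoothSectionOn.contMDiffAt isOpen_univ (Set.mem_univ x) hs)
    refine ((P.assocCore_contMDiffAt_iff (P.trivAt x).2 (P.mem_trivAt x) _).2 ?_).contMDiffWithinAt
    refine (h.linearMap_comp matStar).congr_of_eventuallyEq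
      (Eventually.of_forall fun y => ?_)
    exact map_star (PSU.conj N (transition (P.trivAt y).1 _ y)) _
  locTriv x := ⟨(P.trivAt x).1.baseSet, (P.trivAt x).1.open_baseSet, P.mem_trivAt x,
    fun y => PSU.conj N (transition (P.trivAt x).1 (P.trivAt y).1 y), fun m y hy => by
      refine ((P.assocCore_contMDiffAt_iff (P.trivAt x).2 hy _).2 ?_).contMDiffWithinAt
      refine (smoothFunAt_const m y).congr_of_eventuallyEq ?_
      filter_upwards [(P.trivAt x).1.open_baseSet.mem_nhds hy] with z hz
      exact P.secCoord_transition (P.trivAt x).2 hz m⟩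

end PrincipalPSUBundle

open PrincipalPSUBundle

namespace GaugeTheory

variable [IsManifold 𝓘(ℝ, E4) ∞ M] (G : GaugeTheory M N)

/-- The induced connection on the associated bundle, computed at `x` in the chosen trivialization
around `x`. -/
noncomputable def covFun (σ : ∀ x, G.P.assocBundle.Fiber x) (x : M) :
    TangentSpace 𝓘(ℝ, E4) x →L[ℝ] G.P.assocBundle.Fiber x :=
  haveI : FiniteDimensional ℝ (TangentSpace 𝓘(ℝ, E4) x) :=
    inferInstanceAs (FiniteDimensional ℝ E4)
  haveI : T2Space (TangentSpace 𝓘(ℝ, E4) x) := inferInstanceAs (T2Space E4)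
  let L : TangentSpace 𝓘(ℝ, E4) x →ₗ[ℝ] Mat N :=
    (mvfderiv 𝓘(ℝ, E4) (secCoord (G.P.trivAt x).1 σ) x).toLinearMap +
      bracketLin.flip (show Mat N from σ x) ∘ₗ (G.form (G.P.trivAt x).1 x).toLinearMap
  LinearMap.toContinuousLinearMap (E := TangentSpace 𝓘(ℝ, E4) x)
    (F' := G.P.assocBundle.Fiber x) L

theorem covFun_apply (σ : ∀ x, G.P.assocBundle.Fiber x) (x : M) (v : TangentSpace 𝓘(ℝ, E4) x) :
    G.covFun σ x v = (mvfderiv 𝓘(ℝ, E4) (secCoord (G.P.trivAt x).1 σ) x v +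
        ⁅G.form (G.P.trivAt x).1 x v, (show Mat N from σ x)⁆ : Mat N) := rfl

variable {G}

/-- Over the domain of `e`, the connection is `d + [ω_e, ·]`. -/
theorem covFun_eq {e : Trivialization (PSU N) G.P.proj} (he : e ∈ G.P.trivs) {x : M}
    (hx : x ∈ e.baseSet) {σ : ∀ x, G.P.assocBundle.Fiber x} (hσ : SmoothSectionAt (Mat N) σ x)
    (v : TangentSpace 𝓘(ℝ, E4) x) :
    PSU.conj N (transition (G.P.trivAt x).1 e x) (G.covFun σ x v) =
      mvfderiv 𝓘(ℝ, E4) (secCoord e σ) x v + ⁅G.form e x v, secCoord e σ x⁆ := by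
  set e₀ := G.P.trivAt x
  have hx₀ : x ∈ e₀.1.baseSet := G.P.mem_trivAt x
  have hf := (G.P.assocCore_contMDiffAt_iff e₀.2 hx₀ σ).1 hσ
  have h0 : secCoord e₀.1 σ x = σ x := secCoord_trivAt σ x
  have hcoord : ∀ y ∈ e₀.1.baseSet ∩ e.baseSet, secCoord e σ y =
      PSU.conj N (transition e₀.1 e y) (secCoord e₀.1 σ y) :=
    fun y hy => secCoord_change e₀.2 he hy σ
  have hopen := e₀.1.open_baseSet.inter e.open_baseSet
  have h1 : mvfderiv 𝓘(ℝ, E4) (secCoord e σ) x v =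
      PSU.conj N (transition e₀.1 e x) (mvfderiv 𝓘(ℝ, E4) (secCoord e₀.1 σ) x v) +
        mvfderiv 𝓘(ℝ, E4) (fun y => PSU.conj N (transition e₀.1 e y) (secCoord e₀.1 σ x)) x v := by
    refine (mvfderiv_congr ?_ v).trans (mvfderiv_linearMap_apply
      (A := fun y => PSU.conjLin (transition e₀.1 e y)) (fun w => ?_) hf v)
    · filter_upwards [hopen.mem_nhds ⟨hx₀, hx⟩] with y hy using hcoord y hy
    · exact (smooth_transition e₀.2 he w).contMDiffAt hopen ⟨hx₀, hx⟩
  have h2 := congrArg (PSU.conj N (transition e₀.1 e x))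
    (G.transform e₀.1 e₀.2 e he x ⟨hx₀, hx⟩ v (secCoord e₀.1 σ x))
  rw [map_add, PSU.conj_conj_inv, PSU.conj_bracket, PSU.conj_bracket, PSU.conj_conj_inv] at h2
  rw [hcoord x ⟨hx₀, hx⟩, h1, covFun_apply, map_add, add_assoc, PSU.conj_bracket, ← h0]
  exact congrArg _ h2

theorem smooth_covFun [T2Space M] {σ : ∀ x, G.P.assocBundle.Fiber x}
    (hσ : SmoothSectionOn (Mat N) σ Set.univ)
    {X : ∀ x : M, TangentSpace 𝓘(ℝ, E4) x} (hX : SmoothVectorField X) (x : M) :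
    SmoothSectionAt (Mat N) (fun y => G.covFun σ y (X y)) x := by
  have hσ' := fun y => SmoothSectionOn.contMDiffAt isOpen_univ (Set.mem_univ y) hσ
  have he := (G.P.trivAt x).2
  have hx := G.P.mem_trivAt x
  have hf := (G.P.assocCore_contMDiffAt_iff he hx σ).1 (hσ' x)
  refine (G.P.assocCore_contMDiffAt_iff he hx _).2 ?_
  have hω : SmoothFunAt (fun y => G.form (G.P.trivAt x).1 y (X y)) x :=
    SmoothFunOn.contMDiffAt (G.P.trivAt x).1.open_baseSet hx ((G.isSuForm _ he).smooth X hX)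
  have h1 := contMDiffAt_mvfderiv_apply hf (SmoothSectionOn.contMDiffAt isOpen_univ
    (Set.mem_univ x) hX)
  refine ContMDiffAt.congr_of_eventuallyEq (h1.add (hω.bilin hf bracketLin)) ?_
  filter_upwards [(G.P.trivAt x).1.open_baseSet.mem_nhds hx] with y hy
  exact covFun_eq he hy (hσ' y) (X y)

end GaugeTheory

end Associated

/-! ### The connection induced by a gauge theory -/

section InducedConnection

open Filter Topology PrincipalPSUBundle

variable {M : Type*} [TopologicalSpace M] [ChartedSpace E4 M]

/-- Differentiability at a point of a function with values in a normed space. -/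
abbrev DiffFunAt {F : Type*} [NormedAddCommGroup F] [NormedSpace ℝ F] (f : M → F) (x : M) :
    Prop :=
  MDifferentiableAt 𝓘(ℝ, E4) 𝓘(ℝ, F) f x

theorem mvfderiv_add_apply {F : Type*} [NormedAddCommGroup F] [NormedSpace ℝ F] {f g : M → F}
    {x : M} (hf : DiffFunAt f x) (hg : DiffFunAt g x) (v : TangentSpace 𝓘(ℝ, E4) x) :
    mvfderiv 𝓘(ℝ, E4) (fun y => f y + g y) x v =
      mvfderiv 𝓘(ℝ, E4) f x v + mvfderiv 𝓘(ℝ, E4) g x v :=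
  congrArg (fun L => L v) (mvfderiv_add hf hg)

theorem mvfderiv_smul_apply {F : Type*} [NormedAddCommGroup F] [NormedSpace ℝ F] {c : M → ℝ}
    {f : M → F} {x : M} (hc : DiffFunAt c x) (hf : DiffFunAt f x)
    (v : TangentSpace 𝓘(ℝ, E4) x) :
    mvfderiv 𝓘(ℝ, E4) (fun y => c y • f y) x v =
      c x • mvfderiv 𝓘(ℝ, E4) f x v + mvfderiv 𝓘(ℝ, E4) c x v • f x :=
  congrArg (fun L => L v) (mvfderiv_smul hc hf)

theorem mvfderiv_linearMap_comp {F F' : Type*} [NormedAddCommGroup F] [NormedSpace ℝ F]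
    [FiniteDimensional ℝ F] [NormedAddCommGroup F'] [NormedSpace ℝ F'] (L : F →ₗ[ℝ] F')
    {f : M → F} {x : M} (hf : DiffFunAt f x) (v : TangentSpace 𝓘(ℝ, E4) x) :
    mvfderiv 𝓘(ℝ, E4) (fun y => L (f y)) x v = L (mvfderiv 𝓘(ℝ, E4) f x v) :=
  mvfderiv_clm_comp (LinearMap.toContinuousLinearMap L) hf v

variable [IsManifold 𝓘(ℝ, E4) ∞ M] {N : ℕ} [NeZero N]

namespace PrincipalPSUBundle

variable {P : PrincipalPSUBundle M N}

theorem tau_assocBundle {e : Trivialization (PSU N) P.proj} (he : e ∈ P.trivs) {y : M}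
    (hy : y ∈ e.baseSet) (a b : ∀ x, P.assocBundle.Fiber x) :
    P.assocBundle.tau y (star (a y) * b y) =
      (star (secCoord e a y) * secCoord e b y).trace / N := by
  let θ : Mat N ≃⋆ₐ[ℂ] P.assocBundle.Fiber y := PSU.conj N (transition e (P.trivAt y).1 y)
  have h : ∀ c : ∀ x, P.assocBundle.Fiber x, c y = θ (secCoord e c y) := by
    intro c
    change _ = PSU.conj N _ (PSU.conj N _ (c y))
    have h1 := PSU.conj_mul_apply (transition e (P.trivAt y).1 y) (transition (P.trivAt y).1 e y)
      (c y)
    rw [← h1, transition_mul he (P.trivAt y).2 (P.mem_trivAt y) hy (P.mem_trivAt y),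
      transition_self (P.mem_trivAt y), map_one]
    rfl
  rw [h a, h b, ← map_star, ← map_mul, EndBundle.tau_apply]

end PrincipalPSUBundle

/-- The normalized Hilbert-Schmidt inner product as a real bilinear map. -/
noncomputable def hsInner {N : ℕ} : Mat N →ₗ[ℝ] Mat N →ₗ[ℝ] ℂ :=
  LinearMap.mk₂ ℝ (fun a b => (star a * b).trace / N)
    (fun a a' b => by rw [star_add, add_mul, Matrix.trace_add, add_div])
    (fun r a b => by
      rw [star_smul, star_trivial, smul_mul_assoc, Matrix.trace_smul, smul_div_assoc])
    (fun a b b' => by rw [mul_add, Matrix.trace_add, add_div])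
    (fun r a b => by rw [mul_smul_comm, Matrix.trace_smul, smul_div_assoc])

theorem hsInner_apply {N : ℕ} (a b : Mat N) : hsInner a b = (star a * b).trace / N := rfl

/-- The Hilbert-Schmidt inner product is invariant under `𝔰𝔲(N)`. -/
theorem hsInner_bracket {N : ℕ} {c : Mat N} (hc : c ∈ suLie N) (a b : Mat N) :
    hsInner ⁅c, a⁆ b + hsInner a ⁅c, b⁆ = 0 := by
  have h1 : (star ⁅c, a⁆ * b).trace + (star a * ⁅c, b⁆).trace = 0 := by
    rw [← Matrix.trace_add, Ring.lie_def, Ring.lie_def, star_sub, star_mul, star_mul, hc.1]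
    have h2 : (star a * -c - -c * star a) * b + star a * (c * b - b * c) =
        c * (star a * b) - (star a * b) * c := by noncomm_ring
    rw [h2, Matrix.trace_sub, Matrix.trace_mul_comm, sub_self]
  rw [hsInner_apply, hsInner_apply, ← add_div, h1, zero_div]

theorem bracketLin_apply {N : ℕ} (a b : Mat N) : bracketLin a b = ⁅a, b⁆ := rfl

theorem matStar_bracket {N : ℕ} {c : Mat N} (hc : c ∈ suLie N) (a : Mat N) :
    ⁅c, matStar a⁆ = star ⁅c, a⁆ := by
  change ⁅c, star a⁆ = _
  rw [Ring.lie_def, Ring.lie_def, star_sub, star_mul, star_mul, hc.1]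
  noncomm_ring

theorem bracketLin_smul {N : ℕ} (c : ℂ) (a b : Mat N) :
    bracketLin a (c • b) = c • bracketLin a b := by
  rw [bracketLin_apply, bracketLin_apply, Ring.lie_def, Ring.lie_def, mul_smul_comm,
    smul_mul_assoc, smul_sub]

namespace GaugeTheory

variable (G : GaugeTheory M N)

variable {G} in
theorem covFun_apply_secCoord (σ : ∀ x, G.P.assocBundle.Fiber x) (x : M)
    (v : TangentSpace 𝓘(ℝ, E4) x) {f : M → Mat N} (hf : secCoord (G.P.trivAt x).1 σ = f) :
    @Eq (Mat N) (G.covFun σ x v)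
      (mvfderiv 𝓘(ℝ, E4) f x v + bracketLin (G.form (G.P.trivAt x).1 x v) (f x)) := by
  subst hf
  have h : secCoord (G.P.trivAt x).1 σ x = (show Mat N from σ x) := secCoord_trivAt _ x
  rw [h]; rfl

/-- The induced connection as a covariant derivative. -/
noncomputable def covDeriv :
    CovariantDerivative 𝓘(ℝ, E4) (Mat N) G.P.assocBundle.Fiber where
  toFun := G.covFun
  isCovariantDerivativeOnUniv :=
    { add := fun {σ σ' x} hσ hσ' _ => by
        ext1 v
        have h1 : DiffFunAt (secCoord (G.P.trivAt x).1 σ) x :=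
          G.P.assocCore.mdifferentiableAt hσ
        have h2 : DiffFunAt (secCoord (G.P.trivAt x).1 σ') x :=
          G.P.assocCore.mdifferentiableAt hσ'
        have h3 : secCoord (G.P.trivAt x).1 (σ + σ') =
            fun y => secCoord (G.P.trivAt x).1 σ y + secCoord (G.P.trivAt x).1 σ' y :=
          funext fun y => map_add (PSU.conj N _) _ _
        refine (covFun_apply_secCoord _ x v h3).trans ?_
        rw [mvfderiv_add_apply h1 h2, map_add, add_add_add_comm]
        exact congrArg₂ (· + ·) (covFun_apply_secCoord σ x v rfl).symm
          (covFun_apply_secCoord σ' x v rfl).symm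
      leibniz := fun {σ g x} hσ hg _ => by
        ext1 v
        have h1 : DiffFunAt (secCoord (G.P.trivAt x).1 σ) x :=
          G.P.assocCore.mdifferentiableAt hσ
        have h3 : secCoord (G.P.trivAt x).1 (g • σ) =
            fun y => g y • secCoord (G.P.trivAt x).1 σ y :=
          funext fun y => (PSU.conj N _).map_real_smul _ _
        refine (covFun_apply_secCoord _ x v h3).trans ?_
        rw [mvfderiv_smul_apply hg h1, map_smul, add_right_comm, ← smul_add]
        exact congrArg₂ (· + ·)
          (congrArg (g x • · : Mat N → Mat N) (covFun_apply_secCoord σ x v rfl).symm)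
          (congrArg (mvfderiv 𝓘(ℝ, E4) g x v • · : Mat N → Mat N) (secCoord_trivAt σ x)) }

variable {G} in
theorem smooth_secCoord (s : G.P.assocBundle.sections) (x : M) :
    SmoothFunAt (secCoord (G.P.trivAt x).1 s.1) x :=
  (G.P.assocCore_contMDiffAt_iff (G.P.trivAt x).2 (G.P.mem_trivAt x) s.1).1
    (SmoothSectionOn.contMDiffAt isOpen_univ (Set.mem_univ x) s.2)

/-- The hermitian `*`-algebra connection `d + [ω, ·]` on the associated bundle. -/
noncomputable def assocConnection [T2Space M] : StarConnection G.P.assocBundle where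
  cov := G.covDeriv
  smooth := ⟨⟨fun {σ} hσ x _ => by
    refine (contMDiffAt_hom_of_apply fun X hX => ?_).contMDiffWithinAt
    exact smooth_covFun (hσ.of_le (by simp)) hX x⟩⟩
  map_smul c s x v := by
    have h3 : secCoord (G.P.trivAt x).1 (c • s : G.P.assocBundle.sections).1 = fun y =>
        (LinearMap.lsmul ℂ (Mat N) c).restrictScalars ℝ (secCoord (G.P.trivAt x).1 s.1 y) :=
      funext fun y => map_smul (PSU.conj N _) _ _
    refine (covFun_apply_secCoord _ x v h3).trans ?_
    rw [mvfderiv_linearMap_comp _ ((smooth_secCoord s x).mdifferentiableAt (by simp))]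
    refine Eq.trans ?_ (congrArg (c • · : Mat N → Mat N) (covFun_apply_secCoord s.1 x v rfl)).symm
    refine Eq.trans (congrArg _ (bracketLin_smul c _ _)) (smul_add c _ _).symm
  leibniz s t x v := by
    have h3 : secCoord (G.P.trivAt x).1 (s * t : G.P.assocBundle.sections).1 = fun y =>
        LinearMap.mul ℝ (Mat N) (secCoord (G.P.trivAt x).1 s.1 y)
          (secCoord (G.P.trivAt x).1 t.1 y) :=
      funext fun y => map_mul (PSU.conj N _) _ _
    refine (covFun_apply_secCoord _ x v h3).trans ?_
    rw [mvfderiv_bilin (smooth_secCoord s x) (smooth_secCoord t x)]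
    refine Eq.trans ?_ (congrArg₂ (· + · : Mat N → Mat N → Mat N)
      (congrArg₂ (· * · : Mat N → Mat N → Mat N) (secCoord_trivAt (P := G.P) s.1 x)
        (covFun_apply_secCoord t.1 x v rfl).symm)
      (congrArg₂ (· * · : Mat N → Mat N → Mat N) (covFun_apply_secCoord s.1 x v rfl).symm
        (secCoord_trivAt (P := G.P) t.1 x)))
    simp only [LinearMap.mul_apply', bracketLin_apply, Ring.lie_def]
    noncomm_ring
  map_star s x v := by
    have h3 : secCoord (G.P.trivAt x).1 (star s : G.P.assocBundle.sections).1 = fun y =>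
        matStar (secCoord (G.P.trivAt x).1 s.1 y) :=
      funext fun y => map_star (PSU.conj N _) _
    refine (covFun_apply_secCoord _ x v h3).trans ?_
    rw [mvfderiv_linearMap_comp _ ((smooth_secCoord s x).mdifferentiableAt (by simp))]
    refine Eq.trans ?_ (congrArg (star : Mat N → Mat N) (covFun_apply_secCoord s.1 x v rfl)).symm
    rw [star_add, bracketLin_apply, bracketLin_apply, matStar_bracket
      ((G.isSuForm _ (G.P.trivAt x).2).mem x (G.P.mem_trivAt x) v)]
    rfl
  hermitian s t x v := by
    have h1 := mvfderiv_congr (f := fun y => G.P.assocBundle.tau y (star (s.1 y) * t.1 y))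
      (g := fun y => hsInner (secCoord (G.P.trivAt x).1 s.1 y) (secCoord (G.P.trivAt x).1 t.1 y))
      (by filter_upwards [(G.P.trivAt x).1.open_baseSet.mem_nhds (G.P.mem_trivAt x)] with y hy
          exact tau_assocBundle (G.P.trivAt x).2 hy s.1 t.1) v
    rw [h1, mvfderiv_bilin (smooth_secCoord s x) (smooth_secCoord t x)]
    have hτ : ∀ a b : G.P.assocBundle.Fiber x, G.P.assocBundle.tau x (star a * b) =
        hsInner (N := N) a b := fun a b =>
      EndBundle.tau_apply G.P.assocBundle (StarAlgEquiv.refl (R := ℂ) (A := Mat N)) (star a * b)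
    refine Eq.trans ?_ (congrArg₂ (· + ·)
      ((hτ (G.covFun s.1 x v) (t.1 x)).trans (congrArg₂ (fun a b : Mat N => hsInner a b)
        (covFun_apply_secCoord s.1 x v rfl) (secCoord_trivAt (P := G.P) t.1 x).symm))
      ((hτ (s.1 x) (G.covFun t.1 x v)).trans (congrArg₂ (fun a b : Mat N => hsInner a b)
        (secCoord_trivAt (P := G.P) s.1 x).symm (covFun_apply_secCoord t.1 x v rfl)))).symm
    have h2 := hsInner_bracket ((G.isSuForm _ (G.P.trivAt x).2).mem x (G.P.mem_trivAt x) v)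
      (secCoord (G.P.trivAt x).1 s.1 x) (secCoord (G.P.trivAt x).1 t.1 x)
    simp only [map_add, LinearMap.add_apply, bracketLin_apply]
    linear_combination -h2

variable {G} in
/-- `P ×_{PSU(N)} M_N(ℂ)` is the bundle associated to `P`. -/
noncomputable def assocIso : AssocIso G.P G.P.assocBundle where
  toEquiv x :=
    { toFun := Quotient.lift (fun a => PSU.conj N ((G.P.trivAt x).1 a.1.1).2 a.2) <| by
        rintro ⟨⟨p, hp⟩, m⟩ ⟨⟨q, hq⟩, m'⟩ ⟨g, hg, hm⟩
        change m = PSU.conj N g m' at hm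
        change q = G.P.act p g at hg
        subst hg hm
        change PSU.conj N _ (PSU.conj N g m') = PSU.conj N ((G.P.trivAt x).1 (G.P.act p g)).2 m'
        rw [G.P.equivariant _ (G.P.trivAt x).2 p (by rw [hp]; exact G.P.mem_trivAt x),
          PSU.conj_mul_apply]
      invFun := fun b => assocMk
        (fiberMk (localSection (G.P.trivAt x).1 x) (proj_localSection (G.P.mem_trivAt x))) b
      left_inv := by
        rintro ⟨⟨p, rfl⟩, m⟩
        exact (assocMk_act _ _ _
          (eq_act_localSection (G.P.trivAt _).2 (G.P.mem_trivAt _)) m).symm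
      right_inv := fun b => by
        change PSU.conj N ((G.P.trivAt x).1 (localSection (G.P.trivAt x).1 x)).2 b = b
        rw [apply_localSection (G.P.mem_trivAt x), map_one]; rfl }
  isStarAlg x p := ⟨PSU.conj N ((G.P.trivAt x).1 p.1).2, fun _ => rfl⟩
  smooth e he f hf σ hσ := by
    intro x hx
    refine ((G.P.assocCore_contMDiffAt_iff he hx σ).2 ?_).contMDiffWithinAt
    refine (hf.contMDiffAt e.open_baseSet hx).congr_of_eventuallyEq ?_
    filter_upwards [e.open_baseSet.mem_nhds hx] with y hy
    refine (congrArg (PSU.conj N (transition (G.P.trivAt y).1 e y))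
      (hσ y hy (fiberMk (localSection e y) (proj_localSection hy)) rfl)).trans ?_
    exact G.P.secCoord_transition he hy (f y)

theorem induces_assocConnection [T2Space M] : Induces G assocIso G.assocConnection := by
  intro e he f hf σ hσ x hx p hp v
  have hsec : ∀ y ∈ e.baseSet, secCoord e σ y = f y := fun y hy =>
    (congrArg (PSU.conj N (transition (G.P.trivAt y).1 e y))
      (hσ y hy (fiberMk (localSection e y) (proj_localSection hy)) rfl)).trans
        (G.P.secCoord_transition he hy (f y))
  have hsm := SmoothSectionOn.contMDiffAt e.open_baseSet hx
    (AssocIso.smooth assocIso e he f hf σ hσ)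
  have h1 := covFun_eq he hx hsm v
  have h2 : mvfderiv 𝓘(ℝ, E4) (secCoord e σ) x v = mvfderiv 𝓘(ℝ, E4) f x v :=
    mvfderiv_congr (by filter_upwards [e.open_baseSet.mem_nhds hx] with y hy using hsec y hy) v
  rw [h2, hsec x hx] at h1
  refine (PSU.conj N (transition (G.P.trivAt x).1 e x)).injective ?_
  refine h1.trans ?_
  obtain ⟨p, hp'⟩ := p
  change p = localSection e x at hp
  subst hp
  exact (G.P.secCoord_transition he hx _).symm

end GaugeTheory

end InducedConnection

/-! ### The Riemannian volume measure -/

section RiemannianVolume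

open Filter Topology

variable {M : Type*} [TopologicalSpace M] [ChartedSpace E4 M] [IsManifold 𝓘(ℝ, E4) ∞ M]

/-- The coordinate vector fields of the chart at `c`. -/
noncomputable def coordField (c : M) (i : Fin 4) (x : M) : TangentSpace 𝓘(ℝ, E4) x :=
  (trivializationAt E4 (TangentSpace 𝓘(ℝ, E4) : M → Type _) c).symmL ℝ x
    (EuclideanSpace.single i (1 : ℝ))

theorem smooth_coordField (c : M) (i : Fin 4) :
    SmoothSectionOn E4 (coordField c i) (chartAt E4 c).source := by
  intro y hy
  let eT := trivializationAt E4 (TangentSpace 𝓘(ℝ, E4) : M → Type _) c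
  have hb : eT.baseSet = (chartAt E4 c).source := TangentBundle.trivializationAt_baseSet c
  refine ContMDiffAt.contMDiffWithinAt
    ((eT.contMDiffAt_section_iff (s := coordField c i) (hb ▸ hy)).2 ?_)
  refine (contMDiffAt_const (c := (EuclideanSpace.single i (1 : ℝ) : E4))).congr_of_eventuallyEq ?_
  filter_upwards [(chartAt E4 c).open_source.mem_nhds hy] with z hz
  rw [← hb] at hz
  rw [coordField, eT.symmL_apply hz, eT.apply_mk_symm hz]

theorem linearIndependent_coordField (c : M) {x : M} (hx : x ∈ (chartAt E4 c).source) :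
    LinearIndependent ℝ (fun i => coordField c i x) := by
  let eT := trivializationAt E4 (TangentSpace 𝓘(ℝ, E4) : M → Type _) c
  have hb : eT.baseSet = (chartAt E4 c).source := TangentBundle.trivializationAt_baseSet c
  rw [← hb] at hx
  have h := ((EuclideanSpace.basisFun (Fin 4) ℝ).toBasis.linearIndependent).map'
    (eT.continuousLinearEquivAt ℝ x hx).symm.toLinearEquiv.toLinearMap
    (LinearEquiv.ker _)
  have h2 : (fun i => coordField c i x) = (eT.continuousLinearEquivAt ℝ x hx).symm ∘
      (EuclideanSpace.basisFun (Fin 4) ℝ).toBasis := by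
    funext i
    rw [Function.comp_apply, OrthonormalBasis.coe_toBasis, EuclideanSpace.basisFun_apply]
    exact (congrFun (eT.symm_continuousLinearEquivAt_eq (R := ℝ) hx)
      (EuclideanSpace.single i (1 : ℝ))).symm
  rw [h2]
  exact h

variable [RiemannianBundle (fun x : M => TangentSpace 𝓘(ℝ, E4) x)]

/-- The Riemannian density is the square root of the Gram determinant of the coordinate fields. -/
theorem chartDensity_eq (c : M) {y : E4} (hy : y ∈ (extChartAt 𝓘(ℝ, E4) c).target) :
    chartDensity c y = √(Matrix.gram ℝ
      (fun i => coordField c i ((extChartAt 𝓘(ℝ, E4) c).symm y))).det := by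
  have hx : (extChartAt 𝓘(ℝ, E4) c).symm y ∈ (chartAt E4 c).source := by
    have := (extChartAt 𝓘(ℝ, E4) c).map_target hy
    rwa [extChartAt_source] at this
  have key : ∀ i, (mfderiv 𝓘(ℝ, E4) 𝓘(ℝ, E4) (extChartAt 𝓘(ℝ, E4) c).symm y
      (EuclideanSpace.single i (1 : ℝ) : E4)) =
        coordField c i ((extChartAt 𝓘(ℝ, E4) c).symm y) := by
    intro i
    have h := TangentBundle.symmL_trivializationAt (I := 𝓘(ℝ, E4)) (x₀ := c) hx
    have h0 : ∀ z : E4, z = y → ∀ w : E4,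
        @Eq E4 (mfderivWithin 𝓘(ℝ, E4) 𝓘(ℝ, E4) (extChartAt 𝓘(ℝ, E4) c).symm
          (Set.range 𝓘(ℝ, E4)) z w)
          (mfderiv 𝓘(ℝ, E4) 𝓘(ℝ, E4) (extChartAt 𝓘(ℝ, E4) c).symm y w) := by
      rintro z rfl w
      rw [modelWithCornersSelf_coe, Set.range_id, mfderivWithin_univ]
    refine (h0 _ ((extChartAt 𝓘(ℝ, E4) c).right_inv hy) _).symm.trans ?_
    exact (congrArg (fun L => L (EuclideanSpace.single i (1 : ℝ))) h).symm
  rw [chartDensity]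
  simp only [key]
  rfl

theorem chartDensity_pos (c : M) {y : E4} (hy : y ∈ (extChartAt 𝓘(ℝ, E4) c).target) :
    0 < chartDensity c y := by
  rw [chartDensity_eq c hy]
  have := (extChartAt 𝓘(ℝ, E4) c).map_target hy
  rw [extChartAt_source] at this
  exact Real.sqrt_pos.2 (Matrix.posDef_gram_of_linearIndependent
    (linearIndependent_coordField c this)).det_pos

theorem aemeasurable_chart_symm {M : Type*} [TopologicalSpace M] [ChartedSpace E4 M]
    [RiemannianBundle (fun x : M => TangentSpace 𝓘(ℝ, E4) x)] [MeasurableSpace M] [BorelSpace M]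
    (c : M) : AEMeasurable (extChartAt 𝓘(ℝ, E4) c).symm
    ((volume.restrict (extChartAt 𝓘(ℝ, E4) c).target).withDensity
      fun y => ENNReal.ofReal (chartDensity c y)) :=
  ((continuousOn_extChartAt_symm c).aemeasurable
    (isOpen_extChartAt_target c).measurableSet).mono_ac (withDensity_absolutelyContinuous _ _)

variable [IsContMDiffRiemannianBundle 𝓘(ℝ, E4) ∞ E4 (fun x : M => TangentSpace 𝓘(ℝ, E4) x)]

theorem continuousOn_chartDensity (c : M) :
    ContinuousOn (chartDensity c) (extChartAt 𝓘(ℝ, E4) c).target := by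
  have h1 : ∀ i j, ContinuousOn (fun x => (inner ℝ (coordField c i x) (coordField c j x) : ℝ))
      (chartAt E4 c).source := fun i j =>
    (ContMDiffOn.inner_bundle (smooth_coordField c i) (smooth_coordField c j)).continuousOn
  have h2 : ContinuousOn (fun y => √(Matrix.gram ℝ
      (fun i => coordField c i ((extChartAt 𝓘(ℝ, E4) c).symm y))).det)
      (extChartAt 𝓘(ℝ, E4) c).target := by
    refine Real.continuous_sqrt.comp_continuousOn ?_
    refine (continuous_id.matrix_det).comp_continuousOn ?_
    refine continuousOn_pi.2 fun i => continuousOn_pi.2 fun j => ?_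
    refine (h1 i j).comp (continuousOn_extChartAt_symm c) fun y hy => ?_
    have := (extChartAt 𝓘(ℝ, E4) c).map_target hy
    rwa [extChartAt_source] at this
  exact h2.congr fun y hy => chartDensity_eq c hy

variable [MeasurableSpace M]

theorem lintegral_chartVolume_lt_top [CompactSpace M] (c : M) {f : M → ℝ} (hf : Continuous f)
    (hs : tsupport f ⊆ (chartAt E4 c).source) :
    ∫⁻ x, ENNReal.ofReal (f x) ∂(chartVolume c) < ⊤ := by
  set φ := extChartAt 𝓘(ℝ, E4) c
  have hsrc : tsupport f ⊆ φ.source := by rwa [extChartAt_source]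
  have hcs : IsCompact (tsupport f) := (isClosed_tsupport f).isCompact
  have hK : IsCompact (φ '' tsupport f) :=
    hcs.image_of_continuousOn ((continuousOn_extChartAt c).mono hsrc)
  have hKt : φ '' tsupport f ⊆ φ.target := by
    rintro _ ⟨x, hx, rfl⟩
    exact φ.map_source (hsrc hx)
  obtain ⟨C, hC⟩ := hcs.exists_bound_of_continuousOn hf.continuousOn
  obtain ⟨D, hD⟩ := hK.exists_bound_of_continuousOn ((continuousOn_chartDensity c).mono hKt)
  refine (lintegral_map_le _ _).trans_lt ?_
  have hle : ∀ᵐ y ∂((volume.restrict φ.target).withDensity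
      fun y => ENNReal.ofReal (chartDensity c y)), ENNReal.ofReal (f (φ.symm y)) ≤
        (φ '' tsupport f).indicator (fun _ => ENNReal.ofReal C) y := by
    refine (withDensity_absolutelyContinuous _ _).ae_le ?_
    filter_upwards [ae_restrict_mem (isOpen_extChartAt_target c).measurableSet] with y hy
    by_cases h : φ.symm y ∈ tsupport f
    · have hm : y ∈ φ '' tsupport f := ⟨_, h, φ.right_inv hy⟩
      rw [Set.indicator_of_mem hm]
      exact ENNReal.ofReal_le_ofReal ((le_abs_self _).trans (hC _ h))
    · rw [image_eq_zero_of_notMem_tsupport h, ENNReal.ofReal_zero]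
      exact zero_le
  refine (lintegral_mono_ae hle).trans_lt ?_
  rw [lintegral_indicator hK.measurableSet, setLIntegral_const,
    withDensity_apply _ hK.measurableSet]
  refine ENNReal.mul_lt_top ENNReal.ofReal_lt_top ?_
  calc ∫⁻ y in φ '' tsupport f, ENNReal.ofReal (chartDensity c y) ∂volume.restrict φ.target
      ≤ ∫⁻ _ in φ '' tsupport f, ENNReal.ofReal D ∂volume.restrict φ.target := by
        refine setLIntegral_mono measurable_const fun y hy => ?_
        exact ENNReal.ofReal_le_ofReal ((le_abs_self _).trans (hD y hy))
    _ < ⊤ := by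
        rw [setLIntegral_const]
        exact ENNReal.mul_lt_top ENNReal.ofReal_lt_top
          ((Measure.restrict_apply_le _ _).trans_lt hK.measure_lt_top)

variable [BorelSpace M]

theorem chartVolume_pos (c : M) {V : Set M} (hV : IsOpen V) (hne : V.Nonempty)
    (hs : V ⊆ (chartAt E4 c).source) : chartVolume c V ≠ 0 := by
  set φ := extChartAt 𝓘(ℝ, E4) c with hφ
  intro h
  rw [chartVolume, Measure.map_apply_of_aemeasurable (aemeasurable_chart_symm c) hV.measurableSet,
    withDensity_apply_eq_zero' (((continuousOn_chartDensity c).aemeasurable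
      (isOpen_extChartAt_target c).measurableSet).ennreal_ofReal)] at h
  have hW : IsOpen (φ.target ∩ φ.symm ⁻¹' V) :=
    (continuousOn_extChartAt_symm c).isOpen_inter_preimage (isOpen_extChartAt_target c) hV
  have hWne : (φ.target ∩ φ.symm ⁻¹' V).Nonempty := by
    obtain ⟨x, hx⟩ := hne
    have hxs : x ∈ φ.source := by rw [hφ, extChartAt_source]; exact hs hx
    exact ⟨φ x, φ.map_source hxs, by rw [Set.mem_preimage, φ.left_inv hxs]; exact hx⟩
  refine (hW.measure_pos volume hWne).ne' ?_
  rw [Measure.restrict_apply₀' (isOpen_extChartAt_target c).measurableSet.nullMeasurableSet] at h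
  refine measure_mono_null (fun y hy => ?_) h
  refine ⟨⟨?_, hy.2⟩, hy.1⟩
  rw [Set.mem_ofPred_eq, ne_eq, ENNReal.ofReal_eq_zero, not_le]
  exact chartDensity_pos c hy.1

variable [T2Space M] [CompactSpace M]

instance isFiniteMeasure_riemannianVolume : IsFiniteMeasure (riemannianVolume M) := by
  let ρ := (SmoothPartitionOfUnity.exists_isSubordinate_chartAt_source 𝓘(ℝ, E4) M).choose
  have hρ : ρ.IsSubordinate fun x => (chartAt E4 x).source :=
    (SmoothPartitionOfUnity.exists_isSubordinate_chartAt_source 𝓘(ℝ, E4) M).choose_spec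
  refine ⟨?_⟩
  rw [riemannianVolume, Measure.sum_apply _ MeasurableSet.univ]
  have hfin : {c | (Function.support (ρ c)).Nonempty}.Finite :=
    ρ.locallyFinite.finite_nonempty_of_compact
  rw [tsum_eq_sum (s := hfin.toFinset) fun c hc => ?_]
  · refine ENNReal.sum_lt_top.2 fun c _ => ?_
    rw [withDensity_apply _ MeasurableSet.univ, setLIntegral_univ]
    exact lintegral_chartVolume_lt_top c (ρ c).contMDiff.continuous (hρ c)
  · have h0 : ∀ x, ρ c x = 0 := fun x => by
      by_contra hx
      exact hc (hfin.mem_toFinset.2 ⟨x, hx⟩)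
    change (chartVolume c).withDensity (fun x => ENNReal.ofReal (ρ c x)) Set.univ = 0
    simp [h0]

instance isOpenPosMeasure_riemannianVolume : (riemannianVolume M).IsOpenPosMeasure := by
  let ρ := (SmoothPartitionOfUnity.exists_isSubordinate_chartAt_source 𝓘(ℝ, E4) M).choose
  have hρ : ρ.IsSubordinate fun x => (chartAt E4 x).source :=
    (SmoothPartitionOfUnity.exists_isSubordinate_chartAt_source 𝓘(ℝ, E4) M).choose_spec
  refine ⟨fun U hU ⟨x, hx⟩ h => ?_⟩
  obtain ⟨c, hc⟩ := ρ.exists_pos_of_mem (Set.mem_univ x)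
  rw [riemannianVolume, Measure.sum_apply _ hU.measurableSet, ENNReal.tsum_eq_zero] at h
  have h1 : (chartVolume c).withDensity (fun x => ENNReal.ofReal (ρ c x)) U = 0 := h c
  have hcont : Continuous (ρ c) := (ρ c).contMDiff.continuous
  rw [withDensity_apply_eq_zero' hcont.measurable.ennreal_ofReal.aemeasurable] at h1
  refine chartVolume_pos c ((isOpen_lt continuous_const hcont).inter hU) ⟨x, hc, hx⟩ ?_
    (measure_mono_null (Set.inter_subset_inter_left U ?_) h1)
  · intro y hy
    exact hρ c (subset_tsupport _ (ne_of_gt hy.1))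
  · intro y hy
    rw [Set.mem_ofPred_eq, ne_eq, ENNReal.ofReal_eq_zero, not_le]
    exact hy

end RiemannianVolume

/-! ### The inner product of `M_N(ℂ) ⊗ W` -/

section TensorCoord

variable {N : ℕ} {A W : Type*} [Ring A] [Algebra ℂ A] [Star A] [NormedAddCommGroup W]
  [InnerProductSpace ℂ W]

/-- The components `c_ij` of a tensor `∑ θ(e_ij) ⊗ c_ij ∈ A ⊗ W`, where `θ : M_N(ℂ) ≅ A`. -/
noncomputable def tensorCoord (θ : Mat N ≃⋆ₐ[ℂ] A) (i j : Fin N) : A ⊗[ℂ] W →ₗ[ℂ] W :=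
  TensorProduct.lift ((LinearMap.lsmul ℂ W) ∘ₗ Matrix.entryLinearMap ℂ ℂ i j ∘ₗ
    θ.symm.toAlgEquiv.toLinearMap)

@[simp]
theorem tensorCoord_tmul (θ : Mat N ≃⋆ₐ[ℂ] A) (i j : Fin N) (a : A) (w : W) :
    tensorCoord θ i j (a ⊗ₜ w) = θ.symm a i j • w := rfl

theorem StarAlgEquiv.sum_smul_single (θ : Mat N ≃⋆ₐ[ℂ] A) (a : A) :
    ∑ i, ∑ j, θ.symm a i j • θ (Matrix.single i j 1) = a := by
  have h : ∀ i j, θ.symm a i j • θ (Matrix.single i j 1) =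
      θ (Matrix.single i j (θ.symm a i j)) := fun i j => by
    rw [← map_smul, Matrix.smul_single, smul_eq_mul, mul_one]
  simp only [h, ← map_sum]
  rw [← Matrix.matrix_eq_sum_single, StarAlgEquiv.apply_symm_apply]

theorem sum_tensorCoord (θ : Mat N ≃⋆ₐ[ℂ] A) (ξ : A ⊗[ℂ] W) :
    ∑ i, ∑ j, θ (Matrix.single i j 1) ⊗ₜ[ℂ] tensorCoord θ i j ξ = ξ := by
  induction ξ using TensorProduct.induction_on with
  | zero => simp
  | tmul a w =>
    simp only [tensorCoord_tmul, TensorProduct.tmul_smul, TensorProduct.smul_tmul']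
    simp only [← TensorProduct.sum_tmul]
    rw [θ.sum_smul_single]
  | add ξ η hξ hη =>
    simp only [map_add, TensorProduct.tmul_add, Finset.sum_add_distrib, hξ, hη]

/-- The inner product on `A ⊗ W` for which `⟨a ⊗ w, b ⊗ z⟩ = τ(a* b) ⟨w, z⟩`, `τ` being the
normalized trace of `A ≅ M_N(ℂ)`. -/
noncomputable def tensorInner (θ : Mat N ≃⋆ₐ[ℂ] A) (ξ η : A ⊗[ℂ] W) : ℂ :=
  (N : ℂ)⁻¹ * ∑ i, ∑ j, inner ℂ (tensorCoord θ i j ξ) (tensorCoord θ i j η)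

theorem tensorInner_add_left (θ : Mat N ≃⋆ₐ[ℂ] A) (ξ ξ' η : A ⊗[ℂ] W) :
    tensorInner θ (ξ + ξ') η = tensorInner θ ξ η + tensorInner θ ξ' η := by
  simp only [tensorInner, map_add, inner_add_left, Finset.sum_add_distrib, mul_add]

theorem tensorInner_smul_left (θ : Mat N ≃⋆ₐ[ℂ] A) (c : ℂ) (ξ η : A ⊗[ℂ] W) :
    tensorInner θ (c • ξ) η = star c * tensorInner θ ξ η := by
  simp only [tensorInner, map_smul, inner_smul_left, ← Finset.mul_sum]
  rw [mul_left_comm]; rfl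

theorem star_tensorInner (θ : Mat N ≃⋆ₐ[ℂ] A) (ξ η : A ⊗[ℂ] W) :
    star (tensorInner θ η ξ) = tensorInner θ ξ η := by
  simp only [tensorInner, star_mul', star_sum]
  congr 1
  · simp
  · refine Finset.sum_congr rfl fun i _ => Finset.sum_congr rfl fun j _ => ?_
    exact inner_conj_symm _ _

theorem tensorInner_self (θ : Mat N ≃⋆ₐ[ℂ] A) (ξ : A ⊗[ℂ] W) :
    tensorInner θ ξ ξ = (((N : ℝ)⁻¹ * ∑ i, ∑ j, ‖tensorCoord θ i j ξ‖ ^ 2 : ℝ) : ℂ) := by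
  simp only [tensorInner, inner_self_eq_norm_sq_to_K]
  push_cast
  rfl

theorem tensorInner_tmul (θ : Mat N ≃⋆ₐ[ℂ] A) (a b : A) (w z : W) :
    tensorInner θ (a ⊗ₜ w) (b ⊗ₜ z) =
      (star (θ.symm a) * θ.symm b).trace / N * inner ℂ w z := by
  simp only [tensorInner, tensorCoord_tmul, inner_smul_left, inner_smul_right]
  have h : (star (θ.symm a) * θ.symm b).trace =
      ∑ i, ∑ j, starRingEnd ℂ (θ.symm a i j) * θ.symm b i j := by
    simp only [Matrix.trace, Matrix.diag_apply, Matrix.mul_apply, Matrix.star_apply]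
    rw [Finset.sum_comm]; rfl
  rw [h, div_eq_inv_mul, mul_assoc, Finset.sum_mul]
  congr 1
  refine Finset.sum_congr rfl fun i _ => ?_
  rw [Finset.sum_mul]
  exact Finset.sum_congr rfl fun j _ => by ring

theorem tensorInner_self_nonneg (θ : Mat N ≃⋆ₐ[ℂ] A) (ξ : A ⊗[ℂ] W) :
    0 ≤ (tensorInner θ ξ ξ).re := by
  rw [tensorInner_self, Complex.ofReal_re]
  positivity

theorem eq_zero_of_tensorInner_self [NeZero N] (θ : Mat N ≃⋆ₐ[ℂ] A) {ξ : A ⊗[ℂ] W}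
    (h : (tensorInner θ ξ ξ).re = 0) : ξ = 0 := by
  rw [tensorInner_self, Complex.ofReal_re] at h
  have hN : (N : ℝ)⁻¹ ≠ 0 := inv_ne_zero (Nat.cast_ne_zero.2 (NeZero.ne N))
  have h1 := (mul_eq_zero.1 h).resolve_left hN
  have h2 : ∀ i j, tensorCoord θ i j ξ = 0 := by
    intro i j
    have h3 := (Finset.sum_eq_zero_iff_of_nonneg fun i _ => by positivity).1 h1 i (by simp)
    have h4 := (Finset.sum_eq_zero_iff_of_nonneg fun j _ => by positivity).1 h3 j (by simp)
    simpa using h4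
  rw [← sum_tensorCoord θ ξ]
  simp [h2]

/-- Left multiplication by `a` on `A ⊗ W` is bounded by the Hilbert-Schmidt norm of `a`. -/
theorem tensorInner_mulLeft_le (θ : Mat N ≃⋆ₐ[ℂ] A) (a : A) (ξ : A ⊗[ℂ] W) :
    (tensorInner θ ((LinearMap.mulLeft ℂ a).rTensor W ξ)
      ((LinearMap.mulLeft ℂ a).rTensor W ξ)).re ≤
      (star (θ.symm a) * θ.symm a).trace.re * (tensorInner θ ξ ξ).re := by
  have h1 : ∀ i j, tensorCoord θ i j ((LinearMap.mulLeft ℂ a).rTensor W ξ) =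
      ∑ k, θ.symm a i k • tensorCoord θ k j ξ := by
    intro i j
    induction ξ using TensorProduct.induction_on with
    | zero => simp
    | tmul b w =>
      simp only [LinearMap.rTensor_tmul, LinearMap.mulLeft_apply, tensorCoord_tmul, map_mul,
        Matrix.mul_apply, smul_smul, Finset.sum_smul]
    | add ξ η hξ hη => simp only [map_add, hξ, hη, smul_add, Finset.sum_add_distrib]
  have h2 : (star (θ.symm a) * θ.symm a).trace.re = ∑ i, ∑ k, ‖θ.symm a i k‖ ^ 2 := by
    simp only [Matrix.trace, Matrix.diag_apply, Matrix.mul_apply, Matrix.star_apply,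
      Complex.re_sum]
    rw [Finset.sum_comm]
    refine Finset.sum_congr rfl fun i _ => Finset.sum_congr rfl fun k _ => ?_
    have := Complex.conj_mul' (θ.symm a i k)
    change (starRingEnd ℂ (θ.symm a i k) * θ.symm a i k).re = _
    rw [this]; norm_cast
  rw [tensorInner_self, tensorInner_self, Complex.ofReal_re, Complex.ofReal_re, h2,
    mul_left_comm]
  refine mul_le_mul_of_nonneg_left ?_ (by positivity)
  simp only [h1]
  have h3 : ∀ i j, ‖∑ k, θ.symm a i k • tensorCoord θ k j ξ‖ ^ 2 ≤
      (∑ k, ‖θ.symm a i k‖ ^ 2) * ∑ k, ‖tensorCoord θ k j ξ‖ ^ 2 := by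
    intro i j
    refine le_trans ?_ (Finset.sum_mul_sq_le_sq_mul_sq _ _ _)
    refine pow_le_pow_left₀ (norm_nonneg _) ?_ 2
    exact (norm_sum_le _ _).trans_eq (Finset.sum_congr rfl fun k _ => norm_smul _ _)
  calc ∑ i, ∑ j, ‖∑ k, θ.symm a i k • tensorCoord θ k j ξ‖ ^ 2
      ≤ ∑ i, ∑ j, (∑ k, ‖θ.symm a i k‖ ^ 2) * ∑ k, ‖tensorCoord θ k j ξ‖ ^ 2 :=
        Finset.sum_le_sum fun i _ => Finset.sum_le_sum fun j _ => h3 i j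
    _ = _ := by
        simp only [← Finset.mul_sum, ← Finset.sum_mul]
        rw [Finset.sum_comm (f := fun k j => ‖tensorCoord θ k j ξ‖ ^ 2)]

end TensorCoord

/-! ### The Hilbert space `L²(M, B ⊗ S)` -/

section HilbertSpace

open Filter Topology

theorem tensorInner_add_right {N : ℕ} {A W : Type*} [Ring A] [Algebra ℂ A] [Star A]
    [NormedAddCommGroup W] [InnerProductSpace ℂ W] (θ : Mat N ≃⋆ₐ[ℂ] A) (ξ η η' : A ⊗[ℂ] W) :
    tensorInner θ ξ (η + η') = tensorInner θ ξ η + tensorInner θ ξ η' := by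
  simp only [tensorInner, map_add, inner_add_right, Finset.sum_add_distrib, mul_add]

theorem tensorInner_smul_right {N : ℕ} {A W : Type*} [Ring A] [Algebra ℂ A] [Star A]
    [NormedAddCommGroup W] [InnerProductSpace ℂ W] (θ : Mat N ≃⋆ₐ[ℂ] A) (c : ℂ) (ξ η : A ⊗[ℂ] W) :
    tensorInner θ ξ (c • η) = c * tensorInner θ ξ η := by
  simp only [tensorInner, map_smul, inner_smul_right, ← Finset.mul_sum]
  rw [mul_left_comm]

theorem tensorInner_zero_right {N : ℕ} {A W : Type*} [Ring A] [Algebra ℂ A] [Star A]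
    [NormedAddCommGroup W] [InnerProductSpace ℂ W] (θ : Mat N ≃⋆ₐ[ℂ] A) (ξ : A ⊗[ℂ] W) :
    tensorInner θ ξ 0 = 0 := by
  simp [tensorInner]

theorem tensorInner_zero_left {N : ℕ} {A W : Type*} [Ring A] [Algebra ℂ A] [Star A]
    [NormedAddCommGroup W] [InnerProductSpace ℂ W] (θ : Mat N ≃⋆ₐ[ℂ] A) (ξ : A ⊗[ℂ] W) :
    tensorInner θ 0 ξ = 0 := by
  simp [tensorInner]

variable {M : Type*} [TopologicalSpace M] [ChartedSpace E4 M] [IsManifold 𝓘(ℝ, E4) ∞ M] {N : ℕ}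

theorem EndBundle.tau_star_mul [NeZero N] (B : EndBundle M N) {x : M}
    (θ : Mat N ≃⋆ₐ[ℂ] B.Fiber x) (a b : B.Fiber x) :
    B.tau x (star a * b) = (star (θ.symm a) * θ.symm b).trace / N := by
  rw [← B.tau_apply θ, map_mul, map_star, StarAlgEquiv.apply_symm_apply,
    StarAlgEquiv.apply_symm_apply]

/-- The components of a smooth section of `B` in a local star frame are smooth. -/
theorem IsStarFrameOn.smoothFunAt_symm {B : EndBundle M N} {Θ : ∀ y, Mat N ≃⋆ₐ[ℂ] B.Fiber y}
    {U : Set M} (hΘ : IsStarFrameOn Θ U) {x : M} (hx : x ∈ U) {s : ∀ y, B.Fiber y}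
    (hs : SmoothSectionAt (Mat N) s x) : SmoothFunAt (fun y => (Θ y).symm (s y)) x := by
  refine (hΘ.contMDiffAt_iff hx).1 ?_
  simpa only [StarAlgEquiv.apply_symm_apply] using hs

theorem EndBundle.continuous_tau_star_mul [NeZero N] {B : EndBundle M N} (s t : B.sections) :
    Continuous fun x => B.tau x (star (s.1 x) * t.1 x) := by
  rw [continuous_iff_continuousAt]
  intro x
  obtain ⟨U, Θ, hx, hΘ⟩ := B.exists_starFrame x
  have h := fun s : B.sections => hΘ.smoothFunAt_symm hx (s.2.contMDiffAt isOpen_univ trivial)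
  have h2 := ((h s).bilin (h t) hsInner).continuousAt
  refine h2.congr (Eventually.of_forall fun y => ?_)
  exact (B.tau_star_mul (Θ y) _ _).symm

variable [RiemannianBundle (fun x : M => TangentSpace 𝓘(ℝ, E4) x)] {S : SpinStructure M}

/-- `Θ` is a local frame of the spinor bundle over the open set `U`, i.e. a smooth family of
unitary maps from `ℂ⁴` to the fibres. -/
structure IsSpinFrameOn (Θ : ∀ y, Spinor ≃ₗᵢ[ℂ] S.Fiber y) (U : Set M) : Prop where
  isOpen : IsOpen U
  smooth : ∀ w, SmoothSectionOn Spinor (fun y => Θ y w) U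

theorem IsSpinFrameOn.contMDiffAt_iff {Θ : ∀ y, Spinor ≃ₗᵢ[ℂ] S.Fiber y} {U : Set M}
    (hΘ : IsSpinFrameOn Θ U) {x : M} (hx : x ∈ U) {f : M → Spinor} :
    SmoothSectionAt Spinor (fun y => Θ y (f y)) x ↔ SmoothFunAt f x :=
  contMDiffAt_frame_iff
    (fun y => ⟨map_add (Θ y), fun r m => (Θ y).toLinearMap.map_smul_of_tower r m⟩)
    (fun y => (Θ y).bijective) (fun w => (hΘ.smooth w).contMDiffAt hΘ.isOpen hx)

theorem SpinStructure.exists_spinFrame (S : SpinStructure M) (x : M) :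
    ∃ (U : Set M) (Θ : ∀ y, Spinor ≃ₗᵢ[ℂ] S.Fiber y), x ∈ U ∧ IsSpinFrameOn Θ U := by
  obtain ⟨U, hU, hx, Θ, hΘ⟩ := S.locTriv x
  exact ⟨U, Θ, hx, hU, hΘ⟩

theorem IsSpinFrameOn.smoothFunAt_symm {Θ : ∀ y, Spinor ≃ₗᵢ[ℂ] S.Fiber y} {U : Set M}
    (hΘ : IsSpinFrameOn Θ U) {x : M} (hx : x ∈ U) {ψ : ∀ y, S.Fiber y}
    (hψ : SmoothSectionAt Spinor ψ x) : SmoothFunAt (fun y => (Θ y).symm (ψ y)) x := by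
  refine (hΘ.contMDiffAt_iff hx).1 ?_
  simpa only [LinearIsometryEquiv.apply_symm_apply] using hψ

theorem SpinStructure.continuous_inner (ψ φ : S.sections) :
    Continuous fun x => (inner ℂ (ψ.1 x) (φ.1 x) : ℂ) := by
  rw [continuous_iff_continuousAt]
  intro x
  obtain ⟨U, Θ, hx, hΘ⟩ := S.exists_spinFrame x
  have h := fun ψ : S.sections =>
    (hΘ.smoothFunAt_symm hx (ψ.2.contMDiffAt isOpen_univ trivial)).continuousAt
  refine (ContinuousAt.inner (𝕜 := ℂ) (h ψ) (h φ)).congr (Eventually.of_forall fun y => ?_)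
  exact (Θ y).symm.inner_map_map _ _

variable {B : EndBundle M N}

/-- The inner product of `B_x ⊗ S_x`. -/
noncomputable def fiberInner {x : M} (ξ η : B.Fiber x ⊗[ℂ] S.Fiber x) : ℂ :=
  tensorInner (B.chartFrame x x) ξ η

theorem fiberInner_tmul [NeZero N] {x : M} (a b : B.Fiber x) (w z : S.Fiber x) :
    fiberInner (a ⊗ₜ w) (b ⊗ₜ z) = B.tau x (star a * b) * inner ℂ w z := by
  rw [fiberInner, tensorInner_tmul, B.tau_star_mul (B.chartFrame x x)]

theorem continuous_fiberInner [NeZero N] (ξ η : TwistedSpinors S B) :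
    Continuous fun x => fiberInner (ξ.1 x) (η.1 x) := by
  obtain ⟨ξ, hξ⟩ := ξ
  obtain ⟨η, hη⟩ := η
  change Continuous fun x => fiberInner (ξ x) (η x)
  induction hξ using Submodule.span_induction with
  | mem ξ h =>
    obtain ⟨s, ψ, rfl⟩ := h
    induction hη using Submodule.span_induction with
    | mem η h =>
      obtain ⟨t, φ, rfl⟩ := h
      simp only [fiberInner_tmul]
      exact (EndBundle.continuous_tau_star_mul s t).mul (SpinStructure.continuous_inner ψ φ)
    | zero => simpa [fiberInner, tensorInner_zero_right] using continuous_const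
    | add ξ ξ' _ _ h h' =>
    refine (h.add h').congr fun x => ?_
    exact (tensorInner_add_right ..).symm
    | smul c ξ _ h =>
    refine ((continuous_const (y := c)).mul h).congr fun x => ?_
    exact (tensorInner_smul_right ..).symm
  | zero => simpa [fiberInner, tensorInner_zero_left] using continuous_const
  | add ξ ξ' _ _ h h' =>
    refine (h.add h').congr fun x => ?_
    exact (tensorInner_add_left ..).symm
  | smul c ξ _ h =>
    refine ((continuous_const (y := star c)).mul h).congr fun x => ?_
    exact (tensorInner_smul_left ..).symm

variable (S B) in
/-- `Γ(M, B ⊗ S)` with the `L²` inner product. -/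
def PreL2 : Type _ := TwistedSpinors S B

noncomputable instance : AddCommGroup (PreL2 S B) :=
  inferInstanceAs (AddCommGroup (TwistedSpinors S B))

noncomputable instance : Module ℂ (PreL2 S B) := inferInstanceAs (Module ℂ (TwistedSpinors S B))

/-- The value of a smooth section of `B ⊗ S` at a point. -/
noncomputable def evalAt (x : M) : PreL2 S B →ₗ[ℂ] B.Fiber x ⊗[ℂ] S.Fiber x :=
  LinearMap.proj x ∘ₗ (TwistedSpinors S B).subtype

variable [T2Space M] [CompactSpace M] [MeasurableSpace M] [BorelSpace M] [NeZero N]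
  [IsContMDiffRiemannianBundle 𝓘(ℝ, E4) ∞ E4 (fun x : M => TangentSpace 𝓘(ℝ, E4) x)]

theorem integrable_fiberInner (ξ η : PreL2 S B) :
    Integrable (fun x => fiberInner (evalAt x ξ) (evalAt x η)) (riemannianVolume M) :=
  (continuous_fiberInner ξ η).integrable_of_hasCompactSupport (HasCompactSupport.of_compactSpace _)

/-- The `L²` inner product is definite since the Riemannian volume charges every nonempty open
set. -/
noncomputable instance preL2Core : InnerProductSpace.Core ℂ (PreL2 S B) where
  inner ξ η := ∫ x, fiberInner (evalAt x ξ) (evalAt x η) ∂riemannianVolume M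
  conj_inner_symm ξ η := by
    rw [← integral_conj]
    congr 1
    funext x
    exact star_tensorInner _ _ _
  re_inner_nonneg ξ := by
    rw [← integral_re (integrable_fiberInner ξ ξ)]
    exact integral_nonneg fun x => tensorInner_self_nonneg _ _
  add_left ξ ξ' η := by
    rw [← integral_add (integrable_fiberInner ξ η) (integrable_fiberInner ξ' η)]
    congr 1
    funext x
    rw [map_add]
    exact tensorInner_add_left _ _ _ _
  smul_left ξ η c := by
    rw [← integral_const_mul]
    congr 1
    funext x
    rw [map_smul]
    exact tensorInner_smul_left _ _ _ _
  definite ξ h := by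
    have h1 : ∫ x, (fiberInner (evalAt x ξ) (evalAt x ξ)).re ∂riemannianVolume M = 0 := by
      refine (integral_re (integrable_fiberInner ξ ξ)).trans ?_
      rw [h]
      rfl
    have h2 := Measure.eq_of_ae_eq ((integral_eq_zero_iff_of_nonneg
      (f := fun x => (fiberInner (evalAt x ξ) (evalAt x ξ)).re)
      (fun x => tensorInner_self_nonneg _ _) (integrable_fiberInner ξ ξ).re).1 h1)
      (Complex.continuous_re.comp (continuous_fiberInner ξ ξ)) continuous_const
    refine Subtype.ext (funext fun x => ?_)
    exact eq_zero_of_tensorInner_self _ (congrFun h2 x)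

noncomputable instance : NormedAddCommGroup (PreL2 S B) :=
  (preL2Core (S := S) (B := B)).toNormedAddCommGroup

noncomputable instance : InnerProductSpace ℂ (PreL2 S B) :=
  InnerProductSpace.ofCore (preL2Core (S := S) (B := B)).toCore

theorem PreL2.inner_def (ξ η : PreL2 S B) :
    inner ℂ ξ η = ∫ x, fiberInner (evalAt x ξ) (evalAt x η) ∂riemannianVolume M := rfl

theorem PreL2.norm_sq_eq (ξ : PreL2 S B) :
    ‖ξ‖ ^ 2 = ∫ x, (fiberInner (evalAt x ξ) (evalAt x ξ)).re ∂riemannianVolume M := by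
  rw [norm_sq_eq_re_inner (𝕜 := ℂ), PreL2.inner_def]
  exact (integral_re (integrable_fiberInner ξ ξ)).symm

variable (S B) in
/-- The Hilbert space `L²(M, B ⊗ S)`. -/
abbrev L2 : Type _ := UniformSpace.Completion (PreL2 S B)

variable (S B) in
/-- The inclusion of `Γ(M, B ⊗ S)` in `L²(M, B ⊗ S)`. -/
noncomputable def toL2 : TwistedSpinors S B →ₗ[ℂ] L2 S B :=
  (UniformSpace.Completion.toComplₗᵢ (𝕜 := ℂ) (E := PreL2 S B)).toLinearMap

theorem denseRange_toL2 : DenseRange (toL2 S B) :=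
  UniformSpace.Completion.denseRange_coe (α := PreL2 S B)

theorem toL2_injective : Function.Injective (toL2 S B) :=
  (UniformSpace.Completion.toComplₗᵢ (𝕜 := ℂ) (E := PreL2 S B)).injective

theorem inner_toL2 (ξ η : TwistedSpinors S B) :
    inner ℂ (toL2 S B ξ) (toL2 S B η) =
      ∫ x, fiberInner (ξ.1 x) (η.1 x) ∂riemannianVolume M :=
  (UniformSpace.Completion.toComplₗᵢ (𝕜 := ℂ) (E := PreL2 S B)).inner_map_map _ _

theorem inner_toL2_twist (s t : B.sections) (ψ φ : S.sections) :
    inner ℂ (toL2 S B (twist s ψ)) (toL2 S B (twist t φ)) =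
      ∫ x, B.tau x (star (s.1 x) * t.1 x) * inner ℂ (ψ.1 x) (φ.1 x) ∂riemannianVolume M := by
  rw [inner_toL2]
  congr 1
  funext x
  exact fiberInner_tmul _ _ _ _

end HilbertSpace

/-! ### The representation, the real structure and the grading -/

section RealStructure

open Filter Topology

variable {M : Type*} [TopologicalSpace M] [ChartedSpace E4 M] [IsManifold 𝓘(ℝ, E4) ∞ M] {N : ℕ}
  [RiemannianBundle (fun x : M => TangentSpace 𝓘(ℝ, E4) x)] {S : SpinStructure M}
  {B : EndBundle M N}

/-- The operator on `Γ(M, B ⊗ S)` given by a family `L` of (semi)linear maps of the fibres that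
sends the sections `s ⊗ ψ` to smooth sections. -/
def fiberwise {σ : ℂ →+* ℂ} (L : ∀ x, B.Fiber x ⊗[ℂ] S.Fiber x →ₛₗ[σ] B.Fiber x ⊗[ℂ] S.Fiber x)
    (hL : ∀ (s : B.sections) (ψ : S.sections),
      (fun x => L x (s.1 x ⊗ₜ[ℂ] ψ.1 x)) ∈ TwistedSpinors S B) :
    PreL2 S B →ₛₗ[σ] PreL2 S B where
  toFun ξ := ⟨fun x => L x (ξ.1 x), by
    obtain ⟨ξ, hξ⟩ := ξ
    change (fun x => L x (ξ x)) ∈ _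
    induction hξ using Submodule.span_induction with
    | mem ξ h =>
      obtain ⟨s, ψ, rfl⟩ := h
      exact hL s ψ
    | zero =>
      simp only [Pi.zero_apply, map_zero]
      exact Submodule.zero_mem _
    | add ξ ξ' _ _ h h' =>
      simp only [Pi.add_apply, map_add]
      exact Submodule.add_mem _ h h'
    | smul c ξ _ h =>
      simp only [Pi.smul_apply, map_smulₛₗ]
      exact Submodule.smul_mem _ (σ c) h⟩
  map_add' ξ η := Subtype.ext (funext fun x => map_add (L x) _ _)
  map_smul' c ξ := Subtype.ext (funext fun x => map_smulₛₗ (L x) c _)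

/-- The action of `a ∈ Γ(M, B)` on `Γ(M, B ⊗ S)` by left multiplication. -/
noncomputable def leftMul (a : B.sections) : PreL2 S B →ₗ[ℂ] PreL2 S B :=
  fiberwise (fun x => (LinearMap.mulLeft ℂ (a.1 x)).rTensor (S.Fiber x))
    fun s ψ => (twist (a * s) ψ).2

theorem leftMul_one (ξ : PreL2 S B) : leftMul 1 ξ = ξ :=
  Subtype.ext <| funext fun x => by
    change (LinearMap.mulLeft ℂ (1 : B.Fiber x)).rTensor (S.Fiber x) _ = _
    rw [LinearMap.mulLeft_one, LinearMap.rTensor_id]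
    rfl

theorem leftMul_mul (a b : B.sections) (ξ : PreL2 S B) :
    leftMul (a * b) ξ = leftMul a (leftMul b ξ) :=
  Subtype.ext <| funext fun x => by
    change (LinearMap.mulLeft ℂ (a.1 x * b.1 x)).rTensor (S.Fiber x) _ = _
    rw [LinearMap.mulLeft_mul, LinearMap.rTensor_comp]
    rfl

theorem leftMul_add (a b : B.sections) (ξ : PreL2 S B) :
    leftMul (a + b) ξ = leftMul a ξ + leftMul b ξ :=
  Subtype.ext <| funext fun x => by
    change (LinearMap.mul ℂ (B.Fiber x) (a.1 x + b.1 x)).rTensor (S.Fiber x) _ = _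
    rw [map_add, LinearMap.rTensor_add]
    rfl

theorem leftMul_zero (ξ : PreL2 S B) : leftMul 0 ξ = 0 :=
  Subtype.ext <| funext fun x => by
    change (LinearMap.mul ℂ (B.Fiber x) 0).rTensor (S.Fiber x) _ = _
    rw [map_zero, LinearMap.rTensor_zero]
    rfl

theorem leftMul_algebraMap (c : ℂ) (ξ : PreL2 S B) :
    leftMul (algebraMap ℂ B.sections c) ξ = c • ξ :=
  Subtype.ext <| funext fun x => by
    change (LinearMap.mul ℂ (B.Fiber x) (algebraMap ℂ (B.Fiber x) c)).rTensor (S.Fiber x) _ = _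
    have h : LinearMap.mul ℂ (B.Fiber x) (algebraMap ℂ (B.Fiber x) c) = c • LinearMap.id := by
      ext b
      exact (Algebra.smul_def c b).symm
    rw [h, LinearMap.rTensor_smul, LinearMap.rTensor_id]
    rfl

/-- The operator `1 ⊗ γ₅` on `Γ(M, B ⊗ S)`. -/
noncomputable def chiralTwist : PreL2 S B →ₗ[ℂ] PreL2 S B :=
  fiberwise (fun x => (S.chirality x).lTensor (B.Fiber x))
    fun s ψ => (twist s (S.chiralSection ψ)).2

/-- The antilinear map `a ⊗ w ↦ a* ⊗ J_M w` of the fibre of `B ⊗ S`. -/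
noncomputable def fiberConj (x : M) :
    B.Fiber x ⊗[ℂ] S.Fiber x →ₛₗ[starRingEnd ℂ] B.Fiber x ⊗[ℂ] S.Fiber x :=
  TensorProduct.map (starLinearEquiv ℂ (A := B.Fiber x)).toLinearMap (S.conj x)

theorem fiberConj_tmul {x : M} (a : B.Fiber x) (w : S.Fiber x) :
    fiberConj x (a ⊗ₜ w) = star a ⊗ₜ[ℂ] S.conj x w := rfl

/-- The operator `s ⊗ ψ ↦ s* ⊗ J_M ψ` on `Γ(M, B ⊗ S)`. -/
noncomputable def conjTwist : PreL2 S B →ₛₗ[starRingEnd ℂ] PreL2 S B :=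
  fiberwise fiberConj fun s ψ => (twist (star s) (S.conjSection ψ)).2

theorem fiberConj_fiberConj {x : M} (ξ : B.Fiber x ⊗[ℂ] S.Fiber x) :
    fiberConj x (fiberConj x ξ) = -ξ := by
  induction ξ using TensorProduct.induction_on with
  | zero => simp
  | tmul a w => rw [fiberConj_tmul, fiberConj_tmul, star_star, S.conj_sq, TensorProduct.tmul_neg]
  | add ξ η h h' => rw [map_add, map_add, h, h', neg_add]

variable (S B) in
/-- `conjTwist` is invertible since its square is `-1`. -/
noncomputable def conjTwistEquiv : PreL2 S B ≃ₛₗ[starRingEnd ℂ] PreL2 S B :=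
  LinearEquiv.ofBijective conjTwist <| by
    have h : ∀ ξ : PreL2 S B, conjTwist (conjTwist ξ) = -ξ := fun ξ =>
      Subtype.ext (funext fun x => fiberConj_fiberConj _)
    refine ⟨fun ξ η hξ => ?_, fun ξ => ⟨-conjTwist ξ, ?_⟩⟩
    · have h2 := congrArg conjTwist hξ
      rw [h, h] at h2
      exact neg_injective h2
    · exact (map_neg conjTwist _).trans ((congrArg Neg.neg (h ξ)).trans (neg_neg ξ))

/-- The extension of an antilinear isometry to the completion. -/
noncomputable def completionIsometry {E : Type*} [NormedAddCommGroup E] [InnerProductSpace ℂ E]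
    (f : E ≃ₛₗ[starRingEnd ℂ] E) (hf : ∀ ξ, ‖f ξ‖ = ‖ξ‖) :
    UniformSpace.Completion E ≃ₛₗᵢ[starRingEnd ℂ] UniformSpace.Completion E :=
  f.extendOfIsometry UniformSpace.Completion.toComplₗᵢ.toLinearMap
    UniformSpace.Completion.toComplₗᵢ.toLinearMap UniformSpace.Completion.denseRange_coe
    UniformSpace.Completion.denseRange_coe fun ξ => by
      simpa using! hf ξ

theorem completionIsometry_coe {E : Type*} [NormedAddCommGroup E] [InnerProductSpace ℂ E]
    (f : E ≃ₛₗ[starRingEnd ℂ] E) (hf : ∀ ξ, ‖f ξ‖ = ‖ξ‖) (ξ : E) :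
    completionIsometry f hf ξ = (f ξ : E) :=
  f.extendOfIsometry_eq UniformSpace.Completion.toComplₗᵢ.toLinearMap
    UniformSpace.Completion.toComplₗᵢ.toLinearMap UniformSpace.Completion.denseRange_coe
    UniformSpace.Completion.denseRange_coe _ ξ

section Fiber

variable {x : M} (ξ η : B.Fiber x ⊗[ℂ] S.Fiber x)

variable [NeZero N]

/-- Left multiplication by `a*` is adjoint to left multiplication by `a`. -/
theorem fiberInner_mulLeft (a : B.Fiber x) :
    fiberInner ((LinearMap.mulLeft ℂ (star a)).rTensor (S.Fiber x) ξ) η =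
      fiberInner ξ ((LinearMap.mulLeft ℂ a).rTensor (S.Fiber x) η) := by
  induction ξ using TensorProduct.induction_on with
  | zero => simp [fiberInner, tensorInner_zero_left]
  | add ξ ξ' h h' =>
    rw [map_add]
    exact (tensorInner_add_left ..).trans
      ((congrArg₂ (· + ·) h h').trans (tensorInner_add_left ..).symm)
  | tmul b w =>
    induction η using TensorProduct.induction_on with
    | zero => simp [fiberInner, tensorInner_zero_right]
    | add η η' h h' =>
      rw [map_add]
      exact (tensorInner_add_right ..).trans
        ((congrArg₂ (· + ·) h h').trans (tensorInner_add_right ..).symm)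
    | tmul c z =>
      simp only [LinearMap.rTensor_tmul, LinearMap.mulLeft_apply, fiberInner_tmul, star_mul,
        star_star, mul_assoc]

theorem fiberInner_chirality :
    fiberInner ((S.chirality x).lTensor (B.Fiber x) ξ) ((S.chirality x).lTensor (B.Fiber x) η) =
      fiberInner ξ η := by
  induction ξ using TensorProduct.induction_on with
  | zero => simp [fiberInner, tensorInner_zero_left]
  | add ξ ξ' h h' =>
    rw [map_add]
    exact (tensorInner_add_left ..).trans
      ((congrArg₂ (· + ·) h h').trans (tensorInner_add_left ..).symm)
  | tmul b w =>
    induction η using TensorProduct.induction_on with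
    | zero => simp [fiberInner, tensorInner_zero_right]
    | add η η' h h' =>
      rw [map_add]
      exact (tensorInner_add_right ..).trans
        ((congrArg₂ (· + ·) h h').trans (tensorInner_add_right ..).symm)
    | tmul c z =>
      simp only [LinearMap.lTensor_tmul, fiberInner_tmul, S.chirality_symm, S.chirality_sq]

/-- The conjugation is antiunitary: `τ` is a trace and `J_M` is antiunitary. -/
theorem fiberInner_fiberConj : fiberInner (fiberConj x ξ) (fiberConj x η) = fiberInner η ξ := by
  induction ξ using TensorProduct.induction_on with
  | zero => simp [fiberInner, tensorInner_zero_left, tensorInner_zero_right]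
  | add ξ ξ' h h' =>
    rw [map_add]
    exact (tensorInner_add_left ..).trans
      ((congrArg₂ (· + ·) h h').trans (tensorInner_add_right ..).symm)
  | tmul b w =>
    induction η using TensorProduct.induction_on with
    | zero => simp [fiberInner, tensorInner_zero_left, tensorInner_zero_right]
    | add η η' h h' =>
      rw [map_add]
      exact (tensorInner_add_right ..).trans
        ((congrArg₂ (· + ·) h h').trans (tensorInner_add_left ..).symm)
    | tmul c z =>
      rw [fiberConj_tmul, fiberConj_tmul, fiberInner_tmul, fiberInner_tmul, S.conj_inner,
        B.tau_star_mul (B.chartFrame x x), B.tau_star_mul (B.chartFrame x x), map_star, map_star,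
        star_star, Matrix.trace_mul_comm]

theorem fiberInner_mulLeft_le (a : B.Fiber x) :
    (fiberInner ((LinearMap.mulLeft ℂ a).rTensor (S.Fiber x) ξ)
      ((LinearMap.mulLeft ℂ a).rTensor (S.Fiber x) ξ)).re ≤
      N * (B.tau x (star a * a)).re * (fiberInner ξ ξ).re := by
  have hN : (N : ℂ) ≠ 0 := Nat.cast_ne_zero.2 (NeZero.ne N)
  have h : (star ((B.chartFrame x x).symm a) * (B.chartFrame x x).symm a).trace.re =
      N * (B.tau x (star a * a)).re := by
    rw [B.tau_star_mul (B.chartFrame x x), ← Complex.re_ofReal_mul, Complex.ofReal_natCast,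
      mul_div_cancel₀ _ hN]
  rw [← h]
  exact tensorInner_mulLeft_le _ _ _

end Fiber

variable [T2Space M] [CompactSpace M] [MeasurableSpace M] [BorelSpace M] [NeZero N]
  [IsContMDiffRiemannianBundle 𝓘(ℝ, E4) ∞ E4 (fun x : M => TangentSpace 𝓘(ℝ, E4) x)]

/-- Left multiplication is bounded: the square of the norm of `a` acting on a fibre is at most
`N τ(a* a)`, which is bounded on the compact manifold. -/
theorem exists_norm_leftMul_le (a : B.sections) :
    ∃ C : ℝ, ∀ ξ : PreL2 S B, ‖leftMul a ξ‖ ≤ C * ‖ξ‖ := by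
  have hcont : Continuous fun x => N * (B.tau x (star (a.1 x) * a.1 x)).re :=
    continuous_const.mul (Complex.continuous_re.comp (EndBundle.continuous_tau_star_mul a a))
  obtain ⟨C, hC⟩ := (isCompact_range hcont).bddAbove
  refine ⟨√(max C 0), fun ξ => ?_⟩
  refine le_of_sq_le_sq ?_ (by positivity)
  rw [mul_pow, Real.sq_sqrt (le_max_right _ _), PreL2.norm_sq_eq, PreL2.norm_sq_eq,
    ← integral_const_mul]
  refine integral_mono (integrable_fiberInner _ _).re
    ((integrable_fiberInner ξ ξ).re.const_mul _) fun x => ?_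
  refine (fiberInner_mulLeft_le _ _).trans ?_
  exact mul_le_mul_of_nonneg_right ((hC ⟨x, rfl⟩).trans (le_max_left _ _))
    (tensorInner_self_nonneg _ _)

theorem norm_chiralTwist (ξ : PreL2 S B) : ‖chiralTwist ξ‖ = ‖ξ‖ := by
  rw [← pow_left_inj₀ (norm_nonneg _) (norm_nonneg _) two_ne_zero, PreL2.norm_sq_eq,
    PreL2.norm_sq_eq]
  congr 1
  funext x
  exact congrArg Complex.re (fiberInner_chirality _ _)

theorem norm_conjTwistEquiv (ξ : PreL2 S B) : ‖conjTwistEquiv S B ξ‖ = ‖ξ‖ := by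
  rw [← pow_left_inj₀ (norm_nonneg _) (norm_nonneg _) two_ne_zero, PreL2.norm_sq_eq,
    PreL2.norm_sq_eq]
  congr 1
  funext x
  exact congrArg Complex.re (fiberInner_fiberConj _ _)

variable (S B) in
/-- The antiunitary operator `J` on `L²(M, B ⊗ S)`. -/
noncomputable def conjL2 : L2 S B ≃ₛₗᵢ[starRingEnd ℂ] L2 S B :=
  completionIsometry (conjTwistEquiv S B) norm_conjTwistEquiv

theorem conjL2_coe (ξ : PreL2 S B) : conjL2 S B ξ = (conjTwist ξ : PreL2 S B) :=
  completionIsometry_coe _ _ ξ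

variable (S B) in
/-- The grading operator `γ_B` on `L²(M, B ⊗ S)`. -/
noncomputable def gradingL2 : L2 S B →L[ℂ] L2 S B :=
  (chiralTwist.mkContinuous 1 fun ξ => by
    rw [one_mul]; exact (norm_chiralTwist ξ).le : PreL2 S B →L[ℂ] PreL2 S B).completion

theorem gradingL2_coe (ξ : PreL2 S B) : gradingL2 S B ξ = (chiralTwist ξ : PreL2 S B) :=
  ContinuousLinearMap.completion_apply_coe _ _

/-- The extension of `leftMul a` to `L²(M, B ⊗ S)`. -/
noncomputable def leftMulL2 (a : B.sections) : L2 S B →L[ℂ] L2 S B :=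
  ((leftMul a).mkContinuousOfExistsBound (exists_norm_leftMul_le a)).completion

theorem leftMulL2_coe (a : B.sections) (ξ : PreL2 S B) :
    leftMulL2 a (ξ : L2 S B) = (leftMul a ξ : PreL2 S B) :=
  ContinuousLinearMap.completion_apply_coe _ _

theorem leftMulL2_eq {a : B.sections} {T : L2 S B →L[ℂ] L2 S B}
    (h : ∀ ξ : PreL2 S B, T ξ = (leftMul a ξ : PreL2 S B)) : leftMulL2 a = T :=
  ContinuousLinearMap.coeFn_injective <| UniformSpace.Completion.ext (leftMulL2 a).continuous
    T.continuous fun ξ => (leftMulL2_coe a ξ).trans (h ξ).symm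

theorem leftMulL2_star (a : B.sections) :
    leftMulL2 (S := S) (star a) = star (leftMulL2 a) := by
  rw [ContinuousLinearMap.star_eq_adjoint, ContinuousLinearMap.eq_adjoint_iff]
  intro ξ η
  refine UniformSpace.Completion.induction_on₂ (p := fun ξ η =>
    inner ℂ (leftMulL2 (star a) ξ) η = inner ℂ ξ (leftMulL2 a η)) ξ η ?_ fun ξ η => ?_
  · exact isClosed_eq (by fun_prop) (by fun_prop)
  · rw [leftMulL2_coe, leftMulL2_coe, UniformSpace.Completion.inner_coe,
      UniformSpace.Completion.inner_coe, PreL2.inner_def, PreL2.inner_def]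
    congr 1
    funext x
    exact fiberInner_mulLeft _ _ _

variable (S B) in
/-- The representation of `Γ(M, B)` on `L²(M, B ⊗ S)` by left multiplication. -/
noncomputable def repL2 : B.sections →⋆ₐ[ℂ] (L2 S B →L[ℂ] L2 S B) where
  toFun := leftMulL2
  map_one' := leftMulL2_eq fun ξ => by
    rw [leftMul_one]; rfl
  map_mul' a b := leftMulL2_eq fun ξ => by
    rw [leftMul_mul, ← leftMulL2_coe, ← leftMulL2_coe]; rfl
  map_zero' := leftMulL2_eq fun ξ => by
    rw [leftMul_zero, UniformSpace.Completion.coe_zero]; rfl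
  map_add' a b := leftMulL2_eq fun ξ => by
    rw [leftMul_add, UniformSpace.Completion.coe_add, ← leftMulL2_coe, ← leftMulL2_coe]; rfl
  commutes' c := leftMulL2_eq fun ξ => by
    rw [leftMul_algebraMap, UniformSpace.Completion.coe_smul]; rfl
  map_star' := leftMulL2_star

end RealStructure

/-! ### The inverse metric as a finite sum of products of vector fields -/

section InverseMetric

open Filter Topology

/-- Two families of vectors with `∑ ⟨X_k, v⟩ ⟨Y_k, w⟩ = ⟨v, w⟩`, i.e. `∑ X_k ⊗ Y_k` is the inverse
metric, compute the trace `∑ β(e_μ, e_μ)` of a bilinear map in an orthonormal basis. -/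
theorem OrthonormalBasis.sum_bilin_eq {ι κ V W : Type*} [Fintype ι] [NormedAddCommGroup V]
    [InnerProductSpace ℝ V] [AddCommGroup W] [Module ℝ W] (e : OrthonormalBasis ι ℝ V)
    (β : V →ₗ[ℝ] V →ₗ[ℝ] W) (F : Finset κ) (X Y : κ → V)
    (h : ∀ v w : V, ∑ k ∈ F, inner ℝ (X k) v * inner ℝ (Y k) w = inner ℝ v w) :
    ∑ k ∈ F, β (X k) (Y k) = ∑ μ, β (e μ) (e μ) := by
  classical
  have h1 : ∀ k, β (X k) (Y k) =
      ∑ μ, ∑ ν, (inner ℝ (X k) (e μ) * inner ℝ (Y k) (e ν)) • β (e μ) (e ν) := by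
    intro k
    have h2 : ∀ y, β (X k) y = ∑ μ, (inner ℝ (X k) (e μ) : ℝ) • β (e μ) y := fun y => by
      conv_lhs => rw [← e.sum_repr (X k), ← LinearMap.flip_apply, map_sum]
      exact Finset.sum_congr rfl fun μ _ => by
        rw [map_smul, e.repr_apply_apply, real_inner_comm, LinearMap.flip_apply]
    rw [h2]
    refine Finset.sum_congr rfl fun μ _ => ?_
    conv_lhs => rw [← e.sum_repr (Y k), map_sum, Finset.smul_sum]
    refine Finset.sum_congr rfl fun ν _ => ?_
    rw [map_smul, smul_smul, e.repr_apply_apply, real_inner_comm (Y k)]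
  simp only [h1]
  rw [Finset.sum_comm]
  refine Finset.sum_congr rfl fun μ _ => ?_
  rw [Finset.sum_comm]
  simp only [← Finset.sum_smul, h, OrthonormalBasis.inner_eq_ite, ite_smul, one_smul, zero_smul]
  simp

variable {M : Type*} [TopologicalSpace M] [ChartedSpace E4 M] [IsManifold 𝓘(ℝ, E4) ∞ M]
  [RiemannianBundle (fun x : M => TangentSpace 𝓘(ℝ, E4) x)]

/-- The orthogonal frame obtained from the coordinate fields of the chart at `c`. -/
noncomputable def orthogonalField (c : M) (i : Fin 4) (x : M) : TangentSpace 𝓘(ℝ, E4) x :=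
  InnerProductSpace.gramSchmidt ℝ (fun i => coordField c i x) i

theorem orthogonalField_ne_zero (c : M) (i : Fin 4) {x : M} (hx : x ∈ (chartAt E4 c).source) :
    orthogonalField c i x ≠ 0 :=
  InnerProductSpace.gramSchmidt_ne_zero i (linearIndependent_coordField c hx)

/-- Parseval's identity for an orthogonal, not normalized, frame. -/
theorem sum_inner_orthogonalField (c : M) {x : M} (hx : x ∈ (chartAt E4 c).source)
    (v w : TangentSpace 𝓘(ℝ, E4) x) :
    ∑ i, inner ℝ (orthogonalField c i x) v *
      ((inner ℝ (orthogonalField c i x) (orthogonalField c i x) : ℝ)⁻¹ *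
        inner ℝ (orthogonalField c i x) w) = inner ℝ v w := by
  have : FiniteDimensional ℝ (TangentSpace 𝓘(ℝ, E4) x) :=
    inferInstanceAs (FiniteDimensional ℝ E4)
  have hcard : Fintype.card (Fin 4) = Module.finrank ℝ (TangentSpace 𝓘(ℝ, E4) x) := by
    have : Module.finrank ℝ E4 = 4 := finrank_euclideanSpace_fin
    exact (Fintype.card_fin 4).trans this.symm
  have hon := InnerProductSpace.gramSchmidtNormed_orthonormal
    (linearIndependent_coordField c hx)
  let b := OrthonormalBasis.mk hon
    (hon.linearIndependent.span_eq_top_of_card_eq_finrank hcard).ge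
  rw [← b.sum_inner_mul_inner v w]
  refine Finset.sum_congr rfl fun i _ => ?_
  have hb : b i = ‖orthogonalField c i x‖⁻¹ • orthogonalField c i x := by
    rw [OrthonormalBasis.coe_mk]; rfl
  rw [hb, inner_smul_left, inner_smul_right, real_inner_self_eq_norm_sq,
    real_inner_comm v]
  simp only [conj_trivial]
  ring

variable [IsContMDiffRiemannianBundle 𝓘(ℝ, E4) ∞ E4 (fun x : M => TangentSpace 𝓘(ℝ, E4) x)]

/-- The Gram–Schmidt recursion expresses each field smoothly in the earlier ones. -/
theorem smooth_orthogonalField (c : M) (i : Fin 4) :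
    SmoothSectionOn E4 (orthogonalField c i) (chartAt E4 c).source := by
  induction i using WellFoundedLT.induction with
  | ind i ih =>
  have h : orthogonalField c i = fun x => coordField c i x - ∑ j ∈ Finset.Iio i,
      ((inner ℝ (orthogonalField c j x) (orthogonalField c j x))⁻¹ *
        inner ℝ (orthogonalField c j x) (coordField c i x) : ℝ) • orthogonalField c j x := by
    funext x
    rw [eq_sub_iff_add_eq]
    refine Eq.trans (congrArg (_ + ·) ?_)
      (InnerProductSpace.gramSchmidt_def'' ℝ (fun i => coordField c i x) i).symm
    refine Finset.sum_congr rfl fun j _ => ?_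
    rw [real_inner_self_eq_norm_sq, div_eq_inv_mul]
    rfl
  rw [h]
  refine ContMDiffOn.sub_section (smooth_coordField c i)
    (ContMDiffOn.sum_section fun j hj => ?_)
  have hj' := ih j (Finset.mem_Iio.1 hj)
  refine ContMDiffOn.smul_section (ContMDiffOn.mul (ContMDiffOn.inv₀ ?_ ?_) ?_) hj'
  · exact ContMDiffOn.inner_bundle hj' hj'
  · exact fun x hx => inner_self_ne_zero.2 (orthogonalField_ne_zero c j hx)
  · exact ContMDiffOn.inner_bundle hj' (smooth_coordField c i)

/-- The inverse metric is a finite sum `∑ X_k ⊗ Y_k` with global smooth vector fields `X_k`,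
`Y_k`. -/
theorem exists_fields_sum_inner [T2Space M] [CompactSpace M] :
    ∃ (F : Finset (M × Fin 4)) (X Y : M × Fin 4 → ∀ x : M, TangentSpace 𝓘(ℝ, E4) x),
      (∀ k, SmoothVectorField (X k)) ∧ (∀ k, SmoothVectorField (Y k)) ∧
      ∀ (x : M) (v w : TangentSpace 𝓘(ℝ, E4) x),
        ∑ k ∈ F, inner ℝ (X k x) v * inner ℝ (Y k x) w = inner ℝ v w := by
  obtain ⟨ρ, hρ⟩ := SmoothPartitionOfUnity.exists_isSubordinate_chartAt_source 𝓘(ℝ, E4) M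
  have hfin : {c | (Function.support (ρ c)).Nonempty}.Finite :=
    ρ.locallyFinite.finite_nonempty_of_compact
  -- With cutoff functions on both factors of `∑ X_k ⊗ Y_k`, dividing by `h = ∑ ρ_c²` restores
  -- the normalization.
  let h : M → ℝ := fun x => ∑ c ∈ hfin.toFinset, ρ c x * ρ c x
  have hsmooth : ContMDiff 𝓘(ℝ, E4) 𝓘(ℝ, ℝ) ∞ h :=
    ContMDiff.sum fun c _ => (ρ c).contMDiff.mul (ρ c).contMDiff
  have hpos : ∀ x, h x ≠ 0 := by
    intro x
    obtain ⟨c, hc⟩ := ρ.exists_pos_of_mem (Set.mem_univ x)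
    refine (Finset.sum_pos' (fun c _ => mul_self_nonneg (ρ c x)) ⟨c, ?_, mul_pos hc hc⟩).ne'
    exact hfin.mem_toFinset.2 ⟨x, hc.ne'⟩
  have hsm : ∀ k : M × Fin 4, ∀ σ : ∀ x : M, TangentSpace 𝓘(ℝ, E4) x,
      SmoothSectionOn E4 σ (chartAt E4 k.1).source →
      SmoothVectorField fun x => ρ k.1 x • σ x := fun k σ hσ =>
    (ContMDiffOn.smul_section_of_tsupport (ρ k.1).contMDiff.contMDiffOn
      (chartAt E4 k.1).open_source (hρ k.1) hσ).contMDiffOn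
  have hG := fun k : M × Fin 4 => smooth_orthogonalField k.1 k.2
  refine ⟨hfin.toFinset ×ˢ Finset.univ,
    fun k x => (h x)⁻¹ • (ρ k.1 x • orthogonalField k.1 k.2 x),
    fun k x => ρ k.1 x • ((inner ℝ (orthogonalField k.1 k.2 x) (orthogonalField k.1 k.2 x) : ℝ)⁻¹ •
      orthogonalField k.1 k.2 x), fun k => ?_, fun k => ?_, fun x v w => ?_⟩
  · exact ContMDiffOn.smul_section (hsmooth.inv₀ hpos).contMDiffOn (hsm k _ (hG k))
  · refine hsm k _ (ContMDiffOn.smul_section (ContMDiffOn.inv₀ ?_ ?_) (hG k))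
    · exact ContMDiffOn.inner_bundle (hG k) (hG k)
    · exact fun x hx => inner_self_ne_zero.2 (orthogonalField_ne_zero k.1 k.2 hx)
  · rw [Finset.sum_product]
    have h1 : ∀ c ∈ hfin.toFinset, ∑ i : Fin 4,
        inner ℝ ((h x)⁻¹ • (ρ c x • orthogonalField c i x)) v *
          inner ℝ (ρ c x • ((inner ℝ (orthogonalField c i x) (orthogonalField c i x) : ℝ)⁻¹ •
            orthogonalField c i x)) w = (h x)⁻¹ * (ρ c x * ρ c x) * inner ℝ v w := by
      intro c _
      simp only [inner_smul_left, conj_trivial]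
      by_cases hc : ρ c x = 0
      · simp [hc]
      · rw [← sum_inner_orthogonalField c (hρ c (subset_tsupport _ hc)) v w, Finset.mul_sum]
        exact Finset.sum_congr rfl fun i _ => by ring
    rw [Finset.sum_congr rfl h1, ← Finset.sum_mul, ← Finset.mul_sum]
    rw [inv_mul_cancel₀ (hpos x), one_mul]

end InverseMetric

/-! ### The connection on `B ⊗ S` and the twisted Dirac operator -/

section Dirac

open Filter Topology

variable {M : Type*} [TopologicalSpace M] [ChartedSpace E4 M] [IsManifold 𝓘(ℝ, E4) ∞ M]
  [RiemannianBundle (fun x : M => TangentSpace 𝓘(ℝ, E4) x)] {S : SpinStructure M}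

theorem TensorProduct.smul_tmul'_real {A W : Type*} [AddCommGroup A] [Module ℂ A] [AddCommGroup W]
    [Module ℂ W] (r : ℝ) (a : A) (w : W) : (r • a) ⊗ₜ[ℂ] w = r • a ⊗ₜ[ℂ] w := by
  rw [TensorProduct.smul_tmul']

theorem TensorProduct.tmul_smul_real {A W : Type*} [AddCommGroup A] [Module ℂ A] [AddCommGroup W]
    [Module ℂ W] (r : ℝ) (a : A) (w : W) : a ⊗ₜ[ℂ] (r • w) = r • a ⊗ₜ[ℂ] w := by
  rw [← Complex.coe_smul r w, ← TensorProduct.smul_tmul, Complex.coe_smul, TensorProduct.smul_tmul']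

/-- Scalar multiplication as a real bilinear map. -/
noncomputable def smulLin : ℂ →ₗ[ℝ] Spinor →ₗ[ℝ] Spinor :=
  LinearMap.mk₂ ℝ (fun c w => c • w) (fun c c' w => add_smul c c' w)
    (fun r c w => smul_assoc r c w) (fun c w w' => smul_add c w w')
    (fun r c w => smul_comm c r w)

theorem SmoothFunAt.smul_spinor {f : M → ℂ} {x : M} (hf : SmoothFunAt f x) {ψ : ∀ y, S.Fiber y}
    (hψ : SmoothSectionAt Spinor ψ x) : SmoothSectionAt Spinor (fun y => f y • ψ y) x := by
  obtain ⟨U, Θ, hx, hΘ⟩ := S.exists_spinFrame x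
  have h := (hΘ.contMDiffAt_iff hx).2 (hf.bilin (hΘ.smoothFunAt_symm hx hψ) smulLin)
  refine contMDiffAt_section_congr h (Eventually.of_forall fun y => ?_)
  change f y • ψ y = Θ y (f y • (Θ y).symm (ψ y))
  rw [map_smul, LinearIsometryEquiv.apply_symm_apply]

namespace SpinStructure

variable {ψ : ∀ y, S.Fiber y} {x : M}

theorem cov_smul_const [T2Space M] {U : Set M} (hU : IsOpen U)
    (hψ : SmoothSectionOn Spinor ψ U) (hx : x ∈ U) (c : ℂ) (v : TangentSpace 𝓘(ℝ, E4) x) :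
    S.cov (fun y => c • ψ y) x v = c • S.cov ψ x v := by
  obtain ⟨φ, hφ, h⟩ := exists_smooth_section_eventuallyEq hU hx hψ
  have hφx := SmoothSectionOn.contMDiffAt isOpen_univ (Set.mem_univ x) hφ
  have hψx := hψ.contMDiffAt hU hx
  have h1 : S.cov ψ x = S.cov φ x :=
    S.cov.isCovariantDerivativeOnUniv.congr_of_eventuallyEq
      (hψx.mdifferentiableAt (by simp)) (hφx.mdifferentiableAt (by simp)) univ_mem
      (h.mono fun y hy => hy.symm)
  have h2 : S.cov (fun y => c • ψ y) x = S.cov (c • φ) x :=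
    S.cov.isCovariantDerivativeOnUniv.congr_of_eventuallyEq
      (((smoothFunAt_const c x).smul_spinor hψx).mdifferentiableAt (by simp))
      (((smoothFunAt_const c x).smul_spinor hφx).mdifferentiableAt (by simp)) univ_mem
      (h.mono fun y hy => by
        change c • ψ y = c • φ y
        rw [hy])
  rw [h1, h2, S.cov_smul c φ hφ]

/-- The Leibniz rule for complex functions. -/
theorem cov_smul_fun [T2Space M] {f : M → ℂ} (hf : SmoothFunAt f x)
    (hψ : SmoothSectionOn Spinor ψ Set.univ)
    (v : TangentSpace 𝓘(ℝ, E4) x) : S.cov (fun y => f y • ψ y) x v =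
      f x • S.cov ψ x v + mvfderiv 𝓘(ℝ, E4) f x v • ψ x := by
  have hψx := hψ.contMDiffAt isOpen_univ (Set.mem_univ x)
  have hI : SmoothSectionAt Spinor (fun y => Complex.I • ψ y) x :=
    (smoothFunAt_const Complex.I x).smul_spinor hψx
  -- The Leibniz rule is available for real functions only, so `f` is split as `Re f + i Im f`.
  have hre : SmoothFunAt (fun y => (f y).re) x := hf.linearMap_comp Complex.reLm
  have him : SmoothFunAt (fun y => (f y).im) x := hf.linearMap_comp Complex.imLm
  have hsum : (fun y => f y • ψ y) =
      ((fun y => (f y).re) • ψ) + (fun y => (f y).im) • fun y => Complex.I • ψ y := by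
    funext y
    change f y • ψ y = (f y).re • ψ y + (f y).im • Complex.I • ψ y
    rw [← Complex.coe_smul, ← Complex.coe_smul, smul_smul, ← add_smul, Complex.re_add_im]
  have h := S.cov.isCovariantDerivativeOnUniv
  have d1 : mvfderiv 𝓘(ℝ, E4) (fun y => (f y).re) x v = (mvfderiv 𝓘(ℝ, E4) f x v).re :=
    mvfderiv_linearMap_comp Complex.reLm (hf.mdifferentiableAt (by simp)) v
  have d2 : mvfderiv 𝓘(ℝ, E4) (fun y => (f y).im) x v = (mvfderiv 𝓘(ℝ, E4) f x v).im :=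
    mvfderiv_linearMap_comp Complex.imLm (hf.mdifferentiableAt (by simp)) v
  have h3 := h.add (ContMDiffAt.smul_section hre hψx |>.mdifferentiableAt (by simp))
    (ContMDiffAt.smul_section him hI |>.mdifferentiableAt (by simp))
  have h4 := h.leibniz (hψx.mdifferentiableAt (by simp)) (hre.mdifferentiableAt (by simp))
  have h5 := h.leibniz (hI.mdifferentiableAt (by simp)) (him.mdifferentiableAt (by simp))
  have h6 := congrArg (fun L => L v) ((congrArg (S.cov · x) hsum).trans
    (h3.trans (congrArg₂ (· + ·) h4 h5)))
  refine h6.trans ?_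
  have h7 := cov_smul_const isOpen_univ hψ (Set.mem_univ x) Complex.I v
  change (f x).re • S.cov ψ x v + mvfderiv 𝓘(ℝ, E4) (fun y => (f y).re) x v • ψ x +
    ((f x).im • S.cov (fun y => Complex.I • ψ y) x v +
      mvfderiv 𝓘(ℝ, E4) (fun y => (f y).im) x v • Complex.I • ψ x) = _
  rw [h7, d1, d2]
  have h8 : ∀ (c : ℂ) (w : S.Fiber x), c • w = c.re • w + c.im • Complex.I • w := fun c w => by
    rw [← Complex.coe_smul, ← Complex.coe_smul, smul_smul, ← add_smul, Complex.re_add_im]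
  rw [h8 (f x), h8 (mvfderiv 𝓘(ℝ, E4) f x v)]
  abel

end SpinStructure

variable {N : ℕ} {B : EndBundle M N}

/-- The components of a section of `B ⊗ S` in the star frame of `B` chosen around `x`; these are
spinor fields. -/
noncomputable def frameCoordSection (x : M) (i j : Fin N) (ξ : PreL2 S B) (y : M) : S.Fiber y :=
  tensorCoord (B.chartFrame x y) i j (evalAt y ξ)

theorem smooth_frameCoordSection (x : M) (i j : Fin N) (ξ : PreL2 S B) :
    SmoothSectionOn Spinor (frameCoordSection x i j ξ) (B.chartSet x) := by
  intro y hy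
  refine ContMDiffAt.contMDiffWithinAt ?_
  obtain ⟨ξ, hξ⟩ := ξ
  change SmoothSectionAt Spinor (fun y => tensorCoord (B.chartFrame x y) i j (ξ y)) y
  induction hξ using Submodule.span_induction with
  | mem ξ h =>
    obtain ⟨s, ψ, rfl⟩ := h
    have h1 := (B.isStarFrameOn_chartFrame x).smoothFunAt_symm hy
      (s.2.contMDiffAt isOpen_univ (Set.mem_univ y))
    exact (h1.linearMap_comp (Matrix.entryLinearMap ℝ ℂ i j)).smul_spinor
      (ψ.2.contMDiffAt isOpen_univ (Set.mem_univ y))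
  | zero =>
    simp only [Pi.zero_apply, map_zero]
    exact (contMDiff_zeroSection ℝ S.Fiber).contMDiffAt
  | add ξ ξ' _ _ h h' =>
    simp only [Pi.add_apply, map_add]
    exact ContMDiffAt.add_section h h'
  | smul c ξ _ h =>
    simp only [Pi.smul_apply, map_smul]
    exact (smoothFunAt_const c y).smul_spinor h

/-- The derivation `[α, ·]` of the fibre, for a matrix `α`, read in a frame. -/
noncomputable def adFrame {A : Type*} [Ring A] [Algebra ℂ A] [Star A] (θ : Mat N ≃⋆ₐ[ℂ] A)
    (α : Mat N) : A →ₗ[ℂ] A :=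
  θ.toAlgEquiv.toLinearEquiv.conj (LinearMap.mulLeft ℂ α - LinearMap.mulRight ℂ α)

variable [T2Space M]

/-- The connection `∇^B ⊗ 1 + 1 ⊗ ∇^S` on `B ⊗ S`, written as `d + [α, ·] ⊗ 1 + 1 ⊗ ∇^S` in the
star frame of `B` chosen around `x`. -/
noncomputable def twistedCov (nabla : StarConnection B) (x : M) (v : TangentSpace 𝓘(ℝ, E4) x) :
    PreL2 S B →ₗ[ℂ] B.Fiber x ⊗[ℂ] S.Fiber x where
  toFun ξ := (adFrame (B.chartFrame x x) (connForm nabla (B.chartFrame x) x v)).rTensor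
      (S.Fiber x) (evalAt x ξ) +
    ∑ i, ∑ j, B.chartFrame x x (Matrix.single i j 1) ⊗ₜ[ℂ] S.cov (frameCoordSection x i j ξ) x v
  map_add' ξ η := by
    have h : ∀ i j, S.cov (frameCoordSection x i j (ξ + η)) x v =
        S.cov (frameCoordSection x i j ξ) x v + S.cov (frameCoordSection x i j η) x v := by
      intro i j
      have hd := fun ξ : PreL2 S B => ((smooth_frameCoordSection x i j ξ).contMDiffAt
        (B.isStarFrameOn_chartFrame x).isOpen (B.mem_chartSet x)).mdifferentiableAt
          (n := ∞) (by simp)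
      have h2 : frameCoordSection x i j (ξ + η) =
          frameCoordSection x i j ξ + frameCoordSection x i j η := by
        funext y
        exact (congrArg _ (map_add (evalAt y) ξ η)).trans (map_add _ _ _)
      rw [h2]
      exact congrArg (fun L => L v) (S.cov.isCovariantDerivativeOnUniv.add (hd ξ) (hd η))
    simp only [h, map_add, TensorProduct.tmul_add, Finset.sum_add_distrib]
    abel
  map_smul' c ξ := by
    have h : ∀ i j, S.cov (frameCoordSection x i j (c • ξ)) x v =
        c • S.cov (frameCoordSection x i j ξ) x v := by
      intro i j
      have h2 : frameCoordSection x i j (c • ξ) = fun y => c • frameCoordSection x i j ξ y := by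
        funext y
        exact (congrArg _ (map_smul (evalAt y) c ξ)).trans (map_smul _ _ _)
      rw [h2]
      exact SpinStructure.cov_smul_const (B.isStarFrameOn_chartFrame x).isOpen
        (smooth_frameCoordSection x i j ξ) (B.mem_chartSet x) c v
    simp only [h, map_smul, TensorProduct.tmul_smul, ← Finset.smul_sum, smul_add,
      RingHom.id_apply]

/-- The twisted connection is `∇^B ⊗ 1 + 1 ⊗ ∇^S`. -/
theorem twistedCov_twist [NeZero N] (nabla : StarConnection B) (x : M)
    (v : TangentSpace 𝓘(ℝ, E4) x) (s : B.sections) (ψ : S.sections) :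
    twistedCov nabla x v (twist s ψ) =
      nabla.cov s x v ⊗ₜ[ℂ] ψ.1 x + s.1 x ⊗ₜ[ℂ] S.cov ψ x v := by
  have hΘ := B.isStarFrameOn_chartFrame x
  have hx := B.mem_chartSet x
  set Θ := B.chartFrame x with hΘdef
  let f : M → Mat N := fun y => (Θ y).symm (s.1 y)
  have hf : SmoothFunAt f x := hΘ.smoothFunAt_symm hx (s.2.contMDiffAt isOpen_univ trivial)
  have h1 : nabla.cov s x v = Θ x (mvfderiv 𝓘(ℝ, E4) f x v + ⁅connForm nabla Θ x v, f x⁆) :=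
    (isConnFormOn_connForm nabla hΘ).cov_eq hΘ hx hf
      (Eventually.of_forall fun y => ((Θ y).apply_symm_apply _).symm) v
  have h2 : ∀ i j, S.cov (frameCoordSection x i j (twist s ψ)) x v =
      f x i j • S.cov ψ x v + (mvfderiv 𝓘(ℝ, E4) f x v : Mat N) i j • ψ.1 x := by
    intro i j
    have h3 := SpinStructure.cov_smul_fun
      (hf.linearMap_comp (Matrix.entryLinearMap ℝ ℂ i j)) ψ.2 v
    rw [mvfderiv_linearMap_comp (Matrix.entryLinearMap ℝ ℂ i j)
      (hf.mdifferentiableAt (by simp))] at h3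
    exact h3
  have h4 := (Θ x).sum_smul_single (s.1 x)
  have h5 := (Θ x).sum_smul_single (Θ x (mvfderiv 𝓘(ℝ, E4) f x v))
  rw [StarAlgEquiv.symm_apply_apply] at h5
  change Θ x ⁅connForm nabla Θ x v, f x⁆ ⊗ₜ[ℂ] ψ.1 x +
    ∑ i, ∑ j, Θ x (Matrix.single i j 1) ⊗ₜ[ℂ] S.cov (frameCoordSection x i j (twist s ψ)) x v = _
  simp only [h2, TensorProduct.tmul_add, TensorProduct.tmul_smul, TensorProduct.smul_tmul',
    Finset.sum_add_distrib]
  simp only [← TensorProduct.sum_tmul]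
  rw [h5]
  have h6 : ∑ i, ∑ j, f x i j • Θ x (Matrix.single i j 1) = s.1 x := h4
  rw [h6, h1, map_add, TensorProduct.add_tmul]
  abel

/-- The value at `x` of the twisted Dirac operator. -/
noncomputable def diracAt (nabla : StarConnection B) (x : M) :
    PreL2 S B →ₗ[ℂ] B.Fiber x ⊗[ℂ] S.Fiber x :=
  haveI : FiniteDimensional ℝ (TangentSpace 𝓘(ℝ, E4) x) :=
    inferInstanceAs (FiniteDimensional ℝ E4)
  let e := stdOrthonormalBasis ℝ (TangentSpace 𝓘(ℝ, E4) x)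
  Complex.I • ∑ μ, (S.clifford x (e μ)).lTensor (B.Fiber x) ∘ₗ twistedCov nabla x (e μ)

theorem diracAt_twist [NeZero N] (nabla : StarConnection B) (x : M) (s : B.sections)
    (ψ : S.sections) : diracAt nabla x (twist s ψ) = twistedDirac S nabla s ψ x := by
  have : FiniteDimensional ℝ (TangentSpace 𝓘(ℝ, E4) x) :=
    inferInstanceAs (FiniteDimensional ℝ E4)
  have h : ∀ ξ : PreL2 S B, diracAt nabla x ξ = Complex.I • ∑ μ,
      (S.clifford x (stdOrthonormalBasis ℝ (TangentSpace 𝓘(ℝ, E4) x) μ)).lTensor (B.Fiber x)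
        (twistedCov nabla x (stdOrthonormalBasis ℝ (TangentSpace 𝓘(ℝ, E4) x) μ) ξ) := fun ξ => by
    simp [diracAt]
  refine (h _).trans ?_
  simp only [twistedCov_twist, map_add, LinearMap.lTensor_tmul]
  rfl

variable [CompactSpace M]
  [IsContMDiffRiemannianBundle 𝓘(ℝ, E4) ∞ E4 (fun x : M => TangentSpace 𝓘(ℝ, E4) x)]

/-- The twisted Dirac operator maps smooth sections to smooth sections: the trace over the
orthonormal basis is a finite sum over global smooth vector fields. -/
theorem twistedDirac_mem (nabla : StarConnection B) (s : B.sections) (ψ : S.sections) :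
    (fun x => twistedDirac S nabla s ψ x) ∈ TwistedSpinors S B := by
  obtain ⟨F, X, Y, hX, hY, hXY⟩ := exists_fields_sum_inner (M := M)
  let sX : M × Fin 4 → B.sections := fun k => ⟨fun x => nabla.cov s x (X k x), fun x _ =>
    (nabla.cov_apply_contMDiffAt isOpen_univ s.2 (Set.mem_univ x) (hX k)).contMDiffWithinAt⟩
  let ψX : M × Fin 4 → S.sections := fun k => ⟨fun x => S.cov ψ x (X k x), fun x _ =>
    (((S.cov_smooth.contMDiff.contMDiff (σ := ψ.1) ψ.2).contMDiffAt
      (x := x) univ_mem).clm_bundle_apply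
        ((hX k).contMDiffAt isOpen_univ (Set.mem_univ x))).contMDiffWithinAt⟩
  let γY : M × Fin 4 → S.sections → S.sections := fun k φ =>
    ⟨fun x => S.clifford x (Y k x) (φ.1 x), S.clifford_smooth _ _ (hY k) φ.2⟩
  have h : (fun x => twistedDirac S nabla s ψ x) = Complex.I • ∑ k ∈ F,
      ((twist (sX k) (γY k ψ)).1 + (twist s (γY k (ψX k))).1) := by
    funext x
    have : FiniteDimensional ℝ (TangentSpace 𝓘(ℝ, E4) x) :=
      inferInstanceAs (FiniteDimensional ℝ E4)
    let β : TangentSpace 𝓘(ℝ, E4) x →ₗ[ℝ] TangentSpace 𝓘(ℝ, E4) x →ₗ[ℝ]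
        B.Fiber x ⊗[ℂ] S.Fiber x :=
      LinearMap.mk₂ ℝ (fun v w => nabla.cov s x v ⊗ₜ[ℂ] S.clifford x w (ψ.1 x) +
          s.1 x ⊗ₜ[ℂ] S.clifford x w (S.cov ψ x v))
        (fun v v' w => by simp only [map_add, TensorProduct.tmul_add, TensorProduct.add_tmul]; abel)
        (fun r v w => by
          simp only [map_smul]
          rw [TensorProduct.smul_tmul'_real, (S.clifford x w).map_smul_of_tower r,
            TensorProduct.tmul_smul_real, smul_add])
        (fun v w w' => by
          simp only [map_add, LinearMap.add_apply, TensorProduct.tmul_add]; abel)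
        (fun r v w => by
          simp only [map_smul, LinearMap.smul_apply]
          rw [TensorProduct.tmul_smul_real, TensorProduct.tmul_smul_real, smul_add])
    have hβ := (stdOrthonormalBasis ℝ (TangentSpace 𝓘(ℝ, E4) x)).sum_bilin_eq β F
      (fun k => X k x) (fun k => Y k x) (hXY x)
    rw [Pi.smul_apply, Finset.sum_apply]
    exact congrArg (Complex.I • ·) hβ.symm
  rw [h]
  exact Submodule.smul_mem _ _ (Submodule.sum_mem _ fun k _ =>
    Submodule.add_mem _ (twist (sX k) (γY k ψ)).2 (twist s (γY k (ψX k))).2)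

/-- The twisted Dirac operator on `Γ(M, B ⊗ S)`. -/
noncomputable def diracOp [NeZero N] (nabla : StarConnection B) : PreL2 S B →ₗ[ℂ] PreL2 S B where
  toFun ξ := ⟨fun x => diracAt nabla x ξ, by
    obtain ⟨ξ, hξ⟩ := ξ
    induction hξ using Submodule.span_induction with
    | mem ξ h =>
      obtain ⟨s, ψ, rfl⟩ := h
      exact (funext fun x => diracAt_twist nabla x s ψ : _ = _) ▸ twistedDirac_mem nabla s ψ
    | zero =>
      exact (funext fun x => map_zero (diracAt nabla x) : _ = _) ▸ Submodule.zero_mem _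
    | add ξ ξ' hξ hξ' h h' =>
      refine (funext fun x => map_add (diracAt nabla x) ⟨ξ, hξ⟩ ⟨ξ', hξ'⟩ : _ = _) ▸ ?_
      exact Submodule.add_mem _ h h'
    | smul c ξ hξ h =>
      refine (funext fun x => map_smul (diracAt nabla x) c ⟨ξ, hξ⟩ : _ = _) ▸ ?_
      exact Submodule.smul_mem _ c h⟩
  map_add' ξ η := Subtype.ext (funext fun x => map_add (diracAt nabla x) ξ η)
  map_smul' c ξ := Subtype.ext (funext fun x => map_smul (diracAt nabla x) c ξ)

theorem diracOp_twist [NeZero N] (nabla : StarConnection B) (s : B.sections) (ψ : S.sections)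
    (x : M) : evalAt x (diracOp nabla (twist s ψ)) = twistedDirac S nabla s ψ x :=
  diracAt_twist nabla x s ψ

variable [MeasurableSpace M] [BorelSpace M]

/-- The twisted Dirac operator as an unbounded operator on `L²(M, B ⊗ S)` with domain
`Γ(M, B ⊗ S)`. -/
noncomputable def diracL2 [NeZero N] (nabla : StarConnection B) : L2 S B →ₗ.[ℂ] L2 S B where
  domain := LinearMap.range (toL2 S B)
  toFun := toL2 S B ∘ₗ diracOp nabla ∘ₗ
    (LinearEquiv.ofInjective (toL2 S B) toL2_injective).symm.toLinearMap

theorem diracL2_toL2 [NeZero N] (nabla : StarConnection B) (ξ : PreL2 S B)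
    (h : toL2 S B ξ ∈ (diracL2 (S := S) nabla).domain) :
    diracL2 nabla ⟨toL2 S B ξ, h⟩ = toL2 S B (diracOp nabla ξ) := by
  have h2 : (LinearEquiv.ofInjective (toL2 S B) toL2_injective).symm ⟨toL2 S B ξ, h⟩ = ξ :=
    (LinearEquiv.symm_apply_eq _).2 (Subtype.ext rfl)
  exact congrArg (fun η => toL2 S B (diracOp nabla η)) h2

end Dirac

/-- Every endomorphism bundle with a hermitian `*`-algebra connection has a spectral triple. -/
theorem exists_spectralTriple {M : Type u} [TopologicalSpace M] [T2Space M] [CompactSpace M]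
    [ChartedSpace E4 M] [IsManifold 𝓘(ℝ, E4) ∞ M]
    [RiemannianBundle (fun x : M => TangentSpace 𝓘(ℝ, E4) x)]
    [IsContMDiffRiemannianBundle 𝓘(ℝ, E4) ∞ E4 (fun x : M => TangentSpace 𝓘(ℝ, E4) x)]
    [MeasurableSpace M] [BorelSpace M] (S : SpinStructure.{u, s} M) {N : ℕ} [NeZero N]
    {B : EndBundle.{u, 0} M N} (nabla : StarConnection B) :
    ∃ T : SpectralTripleData.{u, max u s} B.sections, ∃ ι, IsYangMillsTriple S nabla T ι := by
  refine ⟨{ H := L2 S B, rep := repL2 S B, D := (diracL2 nabla).closure, J := conjL2 S B,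
            grading := gradingL2 S B }, toL2 S B, ?_⟩
  exact
    { dense := denseRange_toL2
      inner_eq := inner_toL2_twist
      rep_eq := fun a s ψ => leftMulL2_coe a _
      J_eq := fun s ψ => conjL2_coe _
      grading_eq := fun s ψ => gradingL2_coe _
      dirac_eq := ⟨diracL2 nabla, rfl, rfl, fun s ψ =>
        ⟨diracOp nabla (twist s ψ), fun x => diracOp_twist nabla s ψ x,
          fun h => diracL2_toL2 nabla _ h⟩⟩ }

theorem mainTheorem4 {M : Type u} [TopologicalSpace M] [T2Space M] [CompactSpace M]
    [ChartedSpace E4 M] [IsManifold 𝓘(ℝ, E4) ∞ M]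
    [RiemannianBundle (fun x : M => TangentSpace 𝓘(ℝ, E4) x)]
    [IsContMDiffRiemannianBundle 𝓘(ℝ, E4) ∞ E4 (fun x : M => TangentSpace 𝓘(ℝ, E4) x)]
    [MeasurableSpace M] [BorelSpace M] (S : SpinStructure.{u, s} M) (N : ℕ) [NeZero N] :
    (∀ T : YangMillsTriple.{u, s, v, h} S N,
      ∃ G : GaugeTheory.{u, u} M N, IsGaugeTheoryOf G T ∧
        ∀ G' : GaugeTheory.{u, z} M N, IsGaugeTheoryOf G' T → Nonempty (GaugeTheory.Iso G' G)) ∧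
    (∀ G : GaugeTheory.{u, w} M N,
      ∃ T : YangMillsTriple.{u, s, 0, max u s} S N, IsGaugeTheoryOf G T ∧
        ∀ G' : GaugeTheory.{u, z} M N, IsGaugeTheoryOf G' T → Nonempty (GaugeTheory.Iso G' G)) := by
  refine ⟨fun T => ?_, fun G => ?_⟩
  · refine ⟨EndBundle.gaugeTheory T.nabla, ⟨_, EndBundle.induces_gaugeTheory T.nabla⟩, ?_⟩
    rintro G' ⟨Φ, hΦ⟩
    exact GaugeTheory.nonempty_iso hΦ (EndBundle.induces_gaugeTheory T.nabla)
  · obtain ⟨T, hT⟩ := exists_spectralTriple S G.assocConnection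
    refine ⟨⟨G.P.assocBundle, G.assocConnection, T, hT⟩, ⟨_, G.induces_assocConnection⟩, ?_⟩
    rintro G' ⟨Φ, hΦ⟩
    exact GaugeTheory.nonempty_iso hΦ G.induces_assocConnection
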